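/- **Setting.** Let $(\Omega,\mathcal F,\mathbb P)$ be a complete probability space with an ergodic measure-preserving action $(\tau_x)_{x\in\mathbb R}$ of $\mathbb R$: $\tau_0=\mathrm{id}$, $\tau_{x+y}=\tau_x\circ\tau_y$, every $\tau_x$ is measurable and preserves $\mathbb P$, and every measurable $\varphi:\Omega\to\mathbb R$ such that, for each $x\in\mathbb R$, $\varphi\circ\tau_x=\varphi$ almost surely, is almost surely constant. Let $a:\mathbb R\times\Omega\to[0,1]$ and $H:\mathbb R\times\mathbb R\times\Omega\to\mathbb R$ be jointly measurable and stationary, i.e. $a(x+y,\omega)=a(x,\tau_y\omega)$ and $H(x+y,p,\omega)=H(x,p,\tau_y\omega)$ for all $x,y,p,\omega$. Let $\kappa,\alpha_0,\alpha_1,\eta>0$ and $\gamma>2$ be constants such that * for a.e. $\omega$, $a(\cdot,\omega)\not\equiv0$ and $\min_{\mathbb R}a(\cdot,\omega)=0$; for every $\omega$, $\sqrt{a(\cdot,\omega)}$ is $\kappa$-Lipschitz; * for all $x,y,p,q,\omega$: $\alpha_0|p|^\gamma-1/\alpha_0\le H(x,p,\omega)\le\alpha_1(|p|^\gamma+1)$,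 $\;|H(x,p,\omega)-H(x,q,\omega)|\le\alpha_1(|p|+|q|+1)^{\gamma-1}|p-q|$, $\;|H(x,p,\omega)-H(y,p,\omega)|\le\alpha_1(|p|^\gamma+1)|x-y|$; * for all $x,\omega$: $H(x,(1-s)p_0+sp_1,\omega)<\max\{H(x,p_0,\omega),H(x,p_1,\omega)\}$ for all $p_0\ne p_1$, $s\in(0,1)$, and, with $\hat p(x,\omega)$ the minimizer of $H(x,\cdot,\omega)$, $H(x,p_1,\omega)-H(x,p_2,\omega)\ge\eta|p_1-p_2|$ for $p_1<p_2\le\hat p(x,\omega)$ and $H(x,p_2,\omega)-H(x,p_1,\omega)\ge\eta|p_1-p_2|$ for $p_2>p_1\ge\hat p(x,\omega)$. For $\lambda\in\mathbb R$ consider the equation $$a(x,\omega)u''+H(x,u',\omega)=\lambda\quad\text{in }\mathbb R,\tag{$\mathrm{HJ}_\lambda(\omega)$}$$ whose solutions, sub- and supersolutions are continuous and understood in the viscosity sense (a $C^2$ supersolution satisfies $au''+H\le\lambda$), and put $\lambda_0(\omega):=\inf\{\lambda:\ (\mathrm{HJ}_\lambda(\omega))\text{ has a supersolution}\}$. **Theorem.**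 The function $\lambda_0(\cdot)$ is almost surely equal to a constant $\lambda_0\in\mathbb R$. The set $\Omega_{0}$ of all $\omega$ such that $\lambda_0(\omega)=\lambda_0$, $a(\cdot,\omega)\not\equiv0$ and every connected component of $\{a(\cdot,\omega)>0\}$ is bounded has probability $1$ and is invariant under all $\tau_z$. Let $\hat\Omega\subseteq\Omega_{0}$ be any set of probability $1$. For every $\omega\in\hat\Omega$ there is a Lipschitz solution $u_{\lambda_0}(\cdot,\omega)$ of $(\mathrm{HJ}_{\lambda_0}(\omega))$ with $u_{\lambda_0}(0,\omega)=0$. Choose one for each $\omega\in\hat\Omega$ in an arbitrary way, and set $u_{\lambda_0}(\cdot,\omega)\equiv0$ for $\omega\notin\hat\Omega$. For $\lambda>\lambda_0$ and $\omega\in\hat\Omega$ let $\mathcal S^+_\lambda(\omega)$ (resp. $\mathcal S^-_\lambda(\omega)$) be the set of Lipschitz solutions $u$ of $(\mathrm{HJ}_\lambda(\omega))$ with $u'\ge u_{\lambda_0}'(\cdot,\omega)$ (resp. $u'\le u_{\lambda_0}'(\cdot,\omega)$) a.e. in $\mathbb R$; for $\omega\notin\hat\Omega$ let both be the set of constant functions.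 Then, for every $\lambda>\lambda_0$: (a) for every $\omega\in\Omega$ there is a unique $u^+_\lambda(\cdot,\omega)\in\mathcal S^+_\lambda(\omega)$ with $u^+_\lambda(0,\omega)=0$, and it is of class $C^1$ on $\mathbb R$; (b) for every $\omega\in\Omega$ there is a unique $u^-_\lambda(\cdot,\omega)\in\mathcal S^-_\lambda(\omega)$ with $u^-_\lambda(0,\omega)=0$, and it is of class $C^1$ on $\mathbb R$. Moreover, $u^\pm_\lambda:\mathbb R\times\Omega\to\mathbb R$ are measurable with respect to the product of the Borel $\sigma$-algebra of $\mathbb R$ and $\mathcal F$, and their derivatives are stationary: for every $z\in\mathbb R$, almost surely, $(u^\pm_\lambda)'(x+z,\omega)=(u^\pm_\lambda)'(x,\tau_z\omega)$ for all $x\in\mathbb R$; if $\hat\Omega$ is invariant under all $\tau_z$ (for instance $\hat\Omega=\Omega_{0}$), this holds for all $x,z\in\mathbb R$ and every $\omega\in\Omega$. -/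

import Mathlib

open MeasureTheory

/-- `u` is a (continuous) viscosity supersolution of `a(x) u'' + H(x, u') = lam` in `ℝ`. -/
def IsViscositySupersolution (a : ℝ → ℝ) (H : ℝ → ℝ → ℝ) (lam : ℝ) (u : ℝ → ℝ) : Prop :=
  Continuous u ∧ ∀ φ : ℝ → ℝ, ContDiff ℝ 2 φ → ∀ x : ℝ,
    IsLocalMin (fun y => u y - φ y) x →
      a x * deriv (deriv φ) x + H x (deriv φ x) ≤ lam

/-- `u` is a (continuous) viscosity subsolution of `a(x) u'' + H(x, u') = lam` in `ℝ`. -/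
def IsViscositySubsolution (a : ℝ → ℝ) (H : ℝ → ℝ → ℝ) (lam : ℝ) (u : ℝ → ℝ) : Prop :=
  Continuous u ∧ ∀ φ : ℝ → ℝ, ContDiff ℝ 2 φ → ∀ x : ℝ,
    IsLocalMax (fun y => u y - φ y) x →
      lam ≤ a x * deriv (deriv φ) x + H x (deriv φ x)

/-- `u` is a (continuous) viscosity solution of `a(x) u'' + H(x, u') = lam` in `ℝ`. -/
def IsViscositySolution (a : ℝ → ℝ) (H : ℝ → ℝ → ℝ) (lam : ℝ) (u : ℝ → ℝ) : Prop :=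
  IsViscositySubsolution a H lam u ∧ IsViscositySupersolution a H lam u

/-- The critical value of the pair `(a, H)`: the infimum of the levels `lam` at which the
equation `a(x) u'' + H(x, u') = lam` has a continuous viscosity supersolution. -/
noncomputable def criticalValue (a : ℝ → ℝ) (H : ℝ → ℝ → ℝ) : ℝ :=
  sInf {lam : ℝ | ∃ u : ℝ → ℝ, IsViscositySupersolution a H lam u}

/-- `u` is globally Lipschitz on `ℝ`. -/
def IsLip (u : ℝ → ℝ) : Prop := ∃ K : NNReal, LipschitzWith K u

/-- The growth and regularity class of Hamiltonians with constants `α₀`, `α₁`, `γ`. -/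
structure HamiltonianClass (α₀ α₁ γ : ℝ) (H : ℝ → ℝ → ℝ) : Prop where
  growth_lower : ∀ x p, α₀ * |p| ^ γ - 1 / α₀ ≤ H x p
  growth_upper : ∀ x p, H x p ≤ α₁ * (|p| ^ γ + 1)
  lipschitz_momentum : ∀ x p q,
    |H x p - H x q| ≤ α₁ * (|p| + |q| + 1) ^ (γ - 1) * |p - q|
  lipschitz_space : ∀ x y p, |H x p - H y p| ≤ α₁ * (|p| ^ γ + 1) * |x - y|

/-- Strictly quasiconvex Hamiltonians of the previous class which are, in the momentum, at least
`η`-steep on each side of the minimizer `phat` of `H x`. -/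
structure SqcHamiltonianClass (α₀ α₁ γ η : ℝ) (H : ℝ → ℝ → ℝ) : Prop
    extends HamiltonianClass α₀ α₁ γ H where
  strict_quasiconvex : ∀ x p₀ p₁ s : ℝ, p₀ ≠ p₁ → 0 < s → s < 1 →
    H x ((1 - s) * p₀ + s * p₁) < max (H x p₀) (H x p₁)
  steep_left : ∀ x phat : ℝ, (∀ p, H x phat ≤ H x p) →
    ∀ p₁ p₂, p₁ < p₂ → p₂ ≤ phat → η * |p₁ - p₂| ≤ H x p₁ - H x p₂
  steep_right : ∀ x phat : ℝ, (∀ p, H x phat ≤ H x p) →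
    ∀ p₁ p₂, phat ≤ p₁ → p₁ < p₂ → η * |p₁ - p₂| ≤ H x p₂ - H x p₁

/-- `a` is not identically zero and every connected component of `{a > 0}` is bounded. -/
def HasBoundedComponents (a : ℝ → ℝ) : Prop :=
  (∃ x, a x ≠ 0) ∧
    ∀ x, 0 < a x → Bornology.IsBounded (connectedComponentIn {y | 0 < a y} x)

/-- A measure preserving ergodic action of `ℝ` on the probability space `(Ω, P)`. -/
structure IsErgodicFlow {Ω : Type*} [MeasurableSpace Ω] (P : Measure Ω) (τ : ℝ → Ω → Ω) :
    Prop where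
  zero : ∀ ω, τ 0 ω = ω
  add : ∀ x y ω, τ (x + y) ω = τ x (τ y ω)
  measurePreserving : ∀ x, MeasurePreserving (τ x) P P
  ergodic : ∀ φ : Ω → ℝ, Measurable φ → (∀ x, ∀ᵐ ω ∂P, φ (τ x ω) = φ ω) →
    ∃ c : ℝ, ∀ᵐ ω ∂P, φ ω = c

/-- The set of all `ω` for which `{a(·, ω) > 0}` is nonempty with bounded components and for which
the critical value is `lam0`. -/
def regularSet {Ω : Type*} (a : ℝ → Ω → ℝ) (H : ℝ → ℝ → Ω → ℝ) (lam0 : ℝ) : Set Ω :=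
  {ω | HasBoundedComponents (fun x => a x ω) ∧
    criticalValue (fun x => a x ω) (fun x p => H x p ω) = lam0}

/-- A choice, `ω` by `ω` (no measurability), of Lipschitz solutions at the critical level `lam0`
which vanish at the origin, extended by zero outside `Ωhat`. -/
def IsCriticalFamily {Ω : Type*} (a : ℝ → Ω → ℝ) (H : ℝ → ℝ → Ω → ℝ) (lam0 : ℝ)
    (Ωhat : Set Ω) (v : Ω → ℝ → ℝ) : Prop :=
  (∀ ω ∈ Ωhat, IsLip (v ω) ∧
    IsViscositySolution (fun x => a x ω) (fun x p => H x p ω) lam0 (v ω) ∧ v ω 0 = 0) ∧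
  ∀ ω ∉ Ωhat, ∀ x, v ω x = 0

/-- Lipschitz solutions at level `lam` with derivative a.e. above that of `v ω`;
the constants if `ω ∉ Ωhat`. -/
def correctorsPlus {Ω : Type*} (a : ℝ → Ω → ℝ) (H : ℝ → ℝ → Ω → ℝ) (Ωhat : Set Ω)
    (v : Ω → ℝ → ℝ) (lam : ℝ) (ω : Ω) : Set (ℝ → ℝ) :=
  {u | (ω ∈ Ωhat ∧ IsLip u ∧
      IsViscositySolution (fun x => a x ω) (fun x p => H x p ω) lam u ∧
      ∀ᵐ x : ℝ, deriv (v ω) x ≤ deriv u x) ∨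
    (ω ∉ Ωhat ∧ ∃ c : ℝ, u = fun _ => c)}

/-- Lipschitz solutions at level `lam` with derivative a.e. below that of `v ω`;
the constants if `ω ∉ Ωhat`. -/
def correctorsMinus {Ω : Type*} (a : ℝ → Ω → ℝ) (H : ℝ → ℝ → Ω → ℝ) (Ωhat : Set Ω)
    (v : Ω → ℝ → ℝ) (lam : ℝ) (ω : Ω) : Set (ℝ → ℝ) :=
  {u | (ω ∈ Ωhat ∧ IsLip u ∧
      IsViscositySolution (fun x => a x ω) (fun x p => H x p ω) lam u ∧
      ∀ᵐ x : ℝ, deriv u x ≤ deriv (v ω) x) ∨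
    (ω ∉ Ωhat ∧ ∃ c : ℝ, u = fun _ => c)}

/-- The derivative of `U` in `x` is stationary: for every shift `z` the identity
`U'(x + z, ω) = U'(x, τ_z ω)` holds almost surely for all `x`, and it holds for every `ω` without
exception if the set `Ωhat` is invariant under the flow. -/
def HasStationaryDeriv {Ω : Type*} [MeasurableSpace Ω] (P : Measure Ω) (τ : ℝ → Ω → Ω)
    (Ωhat : Set Ω) (U : ℝ → Ω → ℝ) : Prop :=
  (∀ z, ∀ᵐ ω ∂P, ∀ x, deriv (fun y => U y ω) (x + z) = deriv (fun y => U y (τ z ω)) x) ∧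
  ((∀ z ω, τ z ω ∈ Ωhat ↔ ω ∈ Ωhat) →
    ∀ z ω x, deriv (fun y => U y ω) (x + z) = deriv (fun y => U y (τ z ω)) x)

/-! In one dimension the equation only sees the slope p = u'. Where a > 0 it is the ODE a p' + H(x,
p) = lam; where a = 0 it reduces to H(x, p) = lam, which by strict quasiconvexity has a larger and a
smaller root once H(x, ·) takes values below lam. For lam above the critical value, every Lipschitz
solution whose slope lies above that of a critical solution is a primitive of one function, the
upper profile (`IsUpperProfile`): the larger root at zeros of a and, on each component (l, r) of {a
> 0}, the only bounded solution of the ODE issuing from the larger root at l. The profile depends on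
a, H and lam alone, so the arbitrary choice of critical solutions is harmless.

Uniqueness. Since a vanishes quadratically at l, 1/a is not integrable there, and a bounded slope
must converge at l to a root of H(l, ·) = lam (`Admissible.exists_tendsto_left`). Lying above a
solution of lower level forces the larger root. Past the larger root H increases in p, so the
positive part of the difference of two such solutions cannot grow from its limit 0 at l
(`SolvesOnIoo.eq_of_tendsto`).

Existence. H grows faster than p² while a ≤ 1, so a supersolution obeys one-sided logarithmic growth
bounds, and its presence at a lower level prevents an ODE slope from falling from a high value R to
-R (`IsViscositySupersolution.not_descends`). Slopes started at R thus stay bounded; limits over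
growing intervals give solutions on components, a lower-level solution kept underneath selects the
larger root at both ends, and the glued function is continuous (`Admissible.exists_isUpperProfile`).
Letting the level decrease to the critical one yields a critical solution.

Randomness. The events "critical value < lam" and "profile at x < t" are, up to null sets, countable
combinations of measurable conditions, by comparison with a countable family of C¹ functions dense
on every interval. Shift invariance and ergodicity then make the critical value constant, and
uniqueness of the profile makes the derivative stationary. The lower solutions follow from the
reflection (x, p) ↦ (-x, -p). -/

open Filter Topology Set

/-! ### Viscosity inequalities tested with parabolas -/

/-- The parabola with slope `p` and curvature `s` touches `u` from below at `x`. -/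
def TouchesBelow (u : ℝ → ℝ) (x p s : ℝ) : Prop :=
  ∀ᶠ y in 𝓝 x, u x + p * (y - x) + s / 2 * (y - x) ^ 2 ≤ u y

lemma hasDerivAt_parabola (A p s x y : ℝ) :
    HasDerivAt (fun y => A + p * (y - x) + s / 2 * (y - x) ^ 2) (p + s * (y - x)) y := by
  have h2 : HasDerivAt (fun y : ℝ => y - x) 1 y := (hasDerivAt_id y).sub_const x
  refine (((h2.const_mul p).const_add A).fun_add ((h2.fun_pow 2).const_mul (s / 2))).congr_deriv ?_
  push_cast
  ring

/-- The derivative of φ minus the parabola has the sign of y - x, or vanishes, on each side of x,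
and the mean value theorem integrates this. Only slope bounds for P are required, so φ need not be
C² around x. -/
lemma touchesBelow_of_hasDerivAt {φ P : ℝ → ℝ} {x s : ℝ}
    (h : ∀ᶠ y in 𝓝 x, HasDerivAt φ (P y) y)
    (hr : ∀ᶠ y in 𝓝[>] x, P x + s * (y - x) ≤ P y)
    (hl : ∀ᶠ y in 𝓝[<] x, P y ≤ P x + s * (y - x)) :
    TouchesBelow φ x (P x) s := by
  obtain ⟨ε, hε, hb⟩ := Metric.eventually_nhds_iff.1 h
  obtain ⟨r, hxr, hr⟩ := (mem_nhdsGT_iff_exists_Ioo_subset).1 hr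
  obtain ⟨l, hlx, hl⟩ := (mem_nhdsLT_iff_exists_Ioo_subset).1 hl
  simp only [mem_Ioi, mem_Iio] at hxr hlx
  set f : ℝ → ℝ := fun y => φ y - (φ x + P x * (y - x) + s / 2 * (y - x) ^ 2) with hf
  have hfx : f x = 0 := by simp [hf]
  have hd : ∀ y, dist y x < ε → HasDerivAt f (P y - (P x + s * (y - x))) y := by
    intro y hy
    exact (hb hy).fun_sub (hasDerivAt_parabola _ _ _ _ _)
  have key : ∀ y, dist y x < ε → l < y → y < r → 0 ≤ f y := by
    intro y hy hly hyr
    rcases lt_trichotomy y x with hyx | rfl | hyx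
    · have hsub : ∀ z ∈ Icc y x, dist z x < ε := fun z hz => by
        rw [Real.dist_eq, abs_lt] at hy ⊢; constructor <;> linarith [hz.1, hz.2]
      obtain ⟨z, hz, hz'⟩ := exists_hasDerivAt_eq_slope f _ hyx
        (fun z hz => (hd z (hsub z hz)).continuousAt.continuousWithinAt)
        (fun z hz => hd z (hsub z (Ioo_subset_Icc_self hz)))
      have h2 := hl (show z ∈ Ioo l x from ⟨hly.trans hz.1, hz.2⟩)
      simp only [mem_ofPred_eq] at h2
      rw [eq_div_iff (by linarith), hfx] at hz'
      nlinarith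
    · exact hfx.ge
    · have hsub : ∀ z ∈ Icc x y, dist z x < ε := fun z hz => by
        rw [Real.dist_eq, abs_lt] at hy ⊢; constructor <;> linarith [hz.1, hz.2]
      obtain ⟨z, hz, hz'⟩ := exists_hasDerivAt_eq_slope f _ hyx
        (fun z hz => (hd z (hsub z hz)).continuousAt.continuousWithinAt)
        (fun z hz => hd z (hsub z (Ioo_subset_Icc_self hz)))
      have h2 := hr (show z ∈ Ioo x r from ⟨hz.1, hz.2.trans hyr⟩)
      simp only [mem_ofPred_eq] at h2
      rw [eq_div_iff (by linarith), hfx] at hz'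
      nlinarith
  filter_upwards [Metric.ball_mem_nhds x hε, Ioi_mem_nhds hlx, Iio_mem_nhds hxr] with y h1 h2 h3
  have := key y h1 h2 h3
  simp only [hf] at this
  linarith

lemma eventually_le_of_hasDerivWithinAt_Ioi {P : ℝ → ℝ} {x s s₁ : ℝ}
    (h : HasDerivWithinAt P s₁ (Ioi x) x) (hs : s < s₁) :
    ∀ᶠ y in 𝓝[>] x, P x + s * (y - x) ≤ P y := by
  have h1 := (hasDerivWithinAt_iff_tendsto_slope' (by simp)).1 h
  filter_upwards [h1.eventually (lt_mem_nhds hs), self_mem_nhdsWithin] with y hy hxy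
  simp only [mem_Ioi] at hxy
  rw [slope_def_field, lt_div_iff₀ (by linarith)] at hy
  linarith

lemma eventually_le_of_hasDerivWithinAt_Iio {P : ℝ → ℝ} {x s s₁ : ℝ}
    (h : HasDerivWithinAt P s₁ (Iio x) x) (hs : s < s₁) :
    ∀ᶠ y in 𝓝[<] x, P y ≤ P x + s * (y - x) := by
  have h1 := (hasDerivWithinAt_iff_tendsto_slope' (by simp)).1 h
  filter_upwards [h1.eventually (lt_mem_nhds hs), self_mem_nhdsWithin] with y hy hxy
  simp only [mem_Iio] at hxy
  rw [slope_def_field, lt_div_iff_of_neg (by linarith)] at hy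
  linarith

lemma TouchesBelow.of_isLocalMin {u φ : ℝ → ℝ} {x p s : ℝ}
    (hmin : IsLocalMin (fun y => u y - φ y) x) (h : TouchesBelow φ x p s) :
    TouchesBelow u x p s := by
  filter_upwards [hmin, h] with y h1 h2
  linarith

/-- Parabolas suffice as test functions: a C² function is touched from below by the parabola with
its slope and with curvature lowered by any δ > 0. The loss a x * δ is then sent to zero. -/
lemma isViscositySupersolution_iff {a : ℝ → ℝ} {H : ℝ → ℝ → ℝ} {lam : ℝ} {u : ℝ → ℝ} :
    IsViscositySupersolution a H lam u ↔
      Continuous u ∧ ∀ x p s, TouchesBelow u x p s → a x * s + H x p ≤ lam := by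
  refine and_congr_right fun _ => ⟨fun h x p s ht => ?_, fun h φ hφ x hmin => ?_⟩
  · set φ : ℝ → ℝ := fun y => u x + p * (y - x) + s / 2 * (y - x) ^ 2 with hφ
    have hd : ∀ y, HasDerivAt φ (p + s * (y - x)) y := fun y => hasDerivAt_parabola _ _ _ _ _
    have hd1 : deriv φ = fun y => p + s * (y - x) := funext fun y => (hd y).deriv
    have hd2 : deriv (deriv φ) x = s := by
      rw [hd1]
      simp
    have := h φ (by simp only [hφ]; fun_prop) x (by
      filter_upwards [ht] with y hy
      simp only [hφ]; simp only [sub_self, mul_zero, ne_eq, OfNat.ofNat_ne_zero,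
        not_false_eq_true, zero_pow, add_zero]; linarith)
    rw [hd2, hd1] at this
    simpa using this
  · refine le_of_forall_pos_le_add fun ε hε => ?_
    have hd : ∀ y, HasDerivAt φ (deriv φ y) y := fun y =>
      (hφ.differentiable (by norm_num)).differentiableAt.hasDerivAt
    have hd2 : HasDerivAt (deriv φ) (deriv (deriv φ) x) x := by
      have : ContDiff ℝ 1 (deriv φ) := by
        have := (contDiff_succ_iff_deriv (n := 1) (f := φ)).1 (by simpa [one_add_one_eq_two] using hφ)
        exact this.2.2
      exact (this.differentiable (by norm_num)).differentiableAt.hasDerivAt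
    have ha : 0 < |a x| + 1 := by positivity
    set δ := ε / (|a x| + 1) with hδ
    have hδ0 : 0 < δ := by positivity
    have ht : TouchesBelow φ x (deriv φ x) (deriv (deriv φ) x - δ) :=
      touchesBelow_of_hasDerivAt (Eventually.of_forall hd)
        (eventually_le_of_hasDerivWithinAt_Ioi hd2.hasDerivWithinAt (by linarith))
        (eventually_le_of_hasDerivWithinAt_Iio hd2.hasDerivWithinAt (by linarith))
    have := h x _ _ (ht.of_isLocalMin hmin)
    have h4 : a x * δ ≤ ε := by
      have : (|a x| + 1) * δ = ε := by rw [hδ]; field_simp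
      nlinarith [le_abs_self (a x)]
    nlinarith

/-- Changing the sign of u turns every statement about supersolutions into one about subsolutions.
The new Hamiltonian is not coercive, so lemmas meant for both sides are stated without coercivity.
-/
lemma isViscositySubsolution_iff_neg {a : ℝ → ℝ} {H : ℝ → ℝ → ℝ} {lam : ℝ} {u : ℝ → ℝ} :
    IsViscositySubsolution a H lam u ↔
      IsViscositySupersolution a (fun x p => - H x (-p)) (-lam) (fun x => - u x) := by
  refine and_congr ⟨fun h => h.neg, fun h => by simpa only [neg_neg] using h.fun_neg⟩
    ⟨fun h φ hφ x hm => ?_, fun h φ hφ x hm => ?_⟩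
  all_goals
    have hm' : IsLocalMin (fun y => - u y - -φ y) x ∨ IsLocalMax (fun y => u y - (-φ y)) x := by
      first
        | left; filter_upwards [hm] with y hy; linarith
        | right; filter_upwards [hm] with y hy; linarith
    rcases hm' with hm' | hm'
  all_goals
    have e1 : deriv (fun y => -φ y) = fun y => - deriv φ y := funext fun y => deriv.fun_neg
    have e2 : deriv (deriv (fun y => -φ y)) x = - deriv (deriv φ) x := by
      rw [e1]; exact deriv.fun_neg
  · have := h (fun y => -φ y) hφ.neg x (by filter_upwards [hm] with y hy; linarith)
    rw [e2, e1] at this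
    linarith
  · have := h (fun y => -φ y) hφ.neg x hm'
    rw [e2, e1] at this
    linarith
  · have := h (fun y => -φ y) hφ.neg x hm'
    rw [e2, e1] at this
    simp only [neg_neg] at this
    linarith
  · have := h (fun y => -φ y) hφ.neg x (by filter_upwards [hm] with y hy; linarith)
    rw [e2, e1] at this
    simp only [neg_neg] at this
    linarith

/-- A continuous function which, up to an error `δ`, is uniformly approximated near every point by
supersolutions at level at most `lam + δ` is a supersolution at level `lam`. -/
lemma IsViscositySupersolution.of_approx {a : ℝ → ℝ} {H : ℝ → ℝ → ℝ} {lam : ℝ} {u : ℝ → ℝ}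
    (ha : Continuous a) (hH : Continuous fun q : ℝ × ℝ => H q.1 q.2) (hu : Continuous u)
    (happ : ∀ R > 0, ∀ δ > 0, ∃ v mu, mu ≤ lam + δ ∧ IsViscositySupersolution a H mu v ∧
      ∀ y, |y| ≤ R → |v y - u y| ≤ δ) :
    IsViscositySupersolution a H lam u := by
  rw [isViscositySupersolution_iff]
  refine ⟨hu, fun x p s ht => ?_⟩
  have main : ∀ ε > 0, a x * (s - ε) + H x p ≤ lam := by
    intro ε hε
    set ψ : ℝ → ℝ := fun y => a y * (s - ε) + H y (p + (s - ε) * (y - x)) with hψ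
    have hψc : Continuous ψ := by
      refine (ha.mul continuous_const).add (hH.comp (f := fun y => (y, p + (s - ε) * (y - x))) ?_)
      fun_prop
    have hψx : ψ x = a x * (s - ε) + H x p := by simp [hψ]
    rw [← hψx]
    refine le_of_forall_pos_le_add fun θ hθ => ?_
    obtain ⟨ρ, hρ, hρ'⟩ := Metric.eventually_nhds_iff.1
      (ht.and (hψc.continuousAt.eventually (lt_mem_nhds (sub_lt_self (ψ x) (half_pos hθ)))))
    set r := ρ / 2 with hr
    have hr0 : 0 < r := by positivity
    -- Lowering the curvature by ε makes the contact of u at x strict, with a gap of ε/2 * r² at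
    -- distance r. An error of at most ε/8 * r² between v and u cannot push the minimum of the
    -- perturbed problem to the boundary.
    obtain ⟨v, mu, hmu, hv, hvu⟩ := happ (|x| + r) (by positivity)
      (min (θ / 2) (ε / 8 * r ^ 2)) (by positivity)
    have hv' := isViscositySupersolution_iff.1 hv
    set g : ℝ → ℝ := fun y => v y - (p * (y - x) + (s - ε) / 2 * (y - x) ^ 2) with hg
    have hgc : Continuous g := by simp only [hg]; have := hv'.1; fun_prop
    obtain ⟨y, hy, hymin⟩ := (isCompact_Icc (a := x - r) (b := x + r)).exists_isMinOn
      ⟨x, by constructor <;> linarith⟩ hgc.continuousOn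
    have hxI : x ∈ Icc (x - r) (x + r) := by constructor <;> linarith
    have hclose : ∀ z ∈ Icc (x - r) (x + r), |v z - u z| ≤ ε / 8 * r ^ 2 := fun z hz =>
      (hvu z (by
        have : |z - x| ≤ r := abs_le.2 ⟨by linarith [hz.1], by linarith [hz.2]⟩
        calc |z| = |x + (z - x)| := by ring_nf
          _ ≤ |x| + |z - x| := abs_add_le _ _
          _ ≤ _ := by linarith)).trans (min_le_right _ _)
    have hballz : ∀ z ∈ Icc (x - r) (x + r), dist z x < ρ := fun z hz => by
      rw [Real.dist_eq, abs_lt]; constructor <;> linarith [hz.1, hz.2]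
    have hyint : y ∈ Ioo (x - r) (x + r) := by
      have h1 := hymin hxI
      simp only [mem_ofPred_eq, hg, sub_self] at h1
      have h2 := abs_le.1 (hclose y hy)
      have h3 := abs_le.1 (hclose x hxI)
      have h4 := (hρ' (hballz y hy)).1
      have h5 : (y - x) ^ 2 < r ^ 2 := by
        have h6 : ε * ((y - x) ^ 2 * 2) ≤ ε * r ^ 2 := by linarith [h2.1, h3.2]
        have h7 := le_of_mul_le_mul_left h6 hε
        have : 0 < r ^ 2 := by positivity
        linarith
      have h6 := abs_lt_of_sq_lt_sq h5 hr0.le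
      rw [abs_lt] at h6
      constructor <;> linarith [h6.1, h6.2]
    have hT : TouchesBelow v y (p + (s - ε) * (y - x)) (s - ε) := by
      filter_upwards [Icc_mem_nhds hyint.1 hyint.2] with z hz
      have h1 := hymin hz
      simp only [mem_ofPred_eq, hg] at h1
      nlinarith
    have h7 := hv'.2 _ _ _ hT
    have h8 := (hρ' (hballz y hy)).2
    have h9 := min_le_left (θ / 2) (ε / 8 * r ^ 2)
    simp only [hψ] at h8 ⊢
    linarith
  refine le_of_forall_pos_le_add fun ε hε => ?_
  have ha : 0 < |a x| + 1 := by positivity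
  have h1 := main (ε / (|a x| + 1)) (by positivity)
  have h4 : a x * (ε / (|a x| + 1)) ≤ ε := by
    have : (|a x| + 1) * (ε / (|a x| + 1)) = ε := by field_simp
    have h0 : 0 < ε / (|a x| + 1) := by positivity
    nlinarith [le_abs_self (a x)]
  nlinarith

lemma IsViscositySolution.of_approx {a : ℝ → ℝ} {H : ℝ → ℝ → ℝ} {lam : ℝ} {u : ℝ → ℝ}
    (ha : Continuous a) (hH : Continuous fun q : ℝ × ℝ => H q.1 q.2) (hu : Continuous u)
    (happ : ∀ R > 0, ∀ δ > 0, ∃ v mu, |mu - lam| ≤ δ ∧ IsViscositySolution a H mu v ∧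
      ∀ y, |y| ≤ R → |v y - u y| ≤ δ) :
    IsViscositySolution a H lam u := by
  constructor
  · rw [isViscositySubsolution_iff_neg]
    refine .of_approx ha ?_ hu.neg fun R hR δ hδ => ?_
    · exact (hH.comp (f := fun q : ℝ × ℝ => (q.1, -q.2)) (by fun_prop)).neg
    · obtain ⟨v, mu, h1, h2, h3⟩ := happ R hR δ hδ
      refine ⟨fun y => - v y, -mu, by linarith [(abs_le.1 h1).1],
        isViscositySubsolution_iff_neg.1 h2.1, fun y hy => ?_⟩
      rw [← abs_neg]; convert h3 y hy using 2; ring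
  · refine .of_approx ha hH hu fun R hR δ hδ => ?_
    obtain ⟨v, mu, h1, h2, h3⟩ := happ R hR δ hδ
    exact ⟨v, mu, by linarith [(abs_le.1 h1).2], h2.2, h3⟩

/-- A continuous function that can only be touched from below by parabolas of curvature at most `C`
is `C`-semiconcave. -/
lemma concaveOn_of_touchesBelow_le {h : ℝ → ℝ} {c d C : ℝ} (hc : ContinuousOn h (Ioo c d))
    (ht : ∀ x ∈ Ioo c d, ∀ p s, TouchesBelow h x p s → s ≤ C) :
    ConcaveOn ℝ (Ioo c d) fun x => h x - C / 2 * x ^ 2 := by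
  refine concaveOn_of_slope_anti_adjacent (convex_Ioo c d) ?_
  intro x y z hx hz hxy hyz
  by_contra hcon
  push Not at hcon
  set k : ℝ → ℝ := fun x => h x - C / 2 * x ^ 2 with hk
  set m := (k z - k x) / (z - x) with hm
  have hzx : 0 < z - x := by linarith
  have hyx : 0 < y - x := by linarith
  have hzy : 0 < z - y := by linarith
  have hmz : m * (z - x) = k z - k x := by rw [hm]; field_simp
  have hyneg : k y - k x - m * (y - x) < 0 := by
    rw [div_lt_div_iff₀ hyx hzy] at hcon
    change (k y - k x) * (z - y) < (k z - k y) * (y - x) at hcon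
    have : (k y - k x) * (z - x) < m * (y - x) * (z - x) := by nlinarith
    have := lt_of_mul_lt_mul_right this hzx.le
    linarith
  set D := -(k y - k x - m * (y - x)) with hD
  have hD0 : 0 < D := by linarith
  -- If concavity fails, k lies D below its chord at y. The parabolic bump of curvature ε has height
  -- D/2 at y, so g is still negative there and has an interior minimum, where h is touched with
  -- curvature C + ε.
  set ε := D / ((y - x) * (z - y)) with hε
  have hε0 : 0 < ε := by positivity
  have hεm : ε * ((y - x) * (z - y)) = D := by rw [hε]; field_simp
  set g : ℝ → ℝ := fun w => k w - k x - m * (w - x) - ε / 2 * ((w - x) * (w - z)) with hg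
  have hsub : Icc x z ⊆ Ioo c d := fun w hw => ⟨hx.1.trans_le hw.1, hw.2.trans_lt hz.2⟩
  have hgc : ContinuousOn g (Icc x z) := by
    have := hc.mono hsub
    simp only [hg, hk]
    fun_prop
  obtain ⟨w, hw, hwmin⟩ := isCompact_Icc.exists_isMinOn ⟨x, le_rfl, by linarith⟩ hgc
  have hgy : g y < 0 := by simp only [hg]; nlinarith
  have hgx : g x = 0 := by simp [hg]
  have hgz : g z = 0 := by simp only [hg]; rw [hmz]; ring
  have hgw : g w < 0 := (hwmin ⟨hxy.le, hyz.le⟩).trans_lt hgy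
  have hwI : w ∈ Ioo x z := by
    refine ⟨lt_of_le_of_ne hw.1 ?_, lt_of_le_of_ne hw.2 ?_⟩
    · rintro rfl; linarith
    · rintro rfl; linarith
  have := ht w (hsub hw) (m + ε / 2 * (2 * w - x - z) + C * w) (C + ε) (by
    filter_upwards [Icc_mem_nhds hwI.1 hwI.2] with v hv
    have h1 := hwmin hv
    simp only [mem_ofPred_eq, hg, hk] at h1
    nlinarith)
  linarith

/-! ### Admissible data and the larger root of the Hamiltonian -/

/-- Bounded Lipschitz diffusion coefficients with quadratic vanishing, and strictly quasiconvex,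
superquadratically coercive Hamiltonians; `M` quantifies the coercivity. -/
structure Admissible (M : ℝ → ℝ) (a : ℝ → ℝ) (H : ℝ → ℝ → ℝ) : Prop where
  a_nonneg : ∀ x, 0 ≤ a x
  a_le_one : ∀ x, a x ≤ 1
  a_lip : ∃ A, ∀ x y, |a x - a y| ≤ A * |x - y|
  a_quad : ∃ B > 0, ∀ z x, a z = 0 → a x ≤ B * (x - z) ^ 2
  H_lip : ∀ R, ∃ L > 0, ∀ x y p q, |p| ≤ R → |q| ≤ R → |H x p - H y q| ≤ L * (|x - y| + |p - q|)
  H_bdd : ∀ R, ∃ B > 0, ∀ x p, |p| ≤ R → |H x p| ≤ B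
  one_le_M : ∀ t, 1 ≤ M t
  mono_M : Monotone M
  coercive : ∀ t x p, M t ≤ |p| → t + p ^ 2 < H x p
  sqc : ∀ x p q r, p < q → q < r → H x q < max (H x p) (H x r)

/-- `P` is the larger of the two solutions of `H x = lam`. -/
def IsUpperRoot (H : ℝ → ℝ → ℝ) (lam x P : ℝ) : Prop :=
  H x P = lam ∧ ∃ q < P, H x q < lam

section Roots

variable {M : ℝ → ℝ} {a : ℝ → ℝ} {H : ℝ → ℝ → ℝ} {lam x P : ℝ}

lemma Admissible.continuous_a (h : Admissible M a H) : Continuous a := by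
  obtain ⟨A, hA⟩ := h.a_lip
  refine continuous_iff_continuousAt.2 fun x => ?_
  refine tendsto_iff_dist_tendsto_zero.2 (squeeze_zero (fun _ => dist_nonneg) (fun y => hA y x) ?_)
  have : Continuous fun y => A * |y - x| := by fun_prop
  simpa using this.tendsto x

lemma Admissible.continuous_H (h : Admissible M a H) : Continuous fun q : ℝ × ℝ => H q.1 q.2 := by
  refine continuous_iff_continuousAt.2 fun ⟨x, p⟩ => ?_
  obtain ⟨L, -, hL⟩ := h.H_lip (|p| + 1)
  refine tendsto_iff_dist_tendsto_zero.2 (squeeze_zero' (Eventually.of_forall fun _ => dist_nonneg)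
    (g := fun q : ℝ × ℝ => L * (|q.1 - x| + |q.2 - p|)) ?_ ?_)
  · have : ∀ᶠ q : ℝ × ℝ in 𝓝 (x, p), |q.2| < |p| + 1 :=
      (continuous_snd.abs.tendsto (x, p)).eventually (gt_mem_nhds (by simp))
    filter_upwards [this] with q hq
    exact hL q.1 x q.2 p hq.le (by linarith)
  · have : Continuous fun q : ℝ × ℝ => L * (|q.1 - x| + |q.2 - p|) := by fun_prop
    simpa using this.tendsto (x, p)

lemma Admissible.continuous_H_comp (h : Admissible M a H) {f g : ℝ → ℝ} (hf : Continuous f)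
    (hg : Continuous g) : Continuous fun y => H (f y) (g y) :=
  h.continuous_H.comp (hf.prodMk hg)

lemma Admissible.eventually_lt_H (h : Admissible M a H) {x k : ℝ} (hk : lam < H x k) :
    ∀ᶠ y in 𝓝 x, lam < H y k :=
  (h.continuous_H_comp continuous_id continuous_const).continuousAt.eventually (lt_mem_nhds hk)

lemma Admissible.eventually_H_lt (h : Admissible M a H) {x k : ℝ} (hk : H x k < lam) :
    ∀ᶠ y in 𝓝 x, H y k < lam :=
  (h.continuous_H_comp continuous_id continuous_const).continuousAt.eventually (gt_mem_nhds hk)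

lemma Admissible.a_pos (h : Admissible M a H) (hx : a x ≠ 0) : 0 < a x :=
  lt_of_le_of_ne (h.a_nonneg x) hx.symm

lemma Admissible.abs_lt_of_H_le (h : Admissible M a H) {t p : ℝ} (hp : H x p ≤ t) : |p| < M t := by
  by_contra hcon
  push Not at hcon
  nlinarith [h.coercive t x p hcon, sq_nonneg p]

lemma IsUpperRoot.lt_H (hP : IsUpperRoot H lam x P) (h : Admissible M a H) {r : ℝ} (hr : P < r) :
    lam < H x r := by
  obtain ⟨h1, q, hq, hq'⟩ := hP
  have := h.sqc x q P r hq hr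
  rw [h1, lt_max_iff] at this
  rcases this with h | h <;> linarith

lemma IsUpperRoot.unique (hP : IsUpperRoot H lam x P) (h : Admissible M a H) {Q : ℝ}
    (hQ : IsUpperRoot H lam x Q) : P = Q := by
  rcases lt_trichotomy P Q with h1 | h1 | h1
  · linarith [hP.lt_H h h1, hQ.1]
  · exact h1
  · linarith [hQ.lt_H h h1, hP.1]

lemma IsUpperRoot.le_of_H_le (hP : IsUpperRoot H lam x P) (h : Admissible M a H) {k : ℝ}
    (hk : H x k ≤ lam) : k ≤ P := by
  by_contra! h1
  linarith [hP.lt_H h h1]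

lemma IsUpperRoot.lt_of_H_lt (hP : IsUpperRoot H lam x P) (h : Admissible M a H) {k : ℝ}
    (hk : H x k < lam) : k < P := by
  refine lt_of_le_of_ne (hP.le_of_H_le h hk.le) ?_
  rintro rfl
  linarith [hP.1]

lemma IsUpperRoot.lt_of_lt_H (hP : IsUpperRoot H lam x P) (h : Admissible M a H) {k₁ k₂ : ℝ}
    (hk : k₁ < k₂) (hk₁ : H x k₁ < lam) (hk₂ : lam < H x k₂) : P < k₂ := by
  by_contra! h1
  rcases h1.lt_or_eq with h1 | rfl
  · have := h.sqc x k₁ k₂ P hk h1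
    rw [hP.1, lt_max_iff] at this
    rcases this with h | h <;> linarith
  · linarith [hP.1]

lemma Admissible.exists_isUpperRoot (h : Admissible M a H) {q : ℝ} (hq : H x q < lam) :
    ∃ P, IsUpperRoot H lam x P := by
  set R := max (q + 1) (M lam) with hR
  have h1 : lam < H x R := by
    have h2 := h.coercive lam x R ((le_max_right _ _).trans (le_abs_self _))
    nlinarith [sq_nonneg R]
  have h3 : q < R := by linarith [le_max_left (q + 1) (M lam)]
  obtain ⟨P, hP, hP'⟩ := intermediate_value_Icc h3.le
    (h.continuous_H_comp continuous_const continuous_id (f := fun _ => x)).continuousOn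
    (show lam ∈ Icc (H x q) (H x R) from ⟨hq.le, h1.le⟩)
  refine ⟨P, hP', q, lt_of_le_of_ne hP.1 ?_, hq⟩
  rintro rfl
  simp only [id] at hP'
  linarith

lemma IsUpperRoot.H_lt (hP : IsUpperRoot H lam x P) (h : Admissible M a H) :
    ∃ q₀ < P, ∀ q, q₀ ≤ q → q < P → H x q < lam := by
  obtain ⟨h1, q, hq, hq'⟩ := hP
  refine ⟨q, hq, fun r hr hrP => ?_⟩
  rcases hr.lt_or_eq with hr | rfl
  · have := h.sqc x q r P hr hrP
    rw [h1, lt_max_iff] at this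
    rcases this with h | h <;> linarith
  · exact hq'

/-- On an interval where H x is constant, three points would contradict strict quasiconvexity. These
levels serve as barriers in the proof that slopes have limits at endpoints. -/
lemma Admissible.dense_H_ne (h : Admissible M a H) (x lam : ℝ) : Dense {k | H x k ≠ lam} := by
  refine dense_of_exists_between fun p r hpr => ?_
  by_contra! hcon
  have hc : ∀ b, p < b → b < r → H x b = lam := fun b h1 h2 => by
    by_contra hb
    exact hcon b hb ⟨h1, h2⟩
  have h1 := hc (p + (r - p) / 4) (by linarith) (by linarith)
  have h2 := hc (p + (r - p) / 2) (by linarith) (by linarith)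
  have h3 := hc (p + 3 * (r - p) / 4) (by linarith) (by linarith)
  have := h.sqc x (p + (r - p) / 4) (p + (r - p) / 2) (p + 3 * (r - p) / 4) (by linarith)
    (by linarith)
  rw [h1, h2, h3] at this
  simp at this

end Roots

/-! ### Reflection of the admissible data -/

section Reflection

lemma Admissible.reflect {M : ℝ → ℝ} {a : ℝ → ℝ} {H : ℝ → ℝ → ℝ} (h : Admissible M a H) :
    Admissible M (fun x => a (-x)) (fun x p => H (-x) (-p)) where
  a_nonneg x := h.a_nonneg _
  a_le_one x := h.a_le_one _
  a_lip := by
    obtain ⟨A, hA⟩ := h.a_lip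
    refine ⟨A, fun x y => (hA _ _).trans_eq ?_⟩
    rw [← abs_neg (x - y)]; ring_nf
  a_quad := by
    obtain ⟨B, hB, hB'⟩ := h.a_quad
    exact ⟨B, hB, fun z x hz => (hB' _ _ hz).trans_eq (by ring)⟩
  H_lip R := by
    obtain ⟨L, hL, hL'⟩ := h.H_lip R
    refine ⟨L, hL, fun x y p q hp hq => (hL' _ _ _ _ (by simpa) (by simpa)).trans_eq ?_⟩
    rw [← abs_neg (x - y), ← abs_neg (p - q)]; ring_nf
  H_bdd R := by
    obtain ⟨B, hB, hB'⟩ := h.H_bdd R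
    exact ⟨B, hB, fun x p hp => hB' _ _ (by simpa)⟩
  one_le_M := h.one_le_M
  mono_M := h.mono_M
  coercive t x p hp := by simpa using h.coercive t (-x) (-p) (by simpa)
  sqc x p q r hpq hqr := by
    rw [max_comm]
    exact h.sqc _ _ _ _ (by linarith) (by linarith)

end Reflection

/-! ### Interior regularity where the diffusion is positive -/

section Regularity

lemma TouchesBelow.eq_of_hasDerivAt {u : ℝ → ℝ} {x p s q : ℝ} (h : TouchesBelow u x p s)
    (hu : HasDerivAt u q x) : p = q := by
  have h1 := hu.fun_sub (hasDerivAt_parabola (u x) p s x x)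
  have h2 : IsLocalMin (fun y => u y - (u x + p * (y - x) + s / 2 * (y - x) ^ 2)) x := by
    filter_upwards [h] with y hy
    simp only [sub_self, mul_zero, ne_eq, OfNat.ofNat_ne_zero, not_false_eq_true, zero_pow,
      add_zero]
    linarith
  have := h2.hasDerivAt_eq_zero h1
  linarith

lemma TouchesBelow.abs_le_of_lipschitz {u : ℝ → ℝ} {x p s K : ℝ} (h : TouchesBelow u x p s)
    (hK : ∀ x y, |u x - u y| ≤ K * |x - y|) : |p| ≤ K := by
  refine le_of_forall_pos_le_add fun ε hε => ?_
  obtain ⟨ρ, hρ, hρ'⟩ := Metric.eventually_nhds_iff.1 h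
  set t := min (ρ / 2) (ε / (|s| + 1)) with ht
  have ht0 : 0 < t := by positivity
  have htρ : t < ρ := (min_le_left _ _).trans_lt (by linarith)
  have hts : |s| * t ≤ ε := by
    have h1 : t * (|s| + 1) ≤ ε := (le_div_iff₀ (by positivity)).1 (min_le_right _ _)
    nlinarith
  have h1 := hρ' (y := x + t) (by simpa [Real.dist_eq, abs_of_pos ht0])
  have h2 := hρ' (y := x - t) (by simpa [Real.dist_eq, abs_of_pos ht0])
  have h3 := hK (x + t) x
  have h4 := hK (x - t) x
  simp only [add_sub_cancel_left, sub_sub_cancel_left, abs_neg, abs_of_pos ht0] at h1 h2 h3 h4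
  have h5 := (abs_le.1 h3).2
  have h6 := (abs_le.1 h4).2
  have h7 : -(|s| * t) ≤ s * t := by nlinarith [neg_abs_le s]
  refine abs_le.2 ⟨?_, ?_⟩
  · have : -p * t ≤ (K + ε) * t := by nlinarith
    linarith [le_of_mul_le_mul_right this ht0]
  · have : p * t ≤ (K + ε) * t := by nlinarith
    linarith [le_of_mul_le_mul_right this ht0]

/-- A touching slope is at most K in modulus, so the equation gives a * s ≤ C for the touching
curvature s, and a ≥ m turns this into s ≤ C / m. -/
lemma IsViscositySupersolution.semiconcave {a : ℝ → ℝ} {H : ℝ → ℝ → ℝ} {lam K m C c d : ℝ}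
    {u : ℝ → ℝ} (hu : IsViscositySupersolution a H lam u) (hK : ∀ x y, |u x - u y| ≤ K * |x - y|)
    (hm : 0 < m) (ha : ∀ x ∈ Ioo c d, m ≤ a x) (hC : 0 ≤ C)
    (hH : ∀ x p, |p| ≤ K → lam - H x p ≤ C) :
    ConcaveOn ℝ (Ioo c d) fun x => u x - (C / m) / 2 * x ^ 2 := by
  refine concaveOn_of_touchesBelow_le hu.1.continuousOn fun x hx p s hT => ?_
  have h1 := (isViscositySupersolution_iff.1 hu).2 x p s hT
  have h2 := hH x p (hT.abs_le_of_lipschitz hK)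
  rw [le_div_iff₀ hm]
  rcases le_total s 0 with hs | hs
  · nlinarith
  · nlinarith [ha x hx]

/-- Semiconcavity puts the right derivative below the left one; semiconvexity gives the reverse
inequality. -/
lemma differentiableAt_of_semiconcave_semiconvex {u : ℝ → ℝ} {c d C x : ℝ}
    (h1 : ConcaveOn ℝ (Ioo c d) fun x => u x - C / 2 * x ^ 2)
    (h2 : ConcaveOn ℝ (Ioo c d) fun x => - u x - C / 2 * x ^ 2) (hx : x ∈ Ioo c d) :
    DifferentiableAt ℝ u x := by
  have hx' : x ∈ interior (Ioo c d) := by rwa [isOpen_Ioo.interior_eq]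
  have key : ∀ v : ℝ → ℝ, ConcaveOn ℝ (Ioo c d) (fun x => v x - C / 2 * x ^ 2) →
      ∃ l r, HasDerivWithinAt v l (Iio x) x ∧ HasDerivWithinAt v r (Ioi x) x ∧ r ≤ l := by
    intro v hv
    have hv' := hv.neg
    have hq : HasDerivAt (fun x : ℝ => C / 2 * x ^ 2) (C * x) x := by
      refine ((hasDerivAt_pow 2 x).const_mul (C / 2)).congr_deriv ?_
      push_cast; ring
    have hl := hv'.hasDerivWithinAt_leftDeriv_of_mem_interior hx'
    have hr := hv'.hasDerivWithinAt_rightDeriv_of_mem_interior hx'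
    have e : v = fun x => -((-fun x => v x - C / 2 * x ^ 2) x) + C / 2 * x ^ 2 := by
      ext y; simp
    have hl2 := hl.fun_neg.fun_add hq.hasDerivWithinAt
    have hr2 := hr.fun_neg.fun_add hq.hasDerivWithinAt
    rw [← e] at hl2 hr2
    exact ⟨_, _, hl2, hr2, by linarith [hv'.leftDeriv_le_rightDeriv_of_mem_interior hx']⟩
  obtain ⟨l, r, hl, hr, hlr⟩ := key u h1
  obtain ⟨l', r', hl', hr', hlr'⟩ := key _ h2
  have e1 : l' = -l := (uniqueDiffWithinAt_Iio x).eq_deriv _ hl' hl.fun_neg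
  have e2 : r' = -r := (uniqueDiffWithinAt_Ioi x).eq_deriv _ hr' hr.fun_neg
  have e3 : l = r := by linarith
  subst e3
  have h3 := hl.union hr
  rw [Iio_union_Ioi, ← Set.sdiff_eq_compl_inter.trans (Set.inter_univ _)] at h3
  exact (hasDerivWithinAt_univ.1 (hasDerivWithinAt_sdiff_singleton.1 h3)).differentiableAt

lemma abs_deriv_sub_le_of_semiconcave_semiconvex {u : ℝ → ℝ} {c d C x y : ℝ}
    (h1 : ConcaveOn ℝ (Ioo c d) fun x => u x - C / 2 * x ^ 2)
    (h2 : ConcaveOn ℝ (Ioo c d) fun x => - u x - C / 2 * x ^ 2) (hx : x ∈ Ioo c d)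
    (hy : y ∈ Ioo c d) : |deriv u y - deriv u x| ≤ C * |y - x| := by
  have hd := fun z hz => differentiableAt_of_semiconcave_semiconvex h1 h2 (x := z) hz
  have hq : ∀ x : ℝ, HasDerivAt (fun x : ℝ => C / 2 * x ^ 2) (C * x) x := fun x => by
    refine ((hasDerivAt_pow 2 x).const_mul (C / 2)).congr_deriv ?_
    push_cast; ring
  have d1 : ∀ z ∈ Ioo c d, HasDerivAt (fun x => u x - C / 2 * x ^ 2) (deriv u z - C * z) z :=
    fun z hz => (hd z hz).hasDerivAt.fun_sub (hq z)
  have d2 : ∀ z ∈ Ioo c d, HasDerivAt (fun x => - u x - C / 2 * x ^ 2) (-deriv u z - C * z) z :=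
    fun z hz => (hd z hz).hasDerivAt.fun_neg.fun_sub (hq z)
  have m1 := h1.antitoneOn_deriv fun z hz => (d1 z hz).differentiableAt
  have m2 := h2.antitoneOn_deriv fun z hz => (d2 z hz).differentiableAt
  wlog hxy : x ≤ y generalizing x y
  · rw [abs_sub_comm, abs_sub_comm y]
    exact this hy hx (by linarith)
  have k1 := m1 hx hy hxy
  have k2 := m2 hx hy hxy
  rw [(d1 x hx).deriv, (d1 y hy).deriv] at k1
  rw [(d2 x hx).deriv, (d2 y hy).deriv] at k2
  rw [abs_of_nonneg (by linarith : 0 ≤ y - x), abs_le]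
  constructor <;> linarith

/-- Because u is differentiable, the slope at any contact is the actual derivative, so the
Hamiltonian terms in the inequality and in the identity for F cancel. What remains is that u - W can
only be touched with nonpositive curvature. -/
lemma IsViscositySupersolution.concaveOn_sub {a : ℝ → ℝ} {H : ℝ → ℝ → ℝ} {lam c d : ℝ}
    {u F W₁ W : ℝ → ℝ} (hu : IsViscositySupersolution a H lam u)
    (ha : ∀ x ∈ Ioo c d, 0 < a x) (hd : ∀ x ∈ Ioo c d, DifferentiableAt ℝ u x)
    (hF : ∀ x ∈ Ioo c d, a x * F x + H x (deriv u x) = lam)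
    (hW₁ : ∀ x, HasDerivAt W₁ (F x) x) (hW : ∀ x, HasDerivAt W (W₁ x) x) :
    ConcaveOn ℝ (Ioo c d) fun x => u x - W x := by
  have hWc : Continuous W := continuous_iff_continuousAt.2 fun x => (hW x).continuousAt
  have h0 : ConcaveOn ℝ (Ioo c d) fun x => (u x - W x) - 0 / 2 * x ^ 2 := by
    refine concaveOn_of_touchesBelow_le (hu.1.sub hWc).continuousOn fun x hx p s hT => ?_
    refine le_of_forall_pos_le_add fun ε hε => ?_
    have h1 : TouchesBelow W x (W₁ x) (F x - ε) :=
      touchesBelow_of_hasDerivAt (Eventually.of_forall hW)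
        (eventually_le_of_hasDerivWithinAt_Ioi (hW₁ x).hasDerivWithinAt (by linarith))
        (eventually_le_of_hasDerivWithinAt_Iio (hW₁ x).hasDerivWithinAt (by linarith))
    have h2 : TouchesBelow u x (p + W₁ x) (s + (F x - ε)) := by
      filter_upwards [hT, h1] with y hy1 hy2
      nlinarith
    have h3 := h2.eq_of_hasDerivAt (hd x hx).hasDerivAt
    have h4 := (isViscositySupersolution_iff.1 hu).2 x _ _ h2
    rw [h3] at h4
    have h5 := hF x hx
    have : a x * (s - ε) ≤ 0 := by nlinarith
    nlinarith [ha x hx]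
  simpa using h0

/-- Lipschitz viscosity solutions are classical solutions where the diffusion does not vanish. -/
theorem IsViscositySolution.hasDerivAt_deriv {M : ℝ → ℝ} {a : ℝ → ℝ} {H : ℝ → ℝ → ℝ}
    {lam : ℝ} {u : ℝ → ℝ} (h : Admissible M a H) (hu : IsViscositySolution a H lam u)
    (hL : IsLip u) {x : ℝ} (hx : 0 < a x) :
    DifferentiableAt ℝ u x ∧ HasDerivAt (deriv u) ((lam - H x (deriv u x)) / a x) x := by
  obtain ⟨K, hK⟩ := hL
  have hK1 : ∀ x y, |u x - u y| ≤ K * |x - y| := fun x y => hK.dist_le_mul x y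
  have hK2 : ∀ x y, |-u x - -u y| ≤ K * |x - y| := fun x y => by
    rw [← abs_neg]; convert hK1 x y using 2; ring
  obtain ⟨B, hB, hB'⟩ := h.H_bdd K
  obtain ⟨ρ, hρ, hρ'⟩ := Metric.eventually_nhds_iff.1
    (h.continuous_a.continuousAt.eventually (lt_mem_nhds (half_lt_self hx)))
  set c := x - ρ with hc
  set d := x + ρ with hd
  have hxI : x ∈ Ioo c d := by constructor <;> linarith
  have ham : ∀ y ∈ Ioo c d, a x / 2 ≤ a y := fun y hy => (hρ' (by
    rw [Real.dist_eq, abs_lt]; constructor <;> linarith [hy.1, hy.2])).le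
  have hapos : ∀ y ∈ Ioo c d, 0 < a y := fun y hy => by linarith [ham y hy]
  -- Both u and -u are semiconcave with this constant near x, so u is C^{1,1} there.
  set C := (|lam| + B) / (a x / 2) with hC
  have s1 : ConcaveOn ℝ (Ioo c d) fun x => u x - C / 2 * x ^ 2 :=
    hu.2.semiconcave hK1 (by linarith) ham (by positivity) fun y p hp => by
      linarith [(abs_le.1 (hB' y p hp)).1, le_abs_self lam]
  have hneg := isViscositySubsolution_iff_neg.1 hu.1
  have s2 : ConcaveOn ℝ (Ioo c d) fun x => - u x - C / 2 * x ^ 2 :=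
    hneg.semiconcave hK2 (by linarith) ham (by positivity) fun y p hp => by
      linarith [(abs_le.1 (hB' y (-p) (by simpa))).2, neg_abs_le lam]
  have hdiff := fun z hz => differentiableAt_of_semiconcave_semiconvex s1 s2 (x := z) hz
  refine ⟨hdiff x hxI, ?_⟩
  have hcd : ContinuousOn (deriv u) (Ioo c d) := by
    intro y hy
    refine tendsto_iff_dist_tendsto_zero.2 (squeeze_zero' (g := fun z => C * |z - y|)
      (Eventually.of_forall fun _ => dist_nonneg) ?_ ?_)
    · filter_upwards [self_mem_nhdsWithin] with z hz
      exact abs_deriv_sub_le_of_semiconcave_semiconvex s1 s2 hy hz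
    · have : Continuous fun z => C * |z - y| := by fun_prop
      simpa using (this.tendsto y).mono_left nhdsWithin_le_nhds
  set f : ℝ → ℝ := fun y => (lam - H y (deriv u y)) / a y with hf
  have hfc : ContinuousOn f (Ioo c d) := by
    refine ContinuousOn.div (continuousOn_const.sub ?_) h.continuous_a.continuousOn
      fun y hy => (hapos y hy).ne'
    exact h.continuous_H.comp_continuousOn (f := fun y => (y, deriv u y))
      (continuousOn_id.prodMk hcd)
  set c' := x - ρ / 2 with hc'
  set d' := x + ρ / 2 with hd'
  have hle : c' ≤ d' := by linarith
  have hsub : Icc c' d' ⊆ Ioo c d := fun y hy => ⟨by linarith [hy.1], by linarith [hy.2]⟩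
  set F : ℝ → ℝ := IccExtend hle ((Icc c' d').domRestrict f) with hF
  have hFc : Continuous F := (continuousOn_iff_continuous_domRestrict.1 (hfc.mono hsub)).Icc_extend'
  have hFf : ∀ y ∈ Icc c' d', F y = f y := fun y hy => by
    rw [hF, IccExtend_of_mem _ _ hy]; rfl
  set W₁ : ℝ → ℝ := fun y => ∫ t in x..y, F t with hW₁
  have hW₁d : ∀ y, HasDerivAt W₁ (F y) y := fun y => (hFc.integral_hasStrictDerivAt x y).hasDerivAt
  have hW₁c : Continuous W₁ := continuous_iff_continuousAt.2 fun y => (hW₁d y).continuousAt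
  set W : ℝ → ℝ := fun y => ∫ t in x..y, W₁ t with hW
  have hWd : ∀ y, HasDerivAt W (W₁ y) y := fun y => (hW₁c.integral_hasStrictDerivAt x y).hasDerivAt
  have hsub' : Ioo c' d' ⊆ Ioo c d := Ioo_subset_Icc_self.trans hsub
  have heq : ∀ y ∈ Ioo c' d', a y * F y + H y (deriv u y) = lam := fun y hy => by
    rw [hFf y (Ioo_subset_Icc_self hy)]
    have := (hapos y (hsub' hy)).ne'
    simp only [hf]; field_simp; ring
  -- W is a double primitive of the continuous function (lam - H(y, u'))/a. Both u - W and its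
  -- negative are concave, so u - W is affine and u' inherits the derivative of W₁.
  have k1 := hu.2.concaveOn_sub (fun y hy => hapos y (hsub' hy)) (fun y hy => hdiff y (hsub' hy))
    heq hW₁d hWd
  have k2 := hneg.concaveOn_sub (F := fun y => - F y) (W₁ := fun y => - W₁ y) (W := fun y => - W y)
    (fun y hy => hapos y (hsub' hy)) (fun y hy => (hdiff y (hsub' hy)).fun_neg)
    (fun y hy => by
      rw [deriv.fun_neg, neg_neg]; linarith [heq y hy])
    (fun y => (hW₁d y).fun_neg) (fun y => (hWd y).fun_neg)
  have d1 : ∀ y ∈ Ioo c' d', HasDerivAt (fun y => u y - W y) (deriv u y - W₁ y) y := fun y hy =>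
    (hdiff y (hsub' hy)).hasDerivAt.fun_sub (hWd y)
  have k3 : ∀ y ∈ Ioo c' d', ∀ z ∈ Ioo c' d', |(deriv u z - W₁ z) - (deriv u y - W₁ y)| ≤ 0 := by
    intro y hy z hz
    have := abs_deriv_sub_le_of_semiconcave_semiconvex (u := fun y => u y - W y) (C := 0)
      (by simpa using k1)
      (by convert k2 using 2; ring) hy hz
    rwa [(d1 y hy).deriv, (d1 z hz).deriv, zero_mul] at this
  have hxI' : x ∈ Ioo c' d' := by constructor <;> linarith
  have h5 : deriv u =ᶠ[𝓝 x] fun y => W₁ y + (deriv u x - W₁ x) := by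
    filter_upwards [Ioo_mem_nhds hxI'.1 hxI'.2] with y hy
    have := abs_nonpos_iff.1 (k3 x hxI' y hy)
    linarith
  have h6 := ((hW₁d x).add_const (deriv u x - W₁ x)).congr_of_eventuallyEq h5
  rwa [hFf x (Ioo_subset_Icc_self hxI')] at h6

end Regularity

/-! ### First-order and growth estimates for supersolutions -/

section Supersolutions

variable {M : ℝ → ℝ} {a : ℝ → ℝ} {H : ℝ → ℝ → ℝ} {lam : ℝ} {w : ℝ → ℝ}

/-- Test functions that are twice differentiable only at the contact point are needed for primitives
of ODE solutions. -/
lemma IsViscositySupersolution.le_of_isLocalMin {φ P : ℝ → ℝ} {x s : ℝ}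
    (hw : IsViscositySupersolution a H lam w) (hφ : ∀ᶠ y in 𝓝 x, HasDerivAt φ (P y) y)
    (hP : HasDerivAt P s x) (hmin : IsLocalMin (fun y => w y - φ y) x) :
    a x * s + H x (P x) ≤ lam := by
  refine le_of_forall_pos_le_add fun ε hε => ?_
  have hδ0 : 0 < ε / (|a x| + 1) := by positivity
  have h1 : TouchesBelow φ x (P x) (s - ε / (|a x| + 1)) :=
    touchesBelow_of_hasDerivAt hφ
      (eventually_le_of_hasDerivWithinAt_Ioi hP.hasDerivWithinAt (by linarith))
      (eventually_le_of_hasDerivWithinAt_Iio hP.hasDerivWithinAt (by linarith))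
  have h2 := (isViscositySupersolution_iff.1 hw).2 x _ _ (h1.of_isLocalMin hmin)
  have h4 : a x * (ε / (|a x| + 1)) ≤ ε := by
    have : (|a x| + 1) * (ε / (|a x| + 1)) = ε := by field_simp
    nlinarith [le_abs_self (a x)]
  nlinarith

lemma IsViscositySupersolution.mono {mu : ℝ} (hw : IsViscositySupersolution a H lam w)
    (hle : lam ≤ mu) : IsViscositySupersolution a H mu w :=
  ⟨hw.1, fun φ hφ x hx => (hw.2 φ hφ x hx).trans hle⟩

lemma TouchesBelow.reflect {u : ℝ → ℝ} {x p s : ℝ} (h : TouchesBelow (fun y => u (-y)) x p s) :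
    TouchesBelow u (-x) (-p) s := by
  have h1 : Tendsto (fun y : ℝ => -y) (𝓝 (-x)) (𝓝 x) := by
    simpa using (continuous_neg.tendsto (-x) : Tendsto (fun y : ℝ => -y) _ _)
  filter_upwards [h1.eventually h] with y hy
  simp only [neg_neg] at hy
  nlinarith

lemma IsViscositySupersolution.reflect (hw : IsViscositySupersolution a H lam w) :
    IsViscositySupersolution (fun x => a (-x)) (fun x p => H (-x) (-p)) lam
      (fun x => w (-x)) := by
  rw [isViscositySupersolution_iff] at hw ⊢
  exact ⟨hw.1.comp continuous_neg, fun x p s hT => hw.2 _ _ _ hT.reflect⟩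

lemma IsViscositySolution.reflect (hw : IsViscositySolution a H lam w) :
    IsViscositySolution (fun x => a (-x)) (fun x p => H (-x) (-p)) lam
      (fun x => w (-x)) := by
  refine ⟨?_, hw.2.reflect⟩
  rw [isViscositySubsolution_iff_neg]
  exact (isViscositySubsolution_iff_neg.1 hw.1).reflect

lemma IsViscositySupersolution.translate (hw : IsViscositySupersolution a H lam w) (z : ℝ) :
    IsViscositySupersolution (fun x => a (x + z)) (fun x p => H (x + z) p) lam
      (fun x => w (x + z)) := by
  rw [isViscositySupersolution_iff] at hw ⊢
  refine ⟨hw.1.comp (continuous_add_const z), fun x p s hT => hw.2 _ _ _ ?_⟩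
  have h1 : Tendsto (fun y : ℝ => y - z) (𝓝 (x + z)) (𝓝 x) := by
    simpa using (continuous_sub_right z).tendsto (x + z)
  filter_upwards [h1.eventually hT] with y hy
  simp only [sub_add_cancel] at hy
  nlinarith

/-- Near a zero of the diffusion, a supersolution satisfies the first-order inequality up to an
error controlled by its deviation from an affine function. -/
lemma IsViscositySupersolution.exists_H_le (hw : IsViscositySupersolution a H lam w)
    {z p₀ r ω B : ℝ} (hr : 0 < r) (hω : 0 < ω) (hB0 : 0 ≤ B) (hB : ∀ x, a x ≤ B * (x - z) ^ 2)
    (hosc : ∀ y ∈ Icc (z - r) (z + r), |w y - w z - p₀ * (y - z)| ≤ ω) :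
    ∃ y ∈ Ioo (z - r) (z + r), ∃ q, |q - p₀| ≤ 4 * ω / r ∧ H y q ≤ lam + 4 * B * ω := by
  -- At distance r the added parabola has height 2ω, more than the oscillation ω, so the minimum of
  -- g is interior. The price in the equation is a * C, and the quadratic smallness of a cancels the
  -- factor r⁻², leaving 4Bω.
  set C := 4 * ω / r ^ 2 with hC
  have hC0 : 0 < C := by positivity
  have hCr : C * r ^ 2 = 4 * ω := by rw [hC]; field_simp
  set g : ℝ → ℝ := fun y => w y - w z - p₀ * (y - z) + C / 2 * (y - z) ^ 2 with hg
  have hgc : Continuous g := by have := hw.1; simp only [hg]; fun_prop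
  have hzI : z ∈ Icc (z - r) (z + r) := by constructor <;> linarith
  obtain ⟨y, hy, hymin⟩ := isCompact_Icc.exists_isMinOn ⟨z, hzI⟩ hgc.continuousOn
  have hgz : g z = 0 := by simp [hg]
  have h1 : g y ≤ 0 := hgz ▸ hymin hzI
  have h2 := (abs_le.1 (hosc y hy)).1
  have h3 : C / 2 * (y - z) ^ 2 ≤ ω := by simp only [hg] at h1; linarith
  have h4 : (y - z) ^ 2 < r ^ 2 := by
    by_contra! hcon
    nlinarith
  have h5 := abs_lt.1 (abs_lt_of_sq_lt_sq h4 hr.le)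
  have hyI : y ∈ Ioo (z - r) (z + r) := ⟨by linarith [h5.1], by linarith [h5.2]⟩
  refine ⟨y, hyI, p₀ - C * (y - z), ?_, ?_⟩
  · rw [sub_sub_cancel_left, abs_neg, abs_mul, abs_of_pos hC0]
    have : 4 * ω / r = C * r := by rw [hC]; field_simp
    rw [this]
    exact mul_le_mul_of_nonneg_left (abs_lt_of_sq_lt_sq h4 hr.le).le hC0.le
  · have hT : TouchesBelow w y (p₀ - C * (y - z)) (-C) := by
      filter_upwards [Icc_mem_nhds hyI.1 hyI.2] with x hx
      have := hymin hx
      simp only [mem_ofPred_eq, hg] at this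
      nlinarith
    have h6 := (isViscositySupersolution_iff.1 hw).2 _ _ _ hT
    have h7 : a y * C ≤ 4 * B * ω := by
      calc a y * C ≤ (B * (y - z) ^ 2) * C := mul_le_mul_of_nonneg_right (hB y) hC0.le
        _ ≤ (B * r ^ 2) * C := by gcongr
        _ = B * (C * r ^ 2) := by ring
        _ = _ := by rw [hCr]; ring
    linarith

/-- Mere continuity of w makes the oscillation ω small, and the error 4Bω in `exists_H_le` does not
depend on the radius. Coercivity bounds the slope found near z, so it can be carried to z by the
Lipschitz bound in space. -/
lemma IsViscositySupersolution.exists_H_lt_of_a_eq_zero (h : Admissible M a H)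
    (hw : IsViscositySupersolution a H lam w) {z mu : ℝ} (hz : a z = 0) (hmu : lam < mu) :
    ∃ p, H z p < mu := by
  obtain ⟨B, hB, hB'⟩ := h.a_quad
  obtain ⟨L, hL, hL'⟩ := h.H_lip (M mu)
  set ω := (mu - lam) / (8 * B) with hω
  have hω0 : 0 < ω := div_pos (by linarith) (by positivity)
  obtain ⟨ρ, hρ, hρ'⟩ := Metric.continuous_iff.1 hw.1 z ω hω0
  set r := min (ρ / 2) ((mu - lam) / (4 * L)) with hr
  have hr0 : 0 < r := lt_min (by linarith) (div_pos (by linarith) (by positivity))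
  obtain ⟨y, hy, q, -, hq⟩ := hw.exists_H_le (p₀ := 0) hr0 hω0 hB.le (fun x => hB' z x hz)
    fun y hy => by
      have : dist y z < ρ := by
        rw [Real.dist_eq, abs_lt]
        have := min_le_left (ρ / 2) ((mu - lam) / (4 * L))
        constructor <;> linarith [hy.1, hy.2]
      simpa [Real.dist_eq] using (hρ' y this).le
  have e1 : 4 * B * ω = (mu - lam) / 2 := by rw [hω]; field_simp; ring
  have hqM := h.abs_lt_of_H_le (t := mu) (x := y) (p := q) (by linarith)
  have h2 := (abs_le.1 (hL' z y q q hqM.le hqM.le)).2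
  have h3 : |z - y| ≤ (mu - lam) / (4 * L) := by
    have := min_le_right (ρ / 2) ((mu - lam) / (4 * L))
    rw [abs_le]; constructor <;> linarith [hy.1, hy.2]
  have h4 : L * |z - y| ≤ (mu - lam) / 4 := by
    calc L * |z - y| ≤ L * ((mu - lam) / (4 * L)) := by gcongr
      _ = _ := by field_simp
  simp only [sub_self, abs_zero, add_zero] at h2
  exact ⟨q, by linarith⟩

/-- Differentiability makes the oscillation around the tangent at most ε * r on radius r, so the
slope produced by `exists_H_le` is within 4ε of p. Only local bounds on a and H are assumed, because
the lemma is also applied to the sign-changed Hamiltonian of subsolutions. -/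
lemma IsViscositySupersolution.H_le_of_hasDerivAt
    (hw : IsViscositySupersolution a H lam w) {z p B L : ℝ} (hB : 0 < B) (hL : 0 < L)
    (hB' : ∀ x, a x ≤ B * (x - z) ^ 2)
    (hL' : ∀ x y q r, |q| ≤ |p| + 4 → |r| ≤ |p| + 4 → |H x q - H y r| ≤ L * (|x - y| + |q - r|))
    (hp : HasDerivAt w p z) : H z p ≤ lam := by
  have main : ∀ ε > 0, ε ≤ 1 → H z p ≤ lam + (4 * B + 5 * L) * ε := by
    intro ε hε hε1
    have h1 := (hasDerivAt_iff_isLittleO.1 hp).def hε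
    obtain ⟨ρ, hρ, hρ'⟩ := Metric.eventually_nhds_iff.1 h1
    set r := min (ρ / 2) ε with hr
    have hr0 : 0 < r := lt_min (by linarith) hε
    have hrε : r ≤ ε := min_le_right _ _
    obtain ⟨y, hy, q, hq1, hq⟩ := hw.exists_H_le (p₀ := p) hr0 (mul_pos hε hr0) hB.le
      hB' fun y hy => by
        have h2 : |y - z| ≤ r := abs_le.2 ⟨by linarith [hy.1], by linarith [hy.2]⟩
        have : dist y z < ρ := by
          rw [Real.dist_eq]
          have := min_le_left (ρ / 2) ε
          linarith
        have h3 := hρ' this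
        simp only [smul_eq_mul, Real.norm_eq_abs] at h3
        rw [mul_comm p]
        exact h3.trans (by gcongr)
    have e1 : 4 * (ε * r) / r = 4 * ε := by field_simp
    rw [e1] at hq1
    have h4 : |q| ≤ |p| + 4 := by
      calc |q| = |p + (q - p)| := by ring_nf
        _ ≤ |p| + |q - p| := abs_add_le _ _
        _ ≤ _ := by linarith
    have h5 := (abs_le.1 (hL' z y p q (by linarith) h4)).2
    have h6 : |z - y| ≤ ε := by rw [abs_le]; constructor <;> linarith [hy.1, hy.2]
    have h7 : L * (|z - y| + |p - q|) ≤ L * (5 * ε) := by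
      rw [abs_sub_comm p]; gcongr; linarith
    have h8 : 4 * B * (ε * r) ≤ 4 * B * ε := by
      have : ε * r ≤ ε * 1 := by gcongr; linarith
      nlinarith
    nlinarith
  refine le_of_forall_pos_le_add fun δ hδ => ?_
  have hc : 0 < 4 * B + 5 * L := by positivity
  have h1 := main (min 1 (δ / (4 * B + 5 * L))) (by positivity) (min_le_left _ _)
  have h2 : (4 * B + 5 * L) * min 1 (δ / (4 * B + 5 * L)) ≤ δ := by
    calc _ ≤ (4 * B + 5 * L) * (δ / (4 * B + 5 * L)) := by gcongr; exact min_le_right _ _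
      _ = δ := by field_simp
  linarith

lemma IsViscositySolution.H_eq_of_hasDerivAt (h : Admissible M a H)
    (hw : IsViscositySolution a H lam w) {z p : ℝ} (hz : a z = 0) (hp : HasDerivAt w p z) :
    H z p = lam := by
  obtain ⟨B, hB, hB'⟩ := h.a_quad
  obtain ⟨L, hL, hL'⟩ := h.H_lip (|p| + 4)
  refine le_antisymm (hw.2.H_le_of_hasDerivAt hB hL (fun x => hB' z x hz) hL' hp) ?_
  have h1 := (isViscositySubsolution_iff_neg.1 hw.1).H_le_of_hasDerivAt (p := -p) hB hL
    (fun x => hB' z x hz) (fun x y q r hq hr => by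
      rw [abs_neg] at hq hr
      have := hL' x y (-q) (-r) (by simpa) (by simpa)
      rw [← abs_neg, ← abs_neg (q - r)]
      convert this using 2
      · ring
      · ring_nf) hp.fun_neg
  rw [neg_neg] at h1
  linarith

/-- Supersolutions cannot decrease too fast. -/
lemma IsViscositySupersolution.add_log_le (h : Admissible M a H)
    (hw : IsViscositySupersolution a H lam w) {x y : ℝ} (hxy : x < y)
    (hy : M lam * (y - x) < 1) : w x + Real.log (1 - M lam * (y - x)) ≤ w y := by
  set R := M lam with hR
  have hR1 : 1 ≤ R := h.one_le_M lam
  have hR0 : 0 < R := by linarith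
  by_contra! hcon
  -- This barrier satisfies φ'' = -(φ')² and |φ'| ≥ R to the right of x. An interior minimum of w -
  -- φ would give H(φ') ≤ lam + (φ')², as a ≤ 1, against coercivity.
  set φ : ℝ → ℝ := fun t => Real.log (1 - R * (t - x)) with hφ
  set P : ℝ → ℝ := fun t => -R / (1 - R * (t - x)) with hP
  have hd0 : ∀ t, HasDerivAt (fun t => 1 - R * (t - x)) (-R) t := fun t => by
    simpa using (((hasDerivAt_id t).sub_const x).const_mul R).const_sub 1
  have hpos : ∀ t, R * (t - x) < 1 → HasDerivAt φ (P t) t := fun t ht =>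
    (hd0 t).log (by linarith : (0:ℝ) < 1 - R * (t - x)).ne'
  have hP' : ∀ t, R * (t - x) < 1 → HasDerivAt P (-(P t) ^ 2) t := fun t ht => by
    have hne : 1 - R * (t - x) ≠ 0 := (by linarith : (0:ℝ) < 1 - R * (t - x)).ne'
    refine ((hasDerivAt_const t (-R)).fun_div (hd0 t) hne).congr_deriv ?_
    simp only [hP]; field_simp; ring
  obtain ⟨m, hm⟩ := (isCompact_Icc (a := x) (b := x + 1 / R)).exists_isMinOn
    ⟨x, le_rfl, by simp; positivity⟩ hw.1.continuousOn
  -- The barrier tends to -∞ at x + 1/R. Stopping at b, where it equals log δ, puts w - φ above w x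
  -- at the right end, which excludes a minimum there; δ is also small enough that y < b.
  set δ := min (1 - R * (y - x)) (Real.exp (w m - w x)) / 2 with hδ
  have hδ0 : 0 < δ := by
    have : 0 < 1 - R * (y - x) := by linarith
    positivity
  have hδ1 : δ < 1 - R * (y - x) := by
    have := min_le_left (1 - R * (y - x)) (Real.exp (w m - w x)); linarith
  have hδ2 : Real.log δ < w m - w x := by
    rw [Real.log_lt_iff_lt_exp hδ0]
    have := min_le_right (1 - R * (y - x)) (Real.exp (w m - w x))
    linarith [Real.exp_pos (w m - w x)]
  set b := x + (1 - δ) / R with hb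
  have hbR : R * (b - x) = 1 - δ := by rw [hb]; field_simp; ring
  have hyb : y < b := by nlinarith
  have hbm : b ≤ x + 1 / R := by rw [hb]; gcongr; linarith
  have hlt : ∀ t ≤ b, R * (t - x) < 1 := fun t ht => by nlinarith
  set g : ℝ → ℝ := fun t => w t - φ t with hg
  have hgc : ContinuousOn g (Icc x b) := hw.1.continuousOn.sub fun t ht =>
    (hpos t (hlt t ht.2)).continuousAt.continuousWithinAt
  obtain ⟨t, ht, htmin⟩ := isCompact_Icc.exists_isMinOn ⟨x, le_rfl, by linarith⟩ hgc
  have hgx : g x = w x := by simp [hg, hφ]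
  have hgy : g y < w x := by simp only [hg, hφ]; linarith
  have hgt : g t < w x := (htmin ⟨hxy.le, hyb.le⟩).trans_lt hgy
  have htI : t ∈ Ioo x b := by
    refine ⟨lt_of_le_of_ne ht.1 ?_, lt_of_le_of_ne ht.2 ?_⟩
    · rintro rfl; linarith
    · rintro rfl
      have h1 := hm.2 (show b ∈ Icc x (x + 1 / R) from ⟨by linarith, hbm⟩)
      simp only [mem_ofPred_eq] at h1
      simp only [hg, hφ, hbR] at hgt
      rw [sub_sub_cancel] at hgt
      linarith
  have h2 := hw.le_of_isLocalMin (φ := φ) (P := P) (x := t)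
    (by filter_upwards [Iio_mem_nhds htI.2] with s hs using hpos s (hlt s (le_of_lt hs)))
    (hP' t (hlt t ht.2))
    (by filter_upwards [Icc_mem_nhds htI.1 htI.2] with s hs using htmin hs)
  have h3 : R ≤ |P t| := by
    have h4 : 0 < 1 - R * (t - x) := by linarith [hlt t ht.2]
    simp only [hP]
    rw [abs_div, abs_neg, abs_of_pos hR0, abs_of_pos h4, le_div_iff₀ h4]
    have h6 : 0 ≤ R * (t - x) := mul_nonneg hR0.le (by linarith [htI.1])
    nlinarith [mul_nonneg hR0.le h6]
  have h5 := h.coercive lam t (P t) h3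
  nlinarith [h.a_le_one t, sq_nonneg (P t)]

lemma IsViscositySupersolution.add_log_le' (h : Admissible M a H)
    (hw : IsViscositySupersolution a H lam w) {x y : ℝ} (hxy : y < x)
    (hy : M lam * (x - y) < 1) : w x + Real.log (1 - M lam * (x - y)) ≤ w y := by
  have := hw.reflect.add_log_le h.reflect (x := -x) (y := -y) (by linarith)
    (by convert hy using 1; ring)
  simp only [neg_neg] at this
  convert this using 4
  ring

end Supersolutions

/-! ### The slope ODE on compact intervals: comparison and existence -/

/-- `p` solves the equation `a p' + H(y, p) = lam` for the slope of a solution on `[c, d]`. -/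
def SolvesOn (a : ℝ → ℝ) (H : ℝ → ℝ → ℝ) (lam c d : ℝ) (p : ℝ → ℝ) : Prop :=
  ∀ y ∈ Icc c d, HasDerivWithinAt p ((lam - H y (p y)) / a y) (Icc c d) y

section Comparison

/-- A first-contact argument: derivatives are compared only where the functions meet, and strictly.
This is the form in which all barriers are used, with no Lipschitz assumption on the equation. -/
lemma le_of_deriv_lt_of_eq {f f' g g' : ℝ → ℝ} {c d : ℝ}
    (hf : ∀ y ∈ Icc c d, HasDerivWithinAt f (f' y) (Icc c d) y)
    (hg : ∀ y ∈ Icc c d, HasDerivWithinAt g (g' y) (Icc c d) y) (h0 : f c ≤ g c)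
    (hlt : ∀ y ∈ Icc c d, f y = g y → f' y < g' y) : ∀ y ∈ Icc c d, f y ≤ g y := by
  have hmem : ∀ y ∈ Ico c d, Icc c d ∈ 𝓝[≥] y := fun y hy => Icc_mem_nhdsGE_of_mem hy
  exact image_le_of_deriv_right_lt_deriv_boundary'
    (fun y hy => (hf y hy).continuousWithinAt)
    (fun y hy => (hf y (Ico_subset_Icc_self hy)).mono_of_mem_nhdsWithin (hmem y hy)) h0
    (fun y hy => (hg y hy).continuousWithinAt)
    (fun y hy => (hg y (Ico_subset_Icc_self hy)).mono_of_mem_nhdsWithin (hmem y hy))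
    fun y hy => hlt y (Ico_subset_Icc_self hy)

end Comparison

section Existence

variable {M : ℝ → ℝ} {a : ℝ → ℝ} {H : ℝ → ℝ → ℝ} {lam c d : ℝ}

lemma SolvesOn.mono {p : ℝ → ℝ} (hp : SolvesOn a H lam c d p) {c' d' : ℝ} (hc : c ≤ c')
    (hd : d' ≤ d) : SolvesOn a H lam c' d' p :=
  fun y hy => (hp y (Icc_subset_Icc hc hd hy)).mono (Icc_subset_Icc hc hd)

lemma SolvesOn.hasDerivAt {p : ℝ → ℝ} (hp : SolvesOn a H lam c d p) {y : ℝ} (hy : y ∈ Ioo c d) :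
    HasDerivAt p ((lam - H y (p y)) / a y) y :=
  (hp y (Ioo_subset_Icc_self hy)).hasDerivAt (Icc_mem_nhds hy.1 hy.2)

lemma SolvesOn.continuousOn {p : ℝ → ℝ} (hp : SolvesOn a H lam c d p) : ContinuousOn p (Icc c d) :=
  fun y hy => (hp y hy).continuousWithinAt

lemma Admissible.exists_pos_le (h : Admissible M a H) (hcd : c ≤ d)
    (ha : ∀ y ∈ Icc c d, 0 < a y) : ∃ m > 0, ∀ y ∈ Icc c d, m ≤ a y := by
  obtain ⟨m, hm, hmin⟩ := isCompact_Icc.exists_isMinOn ⟨c, le_rfl, hcd⟩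
    h.continuous_a.continuousOn
  exact ⟨a m, ha m hm, fun y hy => hmin hy⟩

lemma abs_clamp_le {R : ℝ} (hR : 0 ≤ R) (t : ℝ) : |max (-R) (min R t)| ≤ R :=
  abs_le.2 ⟨le_max_left _ _, max_le (by linarith) (min_le_left _ _)⟩

lemma abs_clamp_sub_le (R s t : ℝ) : |max (-R) (min R s) - max (-R) (min R t)| ≤ |s - t| := by
  have h1 : |max (min R s) (-R) - max (min R t) (-R)| ≤ |min R s - min R t| :=
    abs_max_sub_max_le_abs _ _ _
  have h2 : |min s R - min t R| ≤ |s - t| := abs_inf_sub_inf_le_abs _ _ _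
  rw [max_comm (-R), max_comm (-R)]
  rw [min_comm s, min_comm t] at h2
  exact h1.trans h2

lemma clamp_eq_self {R t : ℝ} (ht : |t| ≤ R) : max (-R) (min R t) = t := by
  rw [min_eq_right (abs_le.1 ht).2, max_eq_right (abs_le.1 ht).1]

/-- Clamping the slope inside H makes the right-hand side bounded and globally Lipschitz in p, so a
solution exists on all of [c, d]. A bound by R obtained afterwards removes the clamp. -/
lemma Admissible.exists_clamped_solution (h : Admissible M a H) (hcd : c ≤ d)
    (ha : ∀ y ∈ Icc c d, 0 < a y) {R : ℝ} (hR : 0 ≤ R) (lam p₀ : ℝ) :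
    ∃ p : ℝ → ℝ, p c = p₀ ∧ ∀ y ∈ Icc c d,
      HasDerivWithinAt p ((lam - H y (max (-R) (min R (p y)))) / a y) (Icc c d) y := by
  obtain ⟨m, hm, hma⟩ := h.exists_pos_le hcd ha
  obtain ⟨L, hL, hL'⟩ := h.H_lip R
  obtain ⟨B, hB, hB'⟩ := h.H_bdd R
  set F : ℝ → ℝ → ℝ := fun y q => (lam - H y (max (-R) (min R q))) / a y with hF
  set K : NNReal := ⟨L / m, by positivity⟩ with hK
  set N : NNReal := ⟨(|lam| + B) / m, by positivity⟩ with hN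
  set A : NNReal := ⟨(|lam| + B) / m * (d - c), mul_nonneg (by positivity) (by linarith)⟩ with hA
  have hPL : IsPicardLindelof F (tmin := c) (tmax := d) ⟨c, le_rfl, hcd⟩ p₀ A 0 N K := by
    refine ⟨fun y hy => ?_, fun q _ => ?_, fun y hy q _ => ?_, ?_⟩
    · refine LipschitzOnWith.of_dist_le_mul fun q _ r _ => ?_
      simp only [Real.dist_eq, hF]
      rw [← sub_div, abs_div, abs_of_pos (ha y hy), div_le_iff₀ (ha y hy), sub_sub_sub_cancel_left]
      have h1 := hL' y y _ _ (abs_clamp_le hR r) (abs_clamp_le hR q)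
      rw [sub_self, abs_zero, zero_add] at h1
      refine h1.trans ((mul_le_mul_of_nonneg_left (abs_clamp_sub_le R r q) hL.le).trans ?_)
      rw [abs_sub_comm]
      calc L * |q - r| = L / m * |q - r| * m := by field_simp
        _ ≤ _ := mul_le_mul_of_nonneg_left (hma y hy) (by positivity)
    · refine ContinuousOn.div (Continuous.continuousOn ?_) h.continuous_a.continuousOn
        fun y hy => (ha y hy).ne'
      exact continuous_const.sub (h.continuous_H_comp continuous_id continuous_const)
    · simp only [hF, Real.norm_eq_abs]
      rw [abs_div, abs_of_pos (ha y hy), div_le_iff₀ (ha y hy)]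
      have h1 : |lam - H y (max (-R) (min R q))| ≤ |lam| + B :=
        (abs_sub _ _).trans (by gcongr; exact hB' _ _ (abs_clamp_le hR q))
      refine h1.trans ?_
      calc |lam| + B = (|lam| + B) / m * m := by field_simp
        _ ≤ _ := mul_le_mul_of_nonneg_left (hma y hy) (by positivity)
    · rw [NNReal.coe_zero, sub_zero, sub_self, max_eq_left (by linarith)]
      exact le_rfl
  exact hPL.exists_eq_forall_mem_Icc_hasDerivWithinAt₀

/-- By coercivity H exceeds lam at the slope R, so the constant R is a strict upper barrier. -/
lemma Admissible.exists_clamped_solution_le (h : Admissible M a H) (hcd : c ≤ d)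
    (ha : ∀ y ∈ Icc c d, 0 < a y) {R : ℝ} (hR : M lam ≤ R) :
    ∃ p : ℝ → ℝ, p c = R ∧ (∀ y ∈ Icc c d, p y ≤ R) ∧ ∀ y ∈ Icc c d,
      HasDerivWithinAt p ((lam - H y (max (-R) (min R (p y)))) / a y) (Icc c d) y := by
  have hR1 := h.one_le_M lam
  have hR0 : 0 ≤ R := by linarith
  obtain ⟨p, hpc, hp⟩ := h.exists_clamped_solution hcd ha hR0 lam R
  refine ⟨p, hpc, ?_, hp⟩
  refine le_of_deriv_lt_of_eq hp (g := fun _ => R) (g' := fun _ => 0)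
    (fun y _ => hasDerivWithinAt_const _ _ _) hpc.le fun y hy he => ?_
  rw [he, clamp_eq_self (by rw [abs_of_nonneg hR0])]
  refine div_neg_of_neg_of_pos ?_ (ha y hy)
  have := h.coercive lam y R (by rwa [abs_of_nonneg hR0])
  nlinarith [sq_nonneg R]

/-- Solutions started from a high slope stay above any strict lower barrier. -/
lemma Admissible.exists_solvesOn_of_barrier (h : Admissible M a H) (hcd : c ≤ d)
    (ha : ∀ y ∈ Icc c d, 0 < a y) {R mu : ℝ} (hR : M lam ≤ R) (hmu : mu < lam) {g g' : ℝ → ℝ}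
    (hg : ∀ y ∈ Icc c d, HasDerivWithinAt g (g' y) (Icc c d) y)
    (hgR : ∀ y ∈ Icc c d, |g y| ≤ R) (hgH : ∀ y ∈ Icc c d, a y * g' y + H y (g y) ≤ mu) :
    ∃ p : ℝ → ℝ, p c = R ∧ SolvesOn a H lam c d p ∧ ∀ y ∈ Icc c d, |p y| ≤ R ∧ g y ≤ p y := by
  obtain ⟨p, hpc, hpR, hp⟩ := h.exists_clamped_solution_le hcd ha hR
  -- The gap mu < lam makes the comparison strict at contact points. Since g ≥ -R, the solution
  -- stays above -R and the clamp is inactive.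
  have hgp : ∀ y ∈ Icc c d, g y ≤ p y := by
    refine le_of_deriv_lt_of_eq hg hp ?_ fun y hy he => ?_
    · rw [hpc]; exact (abs_le.1 (hgR c ⟨le_rfl, hcd⟩)).2
    · rw [← he, clamp_eq_self (hgR y hy), lt_div_iff₀ (ha y hy)]
      linarith [hgH y hy]
  have hpa : ∀ y ∈ Icc c d, |p y| ≤ R := fun y hy =>
    abs_le.2 ⟨by linarith [(abs_le.1 (hgR y hy)).1, hgp y hy], hpR y hy⟩
  refine ⟨p, hpc, fun y hy => ?_, fun y hy => ⟨hpa y hy, hgp y hy⟩⟩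
  have := hp y hy
  rwa [clamp_eq_self (hpa y hy)] at this

lemma SolvesOn.exists_primitive {p : ℝ → ℝ} (hcd : c ≤ d) (hp : ContinuousOn p (Icc c d)) :
    ∃ φ P : ℝ → ℝ, (∀ y, HasDerivAt φ (P y) y) ∧ ∀ y ∈ Icc c d, P y = p y := by
  set P : ℝ → ℝ := IccExtend hcd ((Icc c d).domRestrict p) with hP
  have hPc : Continuous P := (continuousOn_iff_continuous_domRestrict.1 hp).Icc_extend'
  exact ⟨fun y => ∫ t in c..y, P t, P, fun y => (hPc.integral_hasStrictDerivAt c y).hasDerivAt,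
    fun y hy => by rw [hP, IccExtend_of_mem _ _ hy]; rfl⟩

/-- If there is a supersolution, no slope can drop from a high value to its opposite. -/
lemma IsViscositySupersolution.not_descends (h : Admissible M a H) {mu R : ℝ} {w : ℝ → ℝ}
    (hw : IsViscositySupersolution a H mu w) (hmu : mu < lam) (hR : M lam < R) (hcd : c < d)
    (ha : ∀ y ∈ Icc c d, 0 < a y) {p : ℝ → ℝ} (hp : SolvesOn a H lam c d p) (hpc : p c = R)
    (hpd : p d = -R) : False := by
  have hwl := hw.mono hmu.le
  have hM1 := h.one_le_M lam
  obtain ⟨φ, P, hφ, hP⟩ := SolvesOn.exists_primitive hcd.le hp.continuousOn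
  have hgc : Continuous fun y => w y - φ y :=
    hw.1.sub (continuous_iff_continuousAt.2 fun y => (hφ y).continuousAt)
  obtain ⟨x, hx, hmin⟩ := isCompact_Icc.exists_isMinOn ⟨c, le_rfl, hcd.le⟩ hgc.continuousOn
  have hlog : HasDerivAt (fun t => Real.log (1 - M lam * t)) (-M lam) 0 := by
    have h1 : HasDerivAt (fun t : ℝ => 1 - M lam * t) (-M lam) 0 := by
      simpa using ((hasDerivAt_id (0:ℝ)).const_mul (M lam)).const_sub 1
    simpa using h1.log (by simp)
  -- At an endpoint φ has slope R or -R, and a minimum of w - φ there would make w grow into the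
  -- interval at rate R; the logarithmic bounds allow only the rate M lam < R. At an interior
  -- minimum φ is an admissible test function and gives lam ≤ mu.
  rcases hx.1.eq_or_lt with rfl | hcx
  · have hd1 : HasDerivAt (fun t => φ (c + t) + Real.log (1 - M lam * t)) (R + -M lam) 0 := by
      refine HasDerivAt.fun_add ?_ hlog
      have h2 : HasDerivAt φ R (c + 0) := by
        rw [add_zero, ← hpc, ← hP c ⟨le_rfl, hcd.le⟩]; exact hφ c
      simpa using h2.comp_const_add c 0
    have h3 := eventually_le_of_hasDerivWithinAt_Ioi (s := (R - M lam) / 2)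
      hd1.hasDerivWithinAt (by linarith)
    have h4 : ∀ᶠ t : ℝ in 𝓝[>] 0, t < min (d - c) (1 / M lam) :=
      mem_nhdsWithin_of_mem_nhds (Iio_mem_nhds (lt_min (by linarith) (by positivity)))
    obtain ⟨t, ht1, ht2, ht3⟩ := (h3.and (h4.and self_mem_nhdsWithin)).exists
    have ht3 : 0 < t := ht3
    have h5 := hwl.add_log_le' h (x := c + t) (y := c) (by linarith) (by
      rw [add_sub_cancel_left, mul_comm]
      exact (lt_div_iff₀ (by linarith)).1 (ht2.trans_le (min_le_right _ _)))
    have h6 := hmin (show c + t ∈ Icc c d from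
      ⟨by linarith, by linarith [ht2.trans_le (min_le_left _ _)]⟩)
    simp only [mem_ofPred_eq] at h6
    simp only [add_zero, mul_zero, sub_zero, Real.log_one, add_sub_cancel_left] at ht1 h5
    have h7 : 0 < (R - M lam) / 2 * t := mul_pos (by linarith) ht3
    linarith
  rcases hx.2.eq_or_lt with rfl | hxd
  · have hd1 : HasDerivAt (fun t => φ (x - t) + Real.log (1 - M lam * t)) (R + -M lam) 0 := by
      refine HasDerivAt.fun_add ?_ hlog
      have h2 : HasDerivAt φ (-R) (x - 0) := by
        rw [sub_zero, ← hpd, ← hP x ⟨hcd.le, le_rfl⟩]; exact hφ x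
      simpa using h2.comp_const_sub x 0
    have h3 := eventually_le_of_hasDerivWithinAt_Ioi (s := (R - M lam) / 2)
      hd1.hasDerivWithinAt (by linarith)
    have h4 : ∀ᶠ t : ℝ in 𝓝[>] 0, t < min (x - c) (1 / M lam) :=
      mem_nhdsWithin_of_mem_nhds (Iio_mem_nhds (lt_min (by linarith) (by positivity)))
    obtain ⟨t, ht1, ht2, ht3⟩ := (h3.and (h4.and self_mem_nhdsWithin)).exists
    have ht3 : 0 < t := ht3
    have h5 := hwl.add_log_le h (x := x - t) (y := x) (by linarith) (by
      rw [sub_sub_cancel, mul_comm]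
      exact (lt_div_iff₀ (by linarith)).1 (ht2.trans_le (min_le_right _ _)))
    have h6 := hmin (show x - t ∈ Icc c x from
      ⟨by linarith [ht2.trans_le (min_le_left _ _)], by linarith⟩)
    simp only [mem_ofPred_eq] at h6
    simp only [mul_zero, sub_zero, Real.log_one, sub_sub_cancel, add_zero] at ht1 h5
    have h7 : 0 < (R - M lam) / 2 * t := mul_pos (by linarith) ht3
    linarith
  · have hxI : x ∈ Ioo c d := ⟨hcx, hxd⟩
    have h1 : P =ᶠ[𝓝 x] p := by
      filter_upwards [Icc_mem_nhds hcx hxd] with y hy using hP y hy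
    have h2 := hw.le_of_isLocalMin (Eventually.of_forall hφ)
      ((hp.hasDerivAt hxI).congr_of_eventuallyEq h1)
      (by filter_upwards [Icc_mem_nhds hcx hxd] with y hy using hmin hy)
    rw [hP x hx, mul_div_cancel₀ _ (ha x hx).ne'] at h2
    linarith

/-- The clamped solution started at R can leave [-R, R] only through -R. Up to its first visit to -R
the clamp is inactive, so it would be a true solution descending from R to -R, which `not_descends`
forbids. -/
lemma IsViscositySupersolution.exists_solvesOn (h : Admissible M a H) {mu R : ℝ} {w : ℝ → ℝ}
    (hw : IsViscositySupersolution a H mu w) (hmu : mu < lam) (hR : M lam < R) (hcd : c ≤ d)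
    (ha : ∀ y ∈ Icc c d, 0 < a y) :
    ∃ p : ℝ → ℝ, SolvesOn a H lam c d p ∧ ∀ y ∈ Icc c d, |p y| ≤ R := by
  obtain ⟨p, hpc, hpR, hp⟩ := h.exists_clamped_solution_le hcd ha hR.le
  have hM1 := h.one_le_M lam
  have hpcont : ContinuousOn p (Icc c d) := fun y hy => (hp y hy).continuousWithinAt
  suffices hlow : ∀ y ∈ Icc c d, -R ≤ p y by
    have hpa : ∀ y ∈ Icc c d, |p y| ≤ R := fun y hy => abs_le.2 ⟨hlow y hy, hpR y hy⟩
    refine ⟨p, fun y hy => ?_, hpa⟩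
    have := hp y hy
    rwa [clamp_eq_self (hpa y hy)] at this
  intro e₀ he₀
  by_contra! hcon
  have hsub : Icc c e₀ ⊆ Icc c d := Icc_subset_Icc le_rfl he₀.2
  have hcl : IsCompact (Icc c e₀ ∩ p ⁻¹' {-R}) :=
    isCompact_Icc.of_isClosed_subset
      ((hpcont.mono hsub).preimage_isClosed_of_isClosed isClosed_Icc isClosed_singleton)
      inter_subset_left
  have hivt : ∀ y ∈ Icc c e₀, p y ≤ -R → ∃ e ∈ Icc c y, p e = -R := fun y hy hpy => by
    obtain ⟨e, he, he'⟩ := intermediate_value_Icc' hy.1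
      (hpcont.mono ((Icc_subset_Icc le_rfl hy.2).trans hsub))
      (show -R ∈ Icc (p y) (p c) from ⟨hpy, by linarith⟩)
    exact ⟨e, he, he'⟩
  obtain ⟨e₁, he₁, he₁'⟩ := hivt e₀ ⟨he₀.1, le_rfl⟩ hcon.le
  obtain ⟨e, ⟨he, hpe⟩, hleast⟩ := hcl.exists_isLeast ⟨e₁, he₁, he₁'⟩
  simp only [mem_preimage, mem_singleton_iff] at hpe
  have hce : c < e := by
    refine lt_of_le_of_ne he.1 ?_
    rintro rfl; linarith
  have hsub' : Icc c e ⊆ Icc c d := Icc_subset_Icc le_rfl (he.2.trans he₀.2)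
  have hpa : ∀ y ∈ Icc c e, |p y| ≤ R := fun y hy => by
    refine abs_le.2 ⟨?_, hpR y (hsub' hy)⟩
    by_contra! hlt
    obtain ⟨e₂, he₂, he₂'⟩ := hivt y ⟨hy.1, hy.2.trans he.2⟩ hlt.le
    have h1 := hleast (show e₂ ∈ Icc c e₀ ∩ p ⁻¹' {-R} from
      ⟨⟨he₂.1, he₂.2.trans (hy.2.trans he.2)⟩, he₂'⟩)
    have h2 : y = e := le_antisymm hy.2 (h1.trans he₂.2)
    rw [h2] at hlt
    linarith
  refine hw.not_descends h hmu hR hce (fun y hy => ha y (hsub' hy)) (p := p) ?_ hpc hpe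
  intro y hy
  have := (hp y (hsub' hy)).mono hsub'
  rwa [clamp_eq_self (hpa y hy)] at this

end Existence

/-! ### Compactness of bounded slopes -/

section Compactness

variable {M : ℝ → ℝ} {a : ℝ → ℝ} {H : ℝ → ℝ → ℝ} {lam c d : ℝ}

lemma exists_sub_eq_deriv_mul {p p' : ℝ → ℝ}
    (hp : ∀ y ∈ Icc c d, HasDerivWithinAt p (p' y) (Icc c d) y) {x y : ℝ} (hx : x ∈ Icc c d)
    (hy : y ∈ Icc c d) :
    ∃ z ∈ Icc c d, |z - x| ≤ |y - x| ∧ p y - p x = p' z * (y - x) := by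
  have key : ∀ s ∈ Icc c d, ∀ t ∈ Icc c d, s < t →
      ∃ z ∈ Ioo s t, p t - p s = p' z * (t - s) := fun s hs t ht hst => by
    have hsub : Icc s t ⊆ Icc c d := Icc_subset_Icc hs.1 ht.2
    obtain ⟨z, hz, hz'⟩ := exists_hasDerivAt_eq_slope p p' hst
      (fun w hw => ((hp w (hsub hw)).mono hsub).continuousWithinAt)
      (fun w hw => (hp w (hsub (Ioo_subset_Icc_self hw))).hasDerivAt
        (Icc_mem_nhds (hs.1.trans_lt hw.1) (hw.2.trans_le ht.2)))
    refine ⟨z, hz, ?_⟩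
    rw [hz', div_mul_cancel₀ _ (by linarith)]
  rcases lt_trichotomy x y with hxy | rfl | hxy
  · obtain ⟨z, hz, hz'⟩ := key x hx y hy hxy
    refine ⟨z, ⟨hx.1.trans hz.1.le, hz.2.le.trans hy.2⟩, ?_, hz'⟩
    rw [abs_of_pos (by linarith [hz.1]), abs_of_pos (by linarith)]
    linarith [hz.2]
  · exact ⟨x, hx, le_rfl, by simp⟩
  · obtain ⟨z, hz, hz'⟩ := key y hy x hx hxy
    refine ⟨z, ⟨hy.1.trans hz.1.le, hz.2.le.trans hx.2⟩, ?_, by linarith⟩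
    rw [abs_of_neg (by linarith [hz.2]), abs_of_neg (by linarith)]
    linarith [hz.1]

/-- Bounded solutions have a second-order Taylor estimate which is uniform in the solution. -/
lemma Admissible.exists_taylor_bound (h : Admissible M a H) {m N R : ℝ} (hm : 0 < m)
    (hN : 0 ≤ N) (ha : ∀ y ∈ Icc c d, m ≤ a y) :
    ∃ C, ∀ mu p, |mu| ≤ N → SolvesOn a H mu c d p → (∀ y ∈ Icc c d, |p y| ≤ R) →
      ∀ x ∈ Icc c d, ∀ y ∈ Icc c d,
        |p y - p x - (mu - H x (p x)) / a x * (y - x)| ≤ C * (y - x) ^ 2 := by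
  obtain ⟨L, hL, hL'⟩ := h.H_lip R
  obtain ⟨B, hB, hB'⟩ := h.H_bdd R
  obtain ⟨A, hA⟩ := h.a_lip
  -- D bounds the derivative of every such p. The final constant is a Lipschitz constant of the
  -- right-hand side along p, and depends neither on p nor on mu.
  set D := (N + B) / m with hD
  have hD0 : 0 ≤ D := by positivity
  refine ⟨L * (1 + D) / m + (N + B) * (|A| / m ^ 2), fun mu p hmu hp hpR x hx y hy => ?_⟩
  set G : ℝ → ℝ := fun z => mu - H z (p z) with hG
  have hGb : ∀ z ∈ Icc c d, |G z| ≤ N + B := fun z hz =>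
    (abs_sub _ _).trans (add_le_add hmu (hB' z _ (hpR z hz)))
  have hapos : ∀ z ∈ Icc c d, 0 < a z := fun z hz => hm.trans_le (ha z hz)
  have hpD : ∀ z ∈ Icc c d, |p z - p x| ≤ D * |z - x| := fun z hz => by
    obtain ⟨t, ht, -, ht'⟩ := exists_sub_eq_deriv_mul hp hx hz
    rw [ht', abs_mul]
    refine mul_le_mul_of_nonneg_right ?_ (abs_nonneg _)
    rw [abs_div, abs_of_pos (hapos t ht), hD]
    exact div_le_div₀ (by positivity) (hGb t ht) hm (ha t ht)
  obtain ⟨z, hz, hzy, hz'⟩ := exists_sub_eq_deriv_mul hp hx hy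
  rw [hz', ← sub_mul, abs_mul]
  have h1 : |G z / a z - G x / a x| ≤ (L * (1 + D) / m + (N + B) * (|A| / m ^ 2)) * |z - x| := by
    have e : G z / a z - G x / a x = (G z - G x) / a z + G x * ((a x - a z) / (a z * a x)) := by
      have := (hapos z hz).ne'
      have := (hapos x hx).ne'
      field_simp
      ring
    rw [e]
    refine (abs_add_le _ _).trans ?_
    rw [add_mul]
    refine add_le_add ?_ ?_
    · rw [abs_div, abs_of_pos (hapos z hz), div_le_iff₀ (hapos z hz)]
      have h2 : |G z - G x| ≤ L * (1 + D) * |z - x| := by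
        have h3 := hL' x z (p x) (p z) (hpR x hx) (hpR z hz)
        have e2 : G z - G x = H x (p x) - H z (p z) := by simp only [hG]; ring
        rw [e2]
        refine h3.trans ?_
        rw [abs_sub_comm x, abs_sub_comm (p x), mul_assoc]
        refine mul_le_mul_of_nonneg_left ?_ hL.le
        linarith [hpD z hz]
      refine h2.trans ?_
      calc L * (1 + D) * |z - x| = L * (1 + D) / m * |z - x| * m := by field_simp
        _ ≤ _ := mul_le_mul_of_nonneg_left (ha z hz) (by positivity)
    · rw [abs_mul, mul_assoc]
      refine mul_le_mul (hGb x hx) ?_ (abs_nonneg _) (by positivity)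
      rw [abs_div, abs_of_pos (mul_pos (hapos z hz) (hapos x hx)),
        div_le_iff₀ (mul_pos (hapos z hz) (hapos x hx))]
      have h4 : |a x - a z| ≤ |A| * |z - x| := by
        rw [abs_sub_comm]
        exact (hA z x).trans (mul_le_mul_of_nonneg_right (le_abs_self A) (abs_nonneg _))
      refine h4.trans ?_
      calc |A| * |z - x| = |A| / m ^ 2 * |z - x| * (m * m) := by field_simp
        _ ≤ _ := mul_le_mul_of_nonneg_left
          (mul_le_mul (ha z hz) (ha x hx) hm.le (hapos z hz).le) (by positivity)
  have hC0 : 0 ≤ L * (1 + D) / m + (N + B) * (|A| / m ^ 2) := by positivity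
  calc |G z / a z - G x / a x| * |y - x|
      ≤ ((L * (1 + D) / m + (N + B) * (|A| / m ^ 2)) * |y - x|) * |y - x| := by
        refine mul_le_mul_of_nonneg_right (h1.trans ?_) (abs_nonneg _)
        exact mul_le_mul_of_nonneg_left hzy hC0
    _ = _ := by rw [mul_assoc, ← sq, sq_abs]

lemma hasDerivAt_of_quadratic_bound {p : ℝ → ℝ} {x D C ρ : ℝ} (hρ : 0 < ρ)
    (hb : ∀ y ∈ Icc (x - ρ) (x + ρ), |p y - p x - D * (y - x)| ≤ C * (y - x) ^ 2) :
    HasDerivAt p D x := by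
  rw [hasDerivAt_iff_isLittleO]
  have h1 : (fun y => p y - p x - (y - x) • D) =O[𝓝 x] fun y => (y - x) ^ 2 := by
    refine Asymptotics.IsBigO.of_bound C ?_
    filter_upwards [Icc_mem_nhds (sub_lt_self x hρ) (lt_add_of_pos_right x hρ)] with y hy
    rw [Real.norm_eq_abs, Real.norm_eq_abs, abs_of_nonneg (sq_nonneg (y - x)), smul_eq_mul,
      mul_comm (y - x)]
    exact hb y hy
  refine h1.trans_isLittleO ?_
  have h2 : Tendsto (fun y => y - x) (𝓝 x) (𝓝 0) := by
    simpa using (continuous_sub_right x).tendsto x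
  have h3 : (fun t : ℝ => t ^ 2) =o[𝓝 0] fun t => t := by
    simpa using Asymptotics.isLittleO_pow_id (𝕜 := ℝ) one_lt_two
  exact h3.comp_tendsto h2

/-- Compactness of bounded solutions on increasing intervals. -/
lemma Admissible.exists_limit_solution (h : Admissible M a H) {l r R : ℝ} {c d mu : ℕ → ℝ}
    {p : ℕ → ℝ → ℝ} (ha : ∀ y ∈ Ioo l r, 0 < a y) (hc : Tendsto c atTop (𝓝 l))
    (hd : Tendsto d atTop (𝓝 r)) (hmu : Tendsto mu atTop (𝓝 lam))
    (hp : ∀ n, SolvesOn a H (mu n) (c n) (d n) (p n))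
    (hpR : ∀ n, ∀ y ∈ Icc (c n) (d n), |p n y| ≤ R) :
    ∃ q : ℝ → ℝ, (∀ x ∈ Ioo l r, HasDerivAt q ((lam - H x (q x)) / a x) x ∧ |q x| ≤ R) ∧
      ∀ x ∈ Ioo l r, ∀ k, (∀ᶠ n in atTop, k ≤ p n x) → k ≤ q x := by
  -- Along a nonprincipal ultrafilter the bounded sequences p n x converge for all x at once,
  -- without extracting subsequences. The uniform Taylor estimate passes to this pointwise limit and
  -- makes it differentiable with the right derivative.
  set U : Filter ℕ := (hyperfilter ℕ : Filter ℕ) with hU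
  have hUle : U ≤ atTop := by rw [← Nat.cofinite_eq_atTop]; exact hyperfilter_le_cofinite
  have : U.NeBot := (hyperfilter ℕ).neBot
  have hev : ∀ x ∈ Ioo l r, ∀ᶠ n in atTop, x ∈ Icc (c n) (d n) := fun x hx => by
    filter_upwards [hc.eventually (Iic_mem_nhds hx.1), hd.eventually (Ici_mem_nhds hx.2)]
      with n h1 h2 using ⟨h1, h2⟩
  have hlim : ∀ x : ℝ, ∃ t, x ∈ Ioo l r → (|t| ≤ R ∧ Tendsto (fun n => p n x) U (𝓝 t)) := by
    intro x
    by_cases hx : x ∈ Ioo l r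
    · obtain ⟨t, ht, ht'⟩ := (isCompact_Icc (a := -R) (b := R)).ultrafilter_le_nhds
        ((hyperfilter ℕ).map fun n => p n x) (by
          rw [le_principal_iff]
          change ∀ᶠ n in U, p n x ∈ Icc (-R) R
          filter_upwards [hUle (hev x hx)] with n hn using abs_le.1 (hpR n x hn))
      exact ⟨t, fun _ => ⟨abs_le.2 ht, ht'⟩⟩
    · exact ⟨0, fun hx' => absurd hx' hx⟩
  choose q hq using hlim
  refine ⟨q, fun x hx => ⟨?_, (hq x hx).1⟩, fun x hx k hk => ?_⟩
  swap
  · exact ge_of_tendsto (hq x hx).2 (hUle hk)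
  set ρ := min (x - l) (r - x) / 2 with hρ
  have hρ0 : 0 < ρ := by
    have := lt_min (sub_pos.2 hx.1) (sub_pos.2 hx.2)
    linarith
  have hsub : Icc (x - ρ) (x + ρ) ⊆ Ioo l r := fun y hy => by
    have h1 := min_le_left (x - l) (r - x)
    have h2 := min_le_right (x - l) (r - x)
    constructor <;> linarith [hy.1, hy.2, hx.1, hx.2]
  have hle : x - ρ ≤ x + ρ := by linarith
  obtain ⟨m, hm, hma⟩ := h.exists_pos_le hle fun y hy => ha y (hsub hy)
  obtain ⟨C, hC⟩ := h.exists_taylor_bound (R := R) (N := |lam| + 1) hm (by positivity) hma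
  refine hasDerivAt_of_quadratic_bound hρ0 (C := C) fun y hy => ?_
  have hxx : x ∈ Icc (x - ρ) (x + ρ) := ⟨by linarith, by linarith⟩
  have hl1 : x - ρ ∈ Ioo l r := hsub ⟨le_rfl, hle⟩
  have hr1 : x + ρ ∈ Ioo l r := hsub ⟨hle, le_rfl⟩
  have hbound : ∀ᶠ n in U,
      |p n y - p n x - (mu n - H x (p n x)) / a x * (y - x)| ≤ C * (y - x) ^ 2 := by
    filter_upwards [hUle (hev _ hl1), hUle (hev _ hr1),
      hUle (hmu.abs.eventually (Iic_mem_nhds (lt_add_one |lam|)))] with n h1 h2 h3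
    exact hC (mu n) (p n) h3 ((hp n).mono h1.1 h2.2)
      (fun z hz => hpR n z ⟨h1.1.trans hz.1, hz.2.trans h2.2⟩) x hxx y hy
  have hHc : Continuous fun t => H x t := h.continuous_H_comp continuous_const continuous_id
  have ht : Tendsto (fun n => |p n y - p n x - (mu n - H x (p n x)) / a x * (y - x)|) U
      (𝓝 |q y - q x - (lam - H x (q x)) / a x * (y - x)|) :=
    ((((hq y (hsub hy)).2.sub (hq x hx).2).sub
      ((((hmu.mono_left hUle).sub ((hHc.tendsto _).comp (hq x hx).2)).div_const _).mul_const _))).abs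
  exact le_of_tendsto ht hbound

end Compactness

/-! ### Behaviour of slopes at the ends of a component -/

/-- `p` solves the equation `a p' + H(y, p) = lam` for the slope of a solution on `(l, r)`. -/
def SolvesOnIoo (a : ℝ → ℝ) (H : ℝ → ℝ → ℝ) (lam l r : ℝ) (p : ℝ → ℝ) : Prop :=
  ∀ y ∈ Ioo l r, HasDerivAt p ((lam - H y (p y)) / a y) y

/-- `(l, r)` is a bounded connected component of `{a > 0}`. -/
structure IsComponent (a : ℝ → ℝ) (l r : ℝ) : Prop where
  lt : l < r
  left : a l = 0
  right : a r = 0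
  pos : ∀ y ∈ Ioo l r, 0 < a y

section Endpoints

variable {M : ℝ → ℝ} {a : ℝ → ℝ} {H : ℝ → ℝ → ℝ} {lam l r R : ℝ}

lemma SolvesOnIoo.solvesOn {p : ℝ → ℝ} (hp : SolvesOnIoo a H lam l r p) {c d : ℝ} (hc : l < c)
    (hd : d < r) : SolvesOn a H lam c d p := fun y hy =>
  (hp y ⟨hc.trans_le hy.1, hy.2.trans_lt hd⟩).hasDerivWithinAt

lemma SolvesOnIoo.reflect {p : ℝ → ℝ} (hp : SolvesOnIoo a H lam l r p) :
    SolvesOnIoo (fun x => a (-x)) (fun x p => H (-x) (-p)) lam (-r) (-l) (fun x => - p (-x)) := by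
  intro y hy
  have h1 := (hp (-y) ⟨by linarith [hy.2], by linarith [hy.1]⟩)
  have h2 := (h1.scomp y (hasDerivAt_neg y)).fun_neg
  simpa [Function.comp_def] using h2

/-- The function f - k/(x - l) is nonincreasing, so f is unbounded near l. Quadratic vanishing of
the diffusion produces exactly such derivatives when the limit slope is not a root. -/
lemma false_of_deriv_le_neg_div_sq {f f' : ℝ → ℝ} {k : ℝ} (hlr : l < r) (hk : 0 < k)
    (hf : ∀ x ∈ Ioo l r, HasDerivAt f (f' x) x) (hf' : ∀ x ∈ Ioo l r, f' x ≤ -(k / (x - l) ^ 2))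
    (hR : ∀ x ∈ Ioo l r, |f x| ≤ R) : False := by
  set g : ℝ → ℝ := fun x => f x - k / (x - l) with hg
  have hd : ∀ x ∈ Ioo l r, HasDerivAt g (f' x + k / (x - l) ^ 2) x := fun x hx => by
    have hne : x - l ≠ 0 := by linarith [hx.1]
    refine ((hf x hx).fun_sub ((hasDerivAt_const x k).fun_div
      ((hasDerivAt_id x).sub_const l) hne)).congr_deriv ?_
    simp only [id]
    field_simp
    ring
  have hanti : AntitoneOn g (Ioo l r) := by
    refine antitoneOn_of_deriv_nonpos (convex_Ioo l r)
      (fun x hx => (hd x hx).continuousAt.continuousWithinAt) ?_ ?_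
    · rw [interior_Ioo]
      exact fun x hx => (hd x hx).differentiableAt.differentiableWithinAt
    · rw [interior_Ioo]
      intro x hx
      rw [(hd x hx).deriv]
      linarith [hf' x hx]
  set b := (l + r) / 2 with hb
  have hbI : b ∈ Ioo l r := by constructor <;> linarith
  have hR0 : 0 ≤ R := (abs_nonneg _).trans (hR b hbI)
  -- Where k/(x - l) = T, monotonicity gives f x ≥ f b + T - k/(b - l) ≥ R + 1.
  set T := 2 * R + k / (b - l) + 1 with hT
  have hbl : 0 < b - l := by linarith [hbI.1]
  have hT0 : 0 < T := by positivity
  set x := l + k / T with hx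
  have hkT : 0 < k / T := by positivity
  have hxb : x ≤ b := by
    have : k / T ≤ b - l := by
      rw [div_le_iff₀ hT0]
      have h1 : (b - l) * (k / (b - l)) = k := by field_simp
      nlinarith
    linarith
  have hxI : x ∈ Ioo l r := ⟨by linarith, by linarith [hbI.2]⟩
  have h1 := hanti hxI hbI hxb
  have e : k / (x - l) = T := by
    have : x - l = k / T := by rw [hx]; ring
    rw [this]; field_simp
  simp only [hg, e] at h1
  linarith [(abs_le.1 (hR x hxI)).2, (abs_le.1 (hR b hbI)).1]

/-- A bounded solution has a limit at a left endpoint where the diffusion vanishes, and the limit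
solves the first-order equation. -/
lemma Admissible.exists_tendsto_left (h : Admissible M a H) (hlr : l < r) (hl : a l = 0)
    (ha : ∀ y ∈ Ioo l r, 0 < a y) {p : ℝ → ℝ} (hp : SolvesOnIoo a H lam l r p)
    (hR : ∀ y ∈ Ioo l r, |p y| ≤ R) : ∃ P, H l P = lam ∧ Tendsto p (𝓝[>] l) (𝓝 P) := by
  have hIoo : ∀ᶠ y in 𝓝[>] l, y ∈ Ioo l r := Ioo_mem_nhdsGT hlr
  obtain ⟨P, hP⟩ : ∃ P, Tendsto p (𝓝[>] l) (𝓝 P) := by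
    -- If H l k ≠ lam, then lam - H y k keeps its sign for y near l, so p can cross the level k in
    -- one direction only and cannot oscillate across it.
    refine tendsto_of_no_upcrossings (h.dense_H_ne l lam) ?_
      ⟨R, by simpa using hIoo.mono fun y hy => (abs_le.1 (hR y hy)).2⟩
      ⟨-R, by simpa using hIoo.mono fun y hy => (abs_le.1 (hR y hy)).1⟩
    rintro k hk k₂ - hkk ⟨hlow, hhigh⟩
    have hhigh : ∃ᶠ y in 𝓝[>] l, k < p y := hhigh.mono fun y hy => hkk.trans hy
    have hderiv : ∀ c d, l < c → d < r → ∀ y ∈ Icc c d,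
        HasDerivWithinAt p ((lam - H y (p y)) / a y) (Icc c d) y := fun c d hc hd =>
      hp.solvesOn hc hd
    have hconst : ∀ c d : ℝ, ∀ y ∈ Icc c d,
        HasDerivWithinAt (fun _ => k) ((fun _ => 0 : ℝ → ℝ) y) (Icc c d) y := fun c d y _ =>
      hasDerivWithinAt_const _ _ _
    rcases lt_or_gt_of_ne hk with hk | hk
    · obtain ⟨δ, hδ, hδ'⟩ := mem_nhdsGT_iff_exists_Ioo_subset.1
        (mem_nhdsWithin_of_mem_nhds (h.eventually_H_lt hk) : _ ∈ 𝓝[>] l)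
      obtain ⟨x, hx1, hx2, hx3⟩ := (hlow.and_eventually
        (hIoo.and (Ioo_mem_nhdsGT (show l < δ from hδ)))).exists
      obtain ⟨y, hy1, hy2⟩ := (hhigh.and_eventually (Ioo_mem_nhdsGT hx2.1)).exists
      have := le_of_deriv_lt_of_eq (hconst y x) (hderiv y x hy2.1 hx2.2) hy1.le
        (fun z hz he => div_pos (by
          rw [← he]
          have : H z k < lam := hδ' ⟨hy2.1.trans_le hz.1, hz.2.trans_lt hx3.2⟩
          linarith) (ha z ⟨hy2.1.trans_le hz.1, hz.2.trans_lt hx2.2⟩)) x ⟨hy2.2.le, le_rfl⟩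
      linarith
    · obtain ⟨δ, hδ, hδ'⟩ := mem_nhdsGT_iff_exists_Ioo_subset.1
        (mem_nhdsWithin_of_mem_nhds (h.eventually_lt_H hk) : _ ∈ 𝓝[>] l)
      obtain ⟨x, hx1, hx2, hx3⟩ := (hhigh.and_eventually
        (hIoo.and (Ioo_mem_nhdsGT (show l < δ from hδ)))).exists
      obtain ⟨y, hy1, hy2⟩ := (hlow.and_eventually (Ioo_mem_nhdsGT hx2.1)).exists
      have := le_of_deriv_lt_of_eq (hderiv y x hy2.1 hx2.2) (hconst y x) hy1.le
        (fun z hz he => div_neg_of_neg_of_pos (by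
          rw [he]
          have : lam < H z k := hδ' ⟨hy2.1.trans_le hz.1, hz.2.trans_lt hx3.2⟩
          linarith) (ha z ⟨hy2.1.trans_le hz.1, hz.2.trans_lt hx2.2⟩)) x ⟨hy2.2.le, le_rfl⟩
      linarith
  refine ⟨P, ?_, hP⟩
  obtain ⟨B, hB, hB'⟩ := h.a_quad
  have hHt : Tendsto (fun y => H y (p y)) (𝓝[>] l) (𝓝 (H l P)) :=
    (h.continuous_H.tendsto (l, P)).comp
      ((tendsto_id.mono_left nhdsWithin_le_nhds).prodMk_nhds hP)
  have haB : ∀ y ∈ Ioo l r, ∀ ε > 0, ε / B / (y - l) ^ 2 ≤ ε / a y := fun y hy ε hε => by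
    rw [div_div]
    exact div_le_div_of_nonneg_left hε.le (ha y hy) (hB' l y hl)
  -- If P were not a root, |p'| would be at least a constant over (y - l)² near l, and p could not
  -- stay bounded.
  rcases lt_trichotomy (H l P) lam with hlt | heq | hgt
  · exfalso
    set ε := (lam - H l P) / 2 with hε
    have hε0 : 0 < ε := by linarith
    obtain ⟨δ, hδ, hδ'⟩ := mem_nhdsGT_iff_exists_Ioo_subset.1
      ((hHt.eventually (gt_mem_nhds (show H l P < lam - ε by linarith))).and hIoo)
    have hδ : l < δ := hδ
    refine false_of_deriv_le_neg_div_sq hδ (div_pos hε0 hB) (f := fun y => - p y)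
      (fun y hy => (hp y (hδ' hy).2).fun_neg) (fun y hy => ?_)
      (fun y hy => by rw [abs_neg]; exact hR y (hδ' hy).2)
    have h1 := haB y (hδ' hy).2 ε hε0
    have h2 : ε / a y ≤ (lam - H y (p y)) / a y := by
      have := ha y (hδ' hy).2
      have h3 : H y (p y) < lam - ε := (hδ' hy).1
      gcongr
      linarith
    linarith
  · exact heq
  · exfalso
    set ε := (H l P - lam) / 2 with hε
    have hε0 : 0 < ε := by linarith
    obtain ⟨δ, hδ, hδ'⟩ := mem_nhdsGT_iff_exists_Ioo_subset.1
      ((hHt.eventually (lt_mem_nhds (show lam + ε < H l P by linarith))).and hIoo)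
    have hδ : l < δ := hδ
    refine false_of_deriv_le_neg_div_sq hδ (div_pos hε0 hB) (f := p)
      (fun y hy => hp y (hδ' hy).2) (fun y hy => ?_) (fun y hy => hR y (hδ' hy).2)
    have h1 := haB y (hδ' hy).2 ε hε0
    have h2 : ε / a y ≤ (H y (p y) - lam) / a y := by
      have := ha y (hδ' hy).2
      have h3 : lam + ε < H y (p y) := (hδ' hy).1
      gcongr
      linarith
    have h4 : (lam - H y (p y)) / a y = -((H y (p y) - lam) / a y) := by ring
    linarith

lemma Admissible.exists_tendsto_right (h : Admissible M a H) (hlr : l < r) (hr : a r = 0)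
    (ha : ∀ y ∈ Ioo l r, 0 < a y) {p : ℝ → ℝ} (hp : SolvesOnIoo a H lam l r p)
    (hR : ∀ y ∈ Ioo l r, |p y| ≤ R) : ∃ P, H r P = lam ∧ Tendsto p (𝓝[<] r) (𝓝 P) := by
  obtain ⟨P, hP, hP'⟩ := h.reflect.exists_tendsto_left (l := -r) (r := -l) (by linarith)
    (by simpa using hr) (fun y hy => ha _ ⟨by linarith [hy.2], by linarith [hy.1]⟩) hp.reflect
    (R := R) (fun y hy => by
      rw [abs_neg]; exact hR _ ⟨by linarith [hy.2], by linarith [hy.1]⟩)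
  refine ⟨-P, by simpa using hP, ?_⟩
  have h1 : Tendsto (fun y : ℝ => -y) (𝓝[<] r) (𝓝[>] (-r)) := by
    refine tendsto_nhdsWithin_iff.2 ⟨(continuous_neg.tendsto r).mono_left nhdsWithin_le_nhds, ?_⟩
    filter_upwards [self_mem_nhdsWithin] with y hy
    exact neg_lt_neg (mem_Iio.1 hy)
  simpa [Function.comp_def] using (hP'.comp h1).neg

lemma isUpperRoot_of_le {mu x P Q : ℝ} (hmu : mu < lam) (hP : H x P = lam) (hQ : H x Q = mu)
    (hle : Q ≤ P) : IsUpperRoot H lam x P := by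
  refine ⟨hP, Q, lt_of_le_of_ne hle ?_, by linarith⟩
  rintro rfl
  linarith

/-- Near l there is a fixed slope k below p with H y k < t < H y (p y). If p < q at some point,
quasiconvexity along k < p < q gives H(p) < H(q), so q - p decreases wherever it is positive. As q -
p tends to 0 at l, it cannot become positive. -/
lemma SolvesOnIoo.eventually_le (h : Admissible M a H) (hlr : l < r)
    (ha : ∀ y ∈ Ioo l r, 0 < a y) {p q : ℝ → ℝ} {P : ℝ} (hP : IsUpperRoot H lam l P)
    (hp : SolvesOnIoo a H lam l r p) (hq : SolvesOnIoo a H lam l r q)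
    (hpP : Tendsto p (𝓝[>] l) (𝓝 P)) (hqP : Tendsto q (𝓝[>] l) (𝓝 P)) :
    ∀ᶠ y in 𝓝[>] l, q y ≤ p y := by
  obtain ⟨hPl, k, hk, hk'⟩ := id hP
  have hIoo : ∀ᶠ y in 𝓝[>] l, y ∈ Ioo l r := Ioo_mem_nhdsGT hlr
  have hHk : ∀ᶠ y in 𝓝[>] l, H y k < (lam + H l k) / 2 :=
    mem_nhdsWithin_of_mem_nhds (h.eventually_H_lt (by linarith))
  set t := (lam + H l k) / 2 with ht
  have hHt : Tendsto (fun y => H y (p y)) (𝓝[>] l) (𝓝 (H l P)) :=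
    (h.continuous_H.tendsto (l, P)).comp
      ((tendsto_id.mono_left nhdsWithin_le_nhds).prodMk_nhds hpP)
  obtain ⟨δ, hδ, hδ'⟩ := mem_nhdsGT_iff_exists_Ioo_subset.1
    (hIoo.and
      ((hHt.eventually (lt_mem_nhds (show t < H l P by linarith))).and
        ((hpP.eventually (lt_mem_nhds hk)).and hHk)))
  filter_upwards [Ioo_mem_nhdsGT (show l < δ from hδ)] with x hx
  by_contra! hlt
  set D : ℝ → ℝ := fun y => q y - p y with hD
  have hDd : ∀ y ∈ Ioo l r, HasDerivAt D
      ((lam - H y (q y)) / a y - (lam - H y (p y)) / a y) y := fun y hy =>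
    (hq y hy).fun_sub (hp y hy)
  have hD0 : Tendsto D (𝓝[>] l) (𝓝 0) := by simpa using hqP.sub hpP
  have hDx : 0 < D x := by simp only [hD]; linarith
  obtain ⟨y, hy1, hy2⟩ := ((hD0.eventually (gt_mem_nhds (half_pos hDx))).and
    (Ioo_mem_nhdsGT hx.1)).exists
  have hxr : x < r := (hδ' hx).1.2
  have := le_of_deriv_lt_of_eq (c := y) (d := x) (f := D) (g := fun _ => D x / 2)
    (g' := fun _ => 0)
    (fun z hz => (hDd z ⟨hy2.1.trans_le hz.1, hz.2.trans_lt hxr⟩).hasDerivWithinAt)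
    (fun z _ => hasDerivWithinAt_const _ _ _) hy1.le (fun z hz he => by
      have hzI : z ∈ Ioo l δ := ⟨hy2.1.trans_le hz.1, hz.2.trans_lt hx.2⟩
      obtain ⟨hz1, hz2, hz3, hz4⟩ := hδ' hzI
      have hpq : p z < q z := by simp only [hD] at he; linarith
      have h1 := h.sqc z k (p z) (q z) hz3 hpq
      rw [← sub_div]
      refine div_neg_of_neg_of_pos ?_ (ha z hz1)
      rcases lt_max_iff.1 h1 with h2 | h2 <;> linarith) x ⟨hy2.2.le, le_rfl⟩
  linarith

/-- The bounded solution issuing from the larger root at the left endpoint is unique. -/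
lemma SolvesOnIoo.eq_of_tendsto (h : Admissible M a H) (hlr : l < r)
    (ha : ∀ y ∈ Ioo l r, 0 < a y) {p q : ℝ → ℝ} {P : ℝ} (hP : IsUpperRoot H lam l P)
    (hp : SolvesOnIoo a H lam l r p) (hq : SolvesOnIoo a H lam l r q)
    (hpP : Tendsto p (𝓝[>] l) (𝓝 P)) (hqP : Tendsto q (𝓝[>] l) (𝓝 P))
    (hpR : ∀ y ∈ Ioo l r, |p y| ≤ R) (hqR : ∀ y ∈ Ioo l r, |q y| ≤ R) :
    ∀ y ∈ Ioo l r, p y = q y := by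
  intro x hx
  -- The two comparisons near l make p and q agree at some c. To the right of c the equation is
  -- Lipschitz in the slope and classical uniqueness applies.
  obtain ⟨c, ⟨hc1, hc2⟩, hc3⟩ := (((hp.eventually_le h hlr ha hP hq hpP hqP).and
    (hq.eventually_le h hlr ha hP hp hqP hpP)).and (Ioo_mem_nhdsGT hx.1)).exists
  have hsub : Icc c x ⊆ Ioo l r := fun y hy => ⟨hc3.1.trans_le hy.1, hy.2.trans_lt hx.2⟩
  obtain ⟨m, hm, hma⟩ := h.exists_pos_le hc3.2.le fun y hy => ha y (hsub hy)
  obtain ⟨L, hL, hL'⟩ := h.H_lip R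
  have hlip : ∀ y ∈ Ico c x, LipschitzOnWith ⟨L / m, by positivity⟩
      (fun t => (lam - H y t) / a y) (Icc (-R) R) := fun y hy => by
    have hay := ha y (hsub (Ico_subset_Icc_self hy))
    refine LipschitzOnWith.of_dist_le_mul fun s hs t ht => ?_
    simp only [Real.dist_eq]
    rw [← sub_div, abs_div, abs_of_pos hay, div_le_iff₀ hay, sub_sub_sub_cancel_left]
    have h1 := hL' y y t s (abs_le.2 ht) (abs_le.2 hs)
    rw [sub_self, abs_zero, zero_add, abs_sub_comm t] at h1
    refine h1.trans ?_
    calc L * |s - t| = L / m * |s - t| * m := by field_simp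
      _ ≤ _ := mul_le_mul_of_nonneg_left (hma y (Ico_subset_Icc_self hy)) (by positivity)
  exact ODE_solution_unique_of_mem_Icc_right (v := fun y t => (lam - H y t) / a y)
    (s := fun _ => Icc (-R) R) hlip
    (fun y hy => (hp y (hsub hy)).continuousAt.continuousWithinAt)
    (fun y hy => (hp y (hsub (Ico_subset_Icc_self hy))).hasDerivWithinAt)
    (fun y hy => abs_le.1 (hpR y (hsub (Ico_subset_Icc_self hy))))
    (fun y hy => (hq y (hsub hy)).continuousAt.continuousWithinAt)
    (fun y hy => (hq y (hsub (Ico_subset_Icc_self hy))).hasDerivWithinAt)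
    (fun y hy => abs_le.1 (hqR y (hsub (Ico_subset_Icc_self hy))))
    (le_antisymm hc2 hc1) ⟨hc3.2.le, le_rfl⟩

/-- Comparison on a component: bounded solutions at a lower level lie below the solution issuing
from the larger root. -/
lemma SolvesOnIoo.le_of_level_lt (h : Admissible M a H) (hI : IsComponent a l r) {mu : ℝ}
    (hmu : mu < lam) {p q : ℝ → ℝ} {P : ℝ} (hP : IsUpperRoot H lam l P)
    (hp : SolvesOnIoo a H lam l r p) (hpP : Tendsto p (𝓝[>] l) (𝓝 P))
    (hq : SolvesOnIoo a H mu l r q) (hqR : ∀ y ∈ Ioo l r, |q y| ≤ R) :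
    ∀ y ∈ Ioo l r, q y ≤ p y := by
  intro x hx
  obtain ⟨Q, hQ, hqQ⟩ := h.exists_tendsto_left hI.lt hI.left hI.pos hq hqR
  have hQP : Q < P := hP.lt_of_H_lt h (by linarith)
  obtain ⟨c, hc1, hc2⟩ := ((hqQ.eventually_lt hpP hQP).and (Ioo_mem_nhdsGT hx.1)).exists
  refine le_of_deriv_lt_of_eq (hq.solvesOn hc2.1 hx.2) (hp.solvesOn hc2.1 hx.2) hc1.le
    (fun y hy he => ?_) x ⟨hc2.2.le, le_rfl⟩
  have := hI.pos y ⟨hc2.1.trans_le hy.1, hy.2.trans_lt hx.2⟩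
  rw [he]
  gcongr

/-- A bounded solution above a bounded solution of lower level issues from the larger root. -/
lemma SolvesOnIoo.exists_tendsto_upperRoot (h : Admissible M a H) (hI : IsComponent a l r) {mu : ℝ}
    (hmu : mu < lam) {p q : ℝ → ℝ} (hp : SolvesOnIoo a H lam l r p)
    (hpR : ∀ y ∈ Ioo l r, |p y| ≤ R)
    (hq : SolvesOnIoo a H mu l r q) (hqR : ∀ y ∈ Ioo l r, |q y| ≤ R)
    (hqp : ∀ y ∈ Ioo l r, q y ≤ p y) :
    (∃ P, IsUpperRoot H lam l P ∧ Tendsto p (𝓝[>] l) (𝓝 P)) ∧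
      ∃ P, IsUpperRoot H lam r P ∧ Tendsto p (𝓝[<] r) (𝓝 P) := by
  obtain ⟨P, hP, hpP⟩ := h.exists_tendsto_left hI.lt hI.left hI.pos hp hpR
  obtain ⟨Q, hQ, hqQ⟩ := h.exists_tendsto_left hI.lt hI.left hI.pos hq hqR
  obtain ⟨P', hP', hpP'⟩ := h.exists_tendsto_right hI.lt hI.right hI.pos hp hpR
  obtain ⟨Q', hQ', hqQ'⟩ := h.exists_tendsto_right hI.lt hI.right hI.pos hq hqR
  refine ⟨⟨P, isUpperRoot_of_le hmu hP hQ ?_, hpP⟩, ⟨P', isUpperRoot_of_le hmu hP' hQ' ?_, hpP'⟩⟩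
  · exact le_of_tendsto_of_tendsto hqQ hpP
      (by filter_upwards [Ioo_mem_nhdsGT hI.lt] with y hy using hqp y hy)
  · exact le_of_tendsto_of_tendsto hqQ' hpP'
      (by filter_upwards [Ioo_mem_nhdsLT hI.lt] with y hy using hqp y hy)

lemma exists_seq_tendsto_endpoints (hlr : l < r) :
    ∃ c d : ℕ → ℝ, (∀ n, l < c n ∧ c n ≤ d n ∧ d n < r) ∧ Tendsto c atTop (𝓝 l) ∧
      Tendsto d atTop (𝓝 r) := by
  have h0 : Tendsto (fun n : ℕ => (r - l) / 2 * (1 / ((n : ℝ) + 1))) atTop (𝓝 0) := by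
    simpa using tendsto_one_div_add_atTop_nhds_zero_nat.const_mul ((r - l) / 2)
  refine ⟨fun n => l + (r - l) / 2 * (1 / ((n : ℝ) + 1)),
    fun n => r - (r - l) / 2 * (1 / ((n : ℝ) + 1)), fun n => ?_, ?_, ?_⟩
  · have h1 : 0 < 1 / ((n : ℝ) + 1) := by positivity
    have h2 : 1 / ((n : ℝ) + 1) ≤ 1 := by
      rw [div_le_one (by positivity)]; linarith [n.cast_nonneg (α := ℝ)]
    refine ⟨?_, ?_, ?_⟩ <;> nlinarith
  · simpa using h0.const_add l
  · simpa using h0.const_sub r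

/-- Strict lower barriers on compact subintervals give a solution on a whole component which takes
the larger root at both ends. -/
lemma Admissible.exists_component_solution (h : Admissible M a H) (hI : IsComponent a l r) {mu : ℝ}
    (hmu : mu < lam) (hR : M lam ≤ R)
    (hbar : ∀ c d, l < c → c ≤ d → d < r → ∃ g g' : ℝ → ℝ,
      (∀ y ∈ Icc c d, HasDerivWithinAt g (g' y) (Icc c d) y) ∧ (∀ y ∈ Icc c d, |g y| ≤ R) ∧
      ∀ y ∈ Icc c d, a y * g' y + H y (g y) ≤ mu) :
    ∃ p, SolvesOnIoo a H lam l r p ∧ (∀ y ∈ Ioo l r, |p y| ≤ R) ∧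
      (∃ P, IsUpperRoot H lam l P ∧ Tendsto p (𝓝[>] l) (𝓝 P)) ∧
      ∃ P, IsUpperRoot H lam r P ∧ Tendsto p (𝓝[<] r) (𝓝 P) := by
  obtain ⟨c, d, hcd, hc, hd⟩ := exists_seq_tendsto_endpoints hI.lt
  have hsub : ∀ n, Icc (c n) (d n) ⊆ Ioo l r := fun n y hy =>
    ⟨(hcd n).1.trans_le hy.1, hy.2.trans_lt (hcd n).2.2⟩
  -- The given barriers depend on the compact interval and need not converge. They are first
  -- replaced by one solution q on the whole component at the intermediate level nu; solutions at
  -- level lam are then kept above q, and this inequality survives the limit and selects the larger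
  -- root at both ends.
  set nu := (mu + lam) / 2 with hnu
  have step1 : ∀ n, ∃ p, SolvesOn a H nu (c n) (d n) p ∧ ∀ y ∈ Icc (c n) (d n), |p y| ≤ R := by
    intro n
    obtain ⟨g, g', hg, hgR, hgH⟩ := hbar (c n) (d n) (hcd n).1 (hcd n).2.1 (hcd n).2.2
    obtain ⟨p, -, hp, hp'⟩ := h.exists_solvesOn_of_barrier (hcd n).2.1
      (fun y hy => hI.pos y (hsub n hy)) (lam := nu)
      ((h.mono_M (by linarith : nu ≤ lam)).trans hR) (by linarith) hg hgR hgH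
    exact ⟨p, hp, fun y hy => (hp' y hy).1⟩
  choose f hf hfR using step1
  obtain ⟨q, hq, -⟩ := h.exists_limit_solution hI.pos hc hd tendsto_const_nhds hf hfR
  have hq1 : SolvesOnIoo a H nu l r q := fun y hy => (hq y hy).1
  have step2 : ∀ n, ∃ p, SolvesOn a H lam (c n) (d n) p ∧
      ∀ y ∈ Icc (c n) (d n), |p y| ≤ R ∧ q y ≤ p y := by
    intro n
    obtain ⟨p, -, hp, hp'⟩ := h.exists_solvesOn_of_barrier (hcd n).2.1
      (fun y hy => hI.pos y (hsub n hy)) hR (by linarith : nu < lam)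
      (hq1.solvesOn (hcd n).1 (hcd n).2.2) (fun y hy => (hq y (hsub n hy)).2) (fun y hy => by
        rw [mul_div_cancel₀ _ (hI.pos y (hsub n hy)).ne']; linarith)
    exact ⟨p, hp, hp'⟩
  choose f₂ hf₂ hf₂R using step2
  obtain ⟨p, hp, hpk⟩ := h.exists_limit_solution hI.pos hc hd tendsto_const_nhds hf₂
    fun n y hy => (hf₂R n y hy).1
  have hp1 : SolvesOnIoo a H lam l r p := fun y hy => (hp y hy).1
  refine ⟨p, hp1, fun y hy => (hp y hy).2, ?_⟩
  refine hp1.exists_tendsto_upperRoot h hI (by linarith : nu < lam) (fun y hy => (hp y hy).2) hq1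
    (fun y hy => (hq y hy).2) fun y hy => hpk y hy _ ?_
  filter_upwards [hc.eventually (Iic_mem_nhds hy.1), hd.eventually (Ici_mem_nhds hy.2)]
    with n h1 h2 using (hf₂R n y ⟨h1, h2⟩).2

end Endpoints

/-! ### The upper profile: gluing, continuity, uniqueness -/

/-- The slope of the solution which takes the larger root wherever the diffusion vanishes. -/
structure IsUpperProfile (a : ℝ → ℝ) (H : ℝ → ℝ → ℝ) (lam : ℝ) (p : ℝ → ℝ) : Prop where
  cont : Continuous p
  bdd : ∃ R, ∀ x, |p x| ≤ R
  ode : ∀ x, 0 < a x → HasDerivAt p ((lam - H x (p x)) / a x) x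
  root : ∀ x, a x = 0 → IsUpperRoot H lam x (p x)

/-- Every point of `{a > 0}` lies between two zeros of `a`. -/
def HasZerosOnBothSides (a : ℝ → ℝ) : Prop :=
  ∀ x, 0 < a x → (∃ l < x, a l = 0) ∧ ∃ r > x, a r = 0

/-- Subsolutions of the slope equation at level `mu`, bounded by `R`, on all compact intervals on
which the diffusion does not vanish. -/
structure HasBarriers (a : ℝ → ℝ) (H : ℝ → ℝ → ℝ) (mu R : ℝ) : Prop where
  zero : ∀ z, a z = 0 → ∃ q, H z q ≤ mu
  barrier : ∀ c d, c ≤ d → (∀ y ∈ Icc c d, 0 < a y) → ∃ g g' : ℝ → ℝ,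
    (∀ y ∈ Icc c d, HasDerivWithinAt g (g' y) (Icc c d) y) ∧ (∀ y ∈ Icc c d, |g y| ≤ R) ∧
    ∀ y ∈ Icc c d, a y * g' y + H y (g y) ≤ mu

section Components

variable {M : ℝ → ℝ} {a : ℝ → ℝ} {H : ℝ → ℝ → ℝ} {lam l r R : ℝ}

/-- If a had no zero on one side of x, the whole half-line would lie in the component of x. The
order-theoretic form is the convenient one for shifts and reflections. -/
lemma hasBoundedComponents_iff (ha : ∀ x, 0 ≤ a x) :
    HasBoundedComponents a ↔ (∃ x, a x ≠ 0) ∧ HasZerosOnBothSides a := by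
  refine and_congr_right fun _ => forall₂_congr fun x hx => ⟨fun hb => ?_, ?_⟩
  · have hpos : ∀ y, a y ≠ 0 → 0 < a y := fun y hy => lt_of_le_of_ne (ha y) hy.symm
    constructor
    · by_contra! hcon
      have hsub : Iic x ⊆ connectedComponentIn {y | 0 < a y} x :=
        isPreconnected_Iic.subset_connectedComponentIn self_mem_Iic fun y hy => by
          rcases eq_or_lt_of_le (mem_Iic.1 hy) with rfl | h
          · exact hx
          · exact hpos y (hcon y h)
      exact (not_bddBelow_Iic x) (hb.subset hsub).bddBelow
    · by_contra! hcon
      have hsub : Ici x ⊆ connectedComponentIn {y | 0 < a y} x :=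
        isPreconnected_Ici.subset_connectedComponentIn self_mem_Ici fun y hy => by
          rcases eq_or_lt_of_le (mem_Ici.1 hy) with rfl | h
          · exact hx
          · exact hpos y (hcon y h)
      exact (not_bddAbove_Ici x) (hb.subset hsub).bddAbove
  · rintro ⟨⟨l, hl, hl0⟩, r, hr, hr0⟩
    have hC := isPreconnected_connectedComponentIn (F := {y | 0 < a y}) (x := x)
    have hCs := connectedComponentIn_subset {y | 0 < a y} x
    have hxC : x ∈ connectedComponentIn {y | 0 < a y} x := mem_connectedComponentIn hx
    refine (Metric.isBounded_Icc l r).subset fun y hy => ⟨?_, ?_⟩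
    · by_contra! hlt
      have h1 : 0 < a l := hCs (hC.ordConnected.out hy hxC ⟨hlt.le, hl.le⟩)
      linarith
    · by_contra! hlt
      have h1 : 0 < a r := hCs (hC.ordConnected.out hxC hy ⟨le_of_lt hr, hlt.le⟩)
      linarith

lemma HasZerosOnBothSides.exists_isComponent (hz : HasZerosOnBothSides a)
    (h : Admissible M a H) {x : ℝ} (hx : 0 < a x) : ∃ l r, IsComponent a l r ∧ x ∈ Ioo l r := by
  obtain ⟨⟨l₀, hl₀, hl₀'⟩, r₀, hr₀, hr₀'⟩ := hz x hx
  have hcl : IsClosed (a ⁻¹' {0}) := isClosed_singleton.preimage h.continuous_a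
  obtain ⟨l, ⟨hl1, hl2⟩, hl3⟩ := ((isCompact_Icc (a := l₀) (b := x)).inter_right hcl).exists_isGreatest
    ⟨l₀, ⟨le_rfl, hl₀.le⟩, hl₀'⟩
  obtain ⟨r, ⟨hr1, hr2⟩, hr3⟩ := ((isCompact_Icc (a := x) (b := r₀)).inter_right hcl).exists_isLeast
    ⟨r₀, ⟨le_of_lt hr₀, le_rfl⟩, hr₀'⟩
  simp only [mem_preimage, mem_singleton_iff] at hl2 hr2
  have hlx : l < x := lt_of_le_of_ne hl1.2 (by rintro rfl; linarith)
  have hxr : x < r := lt_of_le_of_ne hr1.1 (by rintro rfl; linarith)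
  refine ⟨l, r, ⟨hlx.trans hxr, hl2, hr2, fun y hy => h.a_pos fun hy0 => ?_⟩, hlx, hxr⟩
  rcases le_total y x with hyx | hyx
  · exact absurd (hl3 ⟨⟨hl1.1.trans hy.1.le, hyx⟩, hy0⟩) (not_le.2 hy.1)
  · exact absurd (hr3 ⟨⟨hyx, hy.2.le.trans hr1.2⟩, hy0⟩) (not_le.2 hy.2)

lemma IsComponent.unique {l' r' x : ℝ} (h : IsComponent a l r) (h' : IsComponent a l' r')
    (hx : x ∈ Ioo l r) (hx' : x ∈ Ioo l' r') : l = l' ∧ r = r' := by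
  have key : ∀ {l r l' r'}, IsComponent a l r → IsComponent a l' r' → x ∈ Ioo l r →
      x ∈ Ioo l' r' → l ≤ l' ∧ r' ≤ r := fun {l r l' r'} h h' hx hx' => by
    constructor
    · by_contra! hlt
      linarith [h'.pos l ⟨hlt, hx.1.trans hx'.2⟩, h.left]
    · by_contra! hlt
      linarith [h'.pos r ⟨hx'.1.trans hx.2, hlt⟩, h.right]
  obtain ⟨h1, h2⟩ := key h h' hx hx'
  obtain ⟨h3, h4⟩ := key h' h hx' hx
  exact ⟨le_antisymm h1 h3, le_antisymm h4 h2⟩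

/-- A function which solves the slope equation on components, takes the larger root at zeros of the
diffusion and is continuous up to the end points of components is continuous. -/
lemma Admissible.continuous_of_components (h : Admissible M a H) (hz : HasZerosOnBothSides a)
    {p : ℝ → ℝ} (hroot : ∀ x, a x = 0 → IsUpperRoot H lam x (p x))
    (hsol : ∀ l r, IsComponent a l r → SolvesOnIoo a H lam l r p)
    (hleft : ∀ l r, IsComponent a l r → Tendsto p (𝓝[>] l) (𝓝 (p l)))
    (hright : ∀ l r, IsComponent a l r → Tendsto p (𝓝[<] r) (𝓝 (p r))) : Continuous p := by
  refine continuous_iff_continuousAt.2 fun x₀ => ?_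
  by_cases hx₀ : a x₀ = 0
  swap
  · obtain ⟨l, r, hI, hx⟩ := hz.exists_isComponent h (h.a_pos hx₀)
    exact (hsol l r hI x₀ hx).continuousAt
  have hP := hroot x₀ hx₀
  refine Metric.tendsto_nhds.2 fun ε hε => ?_
  obtain ⟨q₀, hq₀, hq⟩ := hP.H_lt h
  -- Near x₀ the constants satisfy H(y, k₁) < lam < H(y, k₂). They therefore enclose the larger root
  -- at every zero of a and are barriers for the ODE run to the right. The maximum with q₀ keeps k₁
  -- where H x₀ is below lam.
  set k₁ := max q₀ (p x₀ - ε / 2) with hk₁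
  set k₂ := p x₀ + ε / 2 with hk₂
  have hk₁P : k₁ < p x₀ := max_lt hq₀ (by linarith)
  have hk₁ε : p x₀ - ε < k₁ := by linarith [le_max_right q₀ (p x₀ - ε / 2)]
  obtain ⟨δ, hδ, hδ'⟩ := Metric.eventually_nhds_iff.1
    ((h.eventually_H_lt (hq k₁ (le_max_left _ _) hk₁P)).and
      (h.eventually_lt_H (hP.lt_H h (show p x₀ < k₂ by linarith))))
  have hsand : ∀ z, a z = 0 → dist z x₀ < δ → k₁ < p z ∧ p z < k₂ := fun z hz0 hzd =>
    ⟨(hroot z hz0).lt_of_H_lt h (hδ' hzd).1,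
      (hroot z hz0).lt_of_lt_H h (by linarith) (hδ' hzd).1 (hδ' hzd).2⟩
  have claim : ∀ z x, a z = 0 → x₀ - δ < z → z ≤ x → x < x₀ + δ → k₁ ≤ p x ∧ p x ≤ k₂ := by
    intro z x hz0 hzδ hzx hxδ
    by_cases hx0 : a x = 0
    · have := hsand x hx0 (by rw [Real.dist_eq, abs_lt]; constructor <;> linarith)
      exact ⟨this.1.le, this.2.le⟩
    obtain ⟨l, r, hI, hx⟩ := hz.exists_isComponent h (h.a_pos hx0)
    have hzl : z ≤ l := by
      by_contra! hlt
      linarith [hI.pos z ⟨hlt, hzx.trans_lt hx.2⟩]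
    have hl := hsand l hI.left (by
      rw [Real.dist_eq, abs_lt]; constructor <;> linarith [hx.1])
    obtain ⟨c, hc1, hc2⟩ := (((hleft l r hI).eventually (Ioo_mem_nhds hl.1 hl.2)).and
      (Ioo_mem_nhdsGT hx.1)).exists
    have hs := (hsol l r hI).solvesOn hc2.1 hx.2
    have hd : ∀ y ∈ Icc c x, dist y x₀ < δ := fun y hy => by
      rw [Real.dist_eq, abs_lt]; constructor <;> linarith [hy.1, hy.2, hc2.1]
    have hpos : ∀ y ∈ Icc c x, 0 < a y := fun y hy =>
      hI.pos y ⟨hc2.1.trans_le hy.1, hy.2.trans_lt hx.2⟩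
    constructor
    · refine le_of_deriv_lt_of_eq (f := fun _ => k₁) (f' := fun _ => 0)
        (fun y _ => hasDerivWithinAt_const _ _ _) hs hc1.1.le (fun y hy he => ?_) x
        ⟨hc2.2.le, le_rfl⟩
      rw [← he]
      exact div_pos (by linarith [(hδ' (hd y hy)).1]) (hpos y hy)
    · refine le_of_deriv_lt_of_eq (g := fun _ => k₂) (g' := fun _ => 0) hs
        (fun y _ => hasDerivWithinAt_const _ _ _) hc1.2.le (fun y hy he => ?_) x
        ⟨hc2.2.le, le_rfl⟩
      rw [he]
      exact div_neg_of_neg_of_pos (by linarith [(hδ' (hd y hy)).2]) (hpos y hy)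
  have hconv : ∀ x, k₁ ≤ p x ∧ p x ≤ k₂ → dist (p x) (p x₀) < ε := fun x hx => by
    rw [Real.dist_eq, abs_lt]; constructor <;> linarith [hx.1, hx.2]
  rw [← nhdsLT_sup_nhdsGE, eventually_sup]
  constructor
  -- On the left of x₀, either a zero in (x₀ - δ, x₀) starts the enclosure, or x₀ is the right end
  -- of a component, where the one-sided limit is assumed.
  · by_cases hex : ∃ z, a z = 0 ∧ x₀ - δ < z ∧ z < x₀
    · obtain ⟨z, hz0, hzδ, hzx⟩ := hex
      filter_upwards [Ioo_mem_nhdsLT hzx] with x hx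
      exact hconv x (claim z x hz0 hzδ hx.1.le (by linarith [hx.2]))
    · push Not at hex
      have hpos : 0 < a (x₀ - δ / 2) := h.a_pos fun h0 => by
        linarith [hex _ h0 (by linarith)]
      obtain ⟨l, r, hI, hx⟩ := hz.exists_isComponent h hpos
      have hr : r = x₀ := by
        refine le_antisymm ?_ (hex r hI.right (by linarith [hx.2]))
        by_contra! hlt
        linarith [hI.pos x₀ ⟨by linarith [hx.1], hlt⟩]
      subst hr
      exact Metric.tendsto_nhds.1 (hright l r hI) ε hε
  · filter_upwards [Ico_mem_nhdsGE (show x₀ < x₀ + δ by linarith)] with x hx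
    exact hconv x (claim x₀ x hx₀ (by linarith) hx.1 hx.2)

/-- Existence of the upper profile. -/
theorem Admissible.exists_isUpperProfile (h : Admissible M a H) (hz : HasZerosOnBothSides a)
    {mu : ℝ} (hmu : mu < lam) (hR : M lam ≤ R) (hbar : HasBarriers a H mu R) :
    ∃ p, IsUpperProfile a H lam p ∧ ∀ x, |p x| ≤ R := by
  have hroot : ∀ z, ∃ P, a z = 0 → IsUpperRoot H lam z P := fun z => by
    by_cases hz0 : a z = 0
    · obtain ⟨q, hq⟩ := hbar.zero z hz0
      obtain ⟨P, hP⟩ := h.exists_isUpperRoot (hq.trans_lt hmu)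
      exact ⟨P, fun _ => hP⟩
    · exact ⟨0, fun h => absurd h hz0⟩
  choose top htop using hroot
  have hcomp : ∀ l r, ∃ p : ℝ → ℝ, IsComponent a l r → (SolvesOnIoo a H lam l r p ∧
      (∀ y ∈ Ioo l r, |p y| ≤ R) ∧ Tendsto p (𝓝[>] l) (𝓝 (top l)) ∧
      Tendsto p (𝓝[<] r) (𝓝 (top r))) := fun l r => by
    by_cases hI : IsComponent a l r
    · obtain ⟨p, hp, hpR, ⟨P, hP, hpP⟩, P', hP', hpP'⟩ :=
        h.exists_component_solution hI hmu hR fun c d hc hcd hd =>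
          hbar.barrier c d hcd fun y hy => hI.pos y ⟨hc.trans_le hy.1, hy.2.trans_lt hd⟩
      rw [hP.unique h (htop l hI.left)] at hpP
      rw [hP'.unique h (htop r hI.right)] at hpP'
      exact ⟨p, fun _ => ⟨hp, hpR, hpP, hpP'⟩⟩
    · exact ⟨0, fun h => absurd h hI⟩
  choose f hf using hcomp
  have hend : ∀ x, ∃ l r, 0 < a x → IsComponent a l r ∧ x ∈ Ioo l r := fun x => by
    by_cases hx : 0 < a x
    · obtain ⟨l, r, hI⟩ := hz.exists_isComponent h hx
      exact ⟨l, r, fun _ => hI⟩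
    · exact ⟨0, 0, fun h => absurd h hx⟩
  choose lft rgt hlr using hend
  classical
  set p : ℝ → ℝ := fun x => if a x = 0 then top x else f (lft x) (rgt x) x with hp
  have hp0 : ∀ x, a x = 0 → p x = top x := fun x hx => by simp [hp, hx]
  have hpI : ∀ l r, IsComponent a l r → ∀ x ∈ Ioo l r, p x = f l r x := fun l r hI x hx => by
    have hx0 := hI.pos x hx
    obtain ⟨h1, h2⟩ := (hlr x hx0).1.unique hI (hlr x hx0).2 hx
    simp only [hp, hx0.ne', if_false, h1, h2]
  have hsol : ∀ l r, IsComponent a l r → SolvesOnIoo a H lam l r p := fun l r hI x hx => by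
    have e : p =ᶠ[𝓝 x] f l r := by
      filter_upwards [Ioo_mem_nhds hx.1 hx.2] with y hy using hpI l r hI y hy
    rw [e.eq_of_nhds]
    exact ((hf l r hI).1 x hx).congr_of_eventuallyEq e
  have hroot : ∀ x, a x = 0 → IsUpperRoot H lam x (p x) := fun x hx => by
    rw [hp0 x hx]; exact htop x hx
  have hpR : ∀ x, |p x| ≤ R := fun x => by
    by_cases hx : a x = 0
    · exact (h.abs_lt_of_H_le (hroot x hx).1.le).le.trans hR
    · obtain ⟨l, r, hI, hxI⟩ := hz.exists_isComponent h (h.a_pos hx)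
      rw [hpI l r hI x hxI]
      exact (hf l r hI).2.1 x hxI
  refine ⟨p, ⟨?_, ⟨R, hpR⟩, fun x hx => ?_, hroot⟩, hpR⟩
  · refine h.continuous_of_components hz hroot hsol (fun l r hI => ?_) (fun l r hI => ?_)
    · rw [hp0 l hI.left]
      refine (hf l r hI).2.2.1.congr' ?_
      filter_upwards [Ioo_mem_nhdsGT hI.lt] with y hy using (hpI l r hI y hy).symm
    · rw [hp0 r hI.right]
      refine (hf l r hI).2.2.2.congr' ?_
      filter_upwards [Ioo_mem_nhdsLT hI.lt] with y hy using (hpI l r hI y hy).symm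
  · obtain ⟨l, r, hI, hxI⟩ := hz.exists_isComponent h hx
    exact hsol l r hI x hxI

lemma IsUpperProfile.solvesOnIoo {p : ℝ → ℝ} (hp : IsUpperProfile a H lam p)
    (hI : IsComponent a l r) : SolvesOnIoo a H lam l r p := fun y hy => hp.ode y (hI.pos y hy)

lemma IsUpperProfile.unique (h : Admissible M a H) (hz : HasZerosOnBothSides a) {p q : ℝ → ℝ}
    (hp : IsUpperProfile a H lam p) (hq : IsUpperProfile a H lam q) : p = q := by
  ext x
  by_cases hx : a x = 0
  · exact (hp.root x hx).unique h (hq.root x hx)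
  · obtain ⟨l, r, hI, hxI⟩ := hz.exists_isComponent h (h.a_pos hx)
    obtain ⟨R₁, hR₁⟩ := hp.bdd
    obtain ⟨R₂, hR₂⟩ := hq.bdd
    refine (hp.solvesOnIoo hI).eq_of_tendsto h hI.lt hI.pos (hp.root l hI.left) (hq.solvesOnIoo hI)
      ((hp.cont.tendsto l).mono_left nhdsWithin_le_nhds) ?_ (R := max R₁ R₂)
      (fun y _ => (hR₁ y).trans (le_max_left _ _)) (fun y _ => (hR₂ y).trans (le_max_right _ _)) x hxI
    rw [(hp.root l hI.left).unique h (hq.root l hI.left)]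
    exact (hq.cont.tendsto l).mono_left nhdsWithin_le_nhds

/-- Near x the function u lies below a parabola with the same slope and curvature s' + ε, so a
parabola touching from below cannot bend more. -/
lemma TouchesBelow.curvature_le {u P : ℝ → ℝ} {x q s s' : ℝ} (hT : TouchesBelow u x q s)
    (hu : ∀ᶠ y in 𝓝 x, HasDerivAt u (P y) y) (hP : HasDerivAt P s' x) : s ≤ s' := by
  refine le_of_forall_pos_le_add fun ε hε => ?_
  have h1 : TouchesBelow (fun y => - u y) x (- P x) (-s' - ε) := by
    have hP' := hP.fun_neg
    exact touchesBelow_of_hasDerivAt (P := fun y => - P y)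
      (hu.mono fun y hy => hy.fun_neg)
      (eventually_le_of_hasDerivWithinAt_Ioi hP'.hasDerivWithinAt (by linarith))
      (eventually_le_of_hasDerivWithinAt_Iio hP'.hasDerivWithinAt (by linarith))
  have hq : q = P x := hT.eq_of_hasDerivAt hu.self_of_nhds
  obtain ⟨δ, hδ, hδ'⟩ := Metric.eventually_nhds_iff.1 (hT.and h1)
  obtain ⟨h2, h3⟩ := hδ' (y := x + δ / 2) (by
    rw [Real.dist_eq, add_sub_cancel_left, abs_of_pos (by linarith)]; linarith)
  rw [hq] at h2
  simp only [add_sub_cancel_left] at h2 h3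
  have h4 : 0 < (δ / 2) ^ 2 := by positivity
  nlinarith

/-- Primitives of the upper profile are viscosity solutions. -/
lemma IsUpperProfile.isViscositySolution {p u : ℝ → ℝ} (h : Admissible M a H)
    (hp : IsUpperProfile a H lam p)
    (hu : ∀ x, HasDerivAt u (p x) x) : IsViscositySolution a H lam u := by
  have huc : Continuous u := continuous_iff_continuousAt.2 fun x => (hu x).continuousAt
  constructor
  · rw [isViscositySubsolution_iff_neg, isViscositySupersolution_iff]
    refine ⟨huc.neg, fun x q s hT => ?_⟩
    have hq : q = - p x := hT.eq_of_hasDerivAt (hu x).fun_neg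
    rw [hq, neg_neg]
    by_cases hx : a x = 0
    · rw [hx, (hp.root x hx).1]; linarith
    · have hx' := h.a_pos hx
      have := hT.curvature_le (Eventually.of_forall fun y => (hu y).fun_neg) (hp.ode x hx').fun_neg
      have h2 := mul_le_mul_of_nonneg_left this hx'.le
      rw [mul_neg, mul_div_cancel₀ _ hx] at h2
      linarith
  · rw [isViscositySupersolution_iff]
    refine ⟨huc, fun x q s hT => ?_⟩
    have hq : q = p x := hT.eq_of_hasDerivAt (hu x)
    rw [hq]
    by_cases hx : a x = 0
    · rw [hx, (hp.root x hx).1]; linarith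
    · have hx' := h.a_pos hx
      have := hT.curvature_le (Eventually.of_forall hu) (hp.ode x hx')
      have h2 := mul_le_mul_of_nonneg_left this hx'.le
      rw [mul_div_cancel₀ _ hx] at h2
      linarith

end Components

/-! ### Deterministic existence and uniqueness, and the critical level -/

section Deterministic

variable {M : ℝ → ℝ} {a : ℝ → ℝ} {H : ℝ → ℝ → ℝ} {lam mu l r R : ℝ}

lemma IsLip.exists_bound {u : ℝ → ℝ} (hu : IsLip u) : ∃ K, ∀ x, |deriv u x| ≤ K := by
  obtain ⟨K, hK⟩ := hu
  exact ⟨K, fun x => by simpa using norm_deriv_le_of_lipschitz hK (x₀ := x)⟩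

lemma IsLip.ae_differentiableAt {u : ℝ → ℝ} (hu : IsLip u) : ∀ᵐ x, DifferentiableAt ℝ u x := by
  obtain ⟨K, hK⟩ := hu
  exact hK.ae_differentiableAt

lemma IsViscositySolution.solvesOnIoo_deriv (h : Admissible M a H) {u : ℝ → ℝ}
    (hu : IsViscositySolution a H lam u) (hL : IsLip u) (hI : IsComponent a l r) :
    SolvesOnIoo a H lam l r (deriv u) := fun y hy => (hu.hasDerivAt_deriv h hL (hI.pos y hy)).2

lemma isLip_of_hasDerivAt {u p : ℝ → ℝ} (hu : ∀ x, HasDerivAt u (p x) x) (hR : ∀ x, |p x| ≤ R) :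
    LipschitzWith R.toNNReal u := by
  have hR0 : 0 ≤ R := (abs_nonneg _).trans (hR 0)
  refine lipschitzWith_of_nnnorm_deriv_le (fun x => (hu x).differentiableAt) fun x => ?_
  rw [(hu x).deriv, ← NNReal.coe_le_coe, coe_nnnorm, Real.coe_toNNReal _ hR0]
  exact hR x

/-- Solutions at lower levels have a smaller slope than the upper profile. -/
lemma IsUpperProfile.ae_deriv_le (h : Admissible M a H) (hz : HasZerosOnBothSides a) {p v : ℝ → ℝ}
    (hp : IsUpperProfile a H lam p) (hmu : mu < lam) (hv : IsViscositySolution a H mu v)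
    (hvL : IsLip v) : ∀ᵐ x, deriv v x ≤ p x := by
  filter_upwards [hvL.ae_differentiableAt] with x hx
  by_cases hx0 : a x = 0
  · exact (hp.root x hx0).le_of_H_le h
      ((hv.H_eq_of_hasDerivAt h hx0 hx.hasDerivAt).le.trans hmu.le)
  · obtain ⟨l, r, hI, hxI⟩ := hz.exists_isComponent h (h.a_pos hx0)
    obtain ⟨K, hK⟩ := hvL.exists_bound
    exact (hp.solvesOnIoo hI).le_of_level_lt h hI hmu (hp.root l hI.left)
      ((hp.cont.tendsto l).mono_left nhdsWithin_le_nhds) (hv.solvesOnIoo_deriv h hvL hI)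
      (fun y _ => hK y) x hxI

/-- A Lipschitz solution whose slope lies above that of a solution of lower level has the upper
profile as its derivative. -/
theorem IsUpperProfile.hasDerivAt_of_ae_le (h : Admissible M a H) (hz : HasZerosOnBothSides a)
    {p u v : ℝ → ℝ} (hp : IsUpperProfile a H lam p) (hmu : mu < lam)
    (hv : IsViscositySolution a H mu v) (hvL : IsLip v) (hu : IsViscositySolution a H lam u)
    (huL : IsLip u) (hle : ∀ᵐ x, deriv v x ≤ deriv u x) : ∀ x, HasDerivAt u (p x) x := by
  obtain ⟨K₁, hK₁⟩ := huL.exists_bound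
  obtain ⟨K₂, hK₂⟩ := hvL.exists_bound
  obtain ⟨R₀, hR₀⟩ := hp.bdd
  set R := max R₀ (max K₁ K₂) with hR
  have hcomp : ∀ l r, IsComponent a l r → ∀ x ∈ Ioo l r, deriv u x = p x := by
    intro l r hI
    have su := hu.solvesOnIoo_deriv h huL hI
    have sv := hv.solvesOnIoo_deriv h hvL hI
    have hle' : ∀ x ∈ Ioo l r, deriv v x ≤ deriv u x := by
      have hcu : ContinuousOn (deriv u) (Ioo l r) := fun x hx =>
        (su x hx).continuousAt.continuousWithinAt
      have hcv : ContinuousOn (deriv v) (Ioo l r) := fun x hx =>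
        (sv x hx).continuousAt.continuousWithinAt
      -- Written as an equality of continuous functions, the inequality of slopes passes from almost
      -- every point to every point of the component.
      have e : (fun x => min (deriv v x) (deriv u x)) =ᵐ[volume.restrict (Ioo l r)] deriv v := by
        filter_upwards [ae_restrict_of_ae hle] with x hx using min_eq_left hx
      have := Measure.eqOn_open_of_ae_eq e isOpen_Ioo (ContinuousOn.inf hcv hcu) hcv
      intro x hx
      exact min_eq_left_iff.1 (this hx)
    obtain ⟨P, hP, huP⟩ := (su.exists_tendsto_upperRoot h hI hmu (R := R)
      (fun y _ => (hK₁ y).trans ((le_max_left _ _).trans (le_max_right _ _))) sv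
      (fun y _ => (hK₂ y).trans ((le_max_right _ _).trans (le_max_right _ _))) hle').1
    have hroot := hp.root l hI.left
    refine su.eq_of_tendsto h hI.lt hI.pos hP (hp.solvesOnIoo hI) huP ?_ (R := R)
      (fun y _ => (hK₁ y).trans ((le_max_left _ _).trans (le_max_right _ _)))
      (fun y _ => (hR₀ y).trans (le_max_left _ _))
    rw [hP.unique h hroot]
    exact (hp.cont.tendsto l).mono_left nhdsWithin_le_nhds
  have hae : ∀ᵐ x, HasDerivAt u (p x) x := by
    filter_upwards [huL.ae_differentiableAt, hvL.ae_differentiableAt, hle] with x h1 h2 h3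
    suffices deriv u x = p x by rw [← this]; exact h1.hasDerivAt
    by_cases hx0 : a x = 0
    · exact (isUpperRoot_of_le hmu (hu.H_eq_of_hasDerivAt h hx0 h1.hasDerivAt)
        (hv.H_eq_of_hasDerivAt h hx0 h2.hasDerivAt) h3).unique h (hp.root x hx0)
    · obtain ⟨l, r, hI, hxI⟩ := hz.exists_isComponent h (h.a_pos hx0)
      exact hcomp l r hI x hxI
  set W : ℝ → ℝ := fun x => ∫ t in (0 : ℝ)..x, p t with hW
  have hWd : ∀ x, HasDerivAt W (p x) x := fun x =>
    (hp.cont.integral_hasStrictDerivAt 0 x).hasDerivAt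
  have hWL := isLip_of_hasDerivAt hWd hR₀
  obtain ⟨K, hK⟩ := huL
  -- Both functions are Lipschitz, hence absolutely continuous, so equality of derivatives almost
  -- everywhere suffices. This also settles the points of {a = 0} where u was not known to be
  -- differentiable.
  have hconst : ∀ x, u x - W x = u 0 - W 0 := by
    intro x
    obtain ⟨C, hC⟩ := AbsolutelyContinuousOnInterval.const_of_ae_hasDerivAt_zero
      (f := fun x => u x - W x) (a := 0) (b := x)
      ((hK.sub hWL).lipschitzOnWith.absolutelyContinuousOnInterval) (by
        filter_upwards [hae] with y hy _
        simpa using hy.fun_sub (hWd y))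
    rw [hC x right_mem_uIcc, hC 0 left_mem_uIcc]
  intro x
  have e : u = fun x => W x + (u 0 - W 0) := funext fun x => by linarith [hconst x]
  rw [e]
  exact (hWd x).add_const _

/-- A solution of the slope equation at level lam is itself a barrier at level lam; the room above
mu provides it, and also provides the first-order inequality at zeros. -/
lemma IsViscositySupersolution.hasBarriers (h : Admissible M a H) {w : ℝ → ℝ}
    (hw : IsViscositySupersolution a H mu w) (hmu : mu < lam) (hR : M lam < R) :
    HasBarriers a H lam R where
  zero z hz := by
    obtain ⟨q, hq⟩ := hw.exists_H_lt_of_a_eq_zero h hz hmu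
    exact ⟨q, hq.le⟩
  barrier c d hcd ha := by
    obtain ⟨p, hp, hpR⟩ := hw.exists_solvesOn h hmu hR hcd ha
    refine ⟨p, _, hp, hpR, fun y hy => ?_⟩
    rw [mul_div_cancel₀ _ (ha y hy).ne']
    linarith

/-- Constants work, because H is bounded at zero slope. -/
lemma Admissible.exists_supersolution (h : Admissible M a H) :
    ∃ lam, ∃ w, IsViscositySupersolution a H lam w := by
  obtain ⟨B, -, hB⟩ := h.H_bdd 0
  refine ⟨B, fun _ => 0, isViscositySupersolution_iff.2 ⟨continuous_const, fun x p s hT => ?_⟩⟩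
  have hp : p = 0 := hT.eq_of_hasDerivAt (hasDerivAt_const x 0)
  have hs : s ≤ 0 := hT.curvature_le (P := fun _ => 0)
    (Eventually.of_forall fun y => hasDerivAt_const y 0) (hasDerivAt_const x 0)
  subst hp
  nlinarith [h.a_nonneg x, (abs_le.1 (hB x 0 (by simp))).2]

/-- At a zero of a, every level of a supersolution is bounded below by the values of H, so the
critical value is a genuine infimum. -/
lemma Admissible.bddBelow_supersolution (h : Admissible M a H) {z : ℝ} (hz : a z = 0) :
    BddBelow {lam : ℝ | ∃ u : ℝ → ℝ, IsViscositySupersolution a H lam u} := by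
  obtain ⟨B, hB, hB'⟩ := h.H_bdd (M 0)
  refine ⟨-B, ?_⟩
  rintro lam ⟨w, hw⟩
  by_contra! hlt
  obtain ⟨p, hp⟩ := hw.exists_H_lt_of_a_eq_zero h hz hlt
  have h1 := h.abs_lt_of_H_le (t := 0) (x := z) (p := p) (by linarith)
  linarith [(abs_le.1 (hB' z p h1.le)).1]

lemma Admissible.exists_supersolution_of_criticalValue_lt (h : Admissible M a H)
    (hlam : criticalValue a H < lam) : ∃ mu < lam, ∃ w, IsViscositySupersolution a H mu w := by
  obtain ⟨mu, hmu, hmu'⟩ := exists_lt_of_csInf_lt h.exists_supersolution hlam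
  exact ⟨mu, hmu', hmu⟩

lemma Admissible.exists_isUpperProfile_of_criticalValue_lt (h : Admissible M a H)
    (hz : HasZerosOnBothSides a) (hlam : criticalValue a H < lam) :
    ∃ p, IsUpperProfile a H lam p ∧ ∀ x, |p x| ≤ M lam + 1 := by
  obtain ⟨mu, hmu, w, hw⟩ := h.exists_supersolution_of_criticalValue_lt hlam
  set nu := (mu + lam) / 2 with hnu
  refine h.exists_isUpperProfile hz (mu := nu) (by linarith) (by linarith)
    (hw.hasBarriers h (by linarith) ?_)
  have := h.mono_M (by linarith : nu ≤ lam)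
  linarith

lemma IsUpperProfile.exists_solution (h : Admissible M a H) {p : ℝ → ℝ}
    (hp : IsUpperProfile a H lam p) (hR : ∀ x, |p x| ≤ R) : ∃ u : ℝ → ℝ,
      LipschitzWith R.toNNReal u ∧ IsViscositySolution a H lam u ∧ u 0 = 0 ∧
        ∀ x, HasDerivAt u (p x) x := by
  have hd : ∀ x, HasDerivAt (fun x => ∫ t in (0 : ℝ)..x, p t) (p x) x := fun x =>
    (hp.cont.integral_hasStrictDerivAt 0 x).hasDerivAt
  exact ⟨_, isLip_of_hasDerivAt hd hR, hp.isViscositySolution h hd, by simp, hd⟩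

/-- Compactness of normalized equi-Lipschitz solutions. -/
lemma Admissible.exists_limit_viscositySolution (h : Admissible M a H) {K : NNReal}
    {nu : ℕ → ℝ} {u : ℕ → ℝ → ℝ} (hnu : Tendsto nu atTop (𝓝 lam))
    (hu : ∀ n, LipschitzWith K (u n) ∧ IsViscositySolution a H (nu n) (u n) ∧ u n 0 = 0) :
    ∃ v : ℝ → ℝ, LipschitzWith K v ∧ IsViscositySolution a H lam v ∧ v 0 = 0 := by
  set U : Filter ℕ := (hyperfilter ℕ : Filter ℕ) with hU
  have hUle : U ≤ atTop := by rw [← Nat.cofinite_eq_atTop]; exact hyperfilter_le_cofinite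
  have : U.NeBot := (hyperfilter ℕ).neBot
  have hlim : ∀ x : ℝ, ∃ t, Tendsto (fun n => u n x) U (𝓝 t) := by
    intro x
    obtain ⟨t, -, ht'⟩ := (isCompact_closedBall (0 : ℝ) (K * |x|)).ultrafilter_le_nhds
      ((hyperfilter ℕ).map fun n => u n x) (by
        rw [le_principal_iff]
        change ∀ᶠ n in U, u n x ∈ Metric.closedBall 0 (K * |x|)
        refine Eventually.of_forall fun n => ?_
        have := (hu n).1.dist_le_mul x 0
        rwa [(hu n).2.2, Real.dist_eq x, sub_zero] at this)
    exact ⟨t, ht'⟩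
  choose v hv using hlim
  have hvL : LipschitzWith K v := LipschitzWith.of_dist_le_mul fun x y =>
    le_of_tendsto ((hv x).dist (hv y)) (Eventually.of_forall fun n => (hu n).1.dist_le_mul x y)
  refine ⟨v, hvL, ?_, ?_⟩
  · refine .of_approx h.continuous_a h.continuous_H hvL.continuous fun T hT δ hδ => ?_
    set ε := δ / (4 * (K + 1)) with hε
    have hK0 : (0 : ℝ) ≤ K := K.2
    have hε0 : 0 < ε := by positivity
    have hKε : K * ε ≤ δ / 4 := by
      have : (K + 1) * ε = δ / 4 := by rw [hε]; field_simp
      nlinarith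
    -- Convergence on a finite ε-net and the common Lipschitz constant give uniform closeness on
    -- [-T, T].
    obtain ⟨t, -, htf, htc⟩ := (isCompact_Icc (a := -T) (b := T)).finite_cover_balls hε0
    have h1 : ∀ᶠ n in U, ∀ x ∈ t, |u n x - v x| < δ / 2 := by
      rw [eventually_all_finite htf]
      intro x _
      exact Metric.tendsto_nhds.1 (hv x) _ (by positivity)
    have h2 : ∀ᶠ n in U, |nu n - lam| < δ := hUle (Metric.tendsto_nhds.1 hnu δ hδ)
    obtain ⟨n, hn1, hn2⟩ := (h1.and h2).exists
    refine ⟨u n, nu n, hn2.le, (hu n).2.1, fun y hy => ?_⟩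
    obtain ⟨x, hx, hxy⟩ := mem_iUnion₂.1 (htc (abs_le.1 hy))
    rw [Metric.mem_ball] at hxy
    have e1 := (hu n).1.dist_le_mul y x
    have e2 := hvL.dist_le_mul x y
    rw [dist_comm x y] at e2
    have e3 : K * dist y x ≤ K * ε := by gcongr
    calc |u n y - v y| = |(u n y - u n x) + (u n x - v x) + (v x - v y)| := by ring_nf
      _ ≤ |u n y - u n x| + |u n x - v x| + |v x - v y| := abs_add_three _ _ _
      _ ≤ δ := by
        rw [Real.dist_eq (u n y)] at e1
        rw [Real.dist_eq (v x)] at e2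
        linarith [hn1 x hx]
  · refine tendsto_nhds_unique (hv 0) ?_
    simp only [(hu _).2.2]
    exact tendsto_const_nhds

/-- At the critical level there is a Lipschitz solution. -/
theorem Admissible.exists_critical_solution (h : Admissible M a H) (hz : HasZerosOnBothSides a) :
    ∃ v, IsLip v ∧ IsViscositySolution a H (criticalValue a H) v ∧ v 0 = 0 := by
  set lam0 := criticalValue a H with hlam0
  -- The levels stay below lam0 + 1, so monotonicity of M gives one Lipschitz constant for all n.
  have key : ∀ n : ℕ, ∃ u : ℝ → ℝ, LipschitzWith (M (lam0 + 1) + 1).toNNReal u ∧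
      IsViscositySolution a H (lam0 + 1 / ((n : ℝ) + 1)) u ∧ u 0 = 0 := fun n => by
    have h1 : 0 < 1 / ((n : ℝ) + 1) := by positivity
    have h2 : 1 / ((n : ℝ) + 1) ≤ 1 := by
      rw [div_le_one (by positivity)]; linarith [n.cast_nonneg (α := ℝ)]
    obtain ⟨p, hp, hpR⟩ := h.exists_isUpperProfile_of_criticalValue_lt hz
      (lam := lam0 + 1 / ((n : ℝ) + 1)) (by linarith)
    have hM := h.mono_M (by linarith : lam0 + 1 / ((n : ℝ) + 1) ≤ lam0 + 1)
    obtain ⟨u, hu1, hu2, hu3, -⟩ := hp.exists_solution h (R := M (lam0 + 1) + 1)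
      fun x => (hpR x).trans (by linarith)
    exact ⟨u, hu1, hu2, hu3⟩
  choose u hu using key
  have hnu : Tendsto (fun n : ℕ => lam0 + 1 / ((n : ℝ) + 1)) atTop (𝓝 lam0) := by
    simpa using tendsto_one_div_add_atTop_nhds_zero_nat.const_add lam0
  obtain ⟨v, hv1, hv2, hv3⟩ := h.exists_limit_viscositySolution hnu hu
  exact ⟨v, ⟨_, hv1⟩, hv2, hv3⟩

end Deterministic

/-! ### The Hamiltonian class is admissible -/

section ClassToAdmissible

/-- An explicit coercivity function for the Hamiltonians under consideration. -/
noncomputable def coercivityBound (α₀ γ t : ℝ) : ℝ :=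
  1 + (2 / α₀) ^ (1 / (γ - 2)) + max t 0 + 1 / α₀

/-- The power term in the bound ensures α₀|p|^γ ≥ 2p². One copy of p² is kept, and the other
dominates |p|, which exceeds t + 1/α₀. -/
lemma coercivityBound_spec {α₀ γ : ℝ} (hα₀ : 0 < α₀) (hγ : 2 < γ) {t p : ℝ}
    (hp : coercivityBound α₀ γ t ≤ |p|) : t + p ^ 2 < α₀ * |p| ^ γ - 1 / α₀ := by
  have h1 : 0 < (2 / α₀) ^ (1 / (γ - 2)) := by positivity
  have h2 : 0 < 1 / α₀ := by positivity
  have h3 : 0 ≤ max t 0 := le_max_right _ _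
  have h4 : t ≤ max t 0 := le_max_left _ _
  unfold coercivityBound at hp
  have hp1 : 1 ≤ |p| := by linarith
  have hp0 : 0 < |p| := by linarith
  have h5 : 2 / α₀ ≤ |p| ^ (γ - 2) := by
    calc 2 / α₀ = ((2 / α₀) ^ (1 / (γ - 2))) ^ (γ - 2) := by
          rw [← Real.rpow_mul (by positivity), one_div_mul_cancel (by linarith), Real.rpow_one]
      _ ≤ _ := Real.rpow_le_rpow h1.le (by linarith) (by linarith)
  have h6 : |p| ^ γ = |p| ^ (γ - 2) * p ^ 2 := by
    rw [← sq_abs p, ← Real.rpow_natCast, ← Real.rpow_add hp0]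
    norm_num
  have h7 : 2 * p ^ 2 ≤ α₀ * |p| ^ γ := by
    rw [h6, ← mul_assoc]
    refine mul_le_mul_of_nonneg_right ?_ (sq_nonneg p)
    rw [div_le_iff₀ hα₀] at h5
    linarith
  have h8 : |p| ≤ p ^ 2 := by rw [← sq_abs]; nlinarith
  linarith

/-- The Lipschitz bound on √a gives the quadratic vanishing of a at its zeros; γ > 2 lets H dominate
the diffusion term p². -/
lemma SqcHamiltonianClass.admissible {α₀ α₁ γ η κ : ℝ} (hκ : 0 < κ) (hα₀ : 0 < α₀)
    (hα₁ : 0 < α₁) (hγ : 2 < γ) {a : ℝ → ℝ} {H : ℝ → ℝ → ℝ} (ha : ∀ x, 0 ≤ a x ∧ a x ≤ 1)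
    (hA : ∀ x y, |√(a x) - √(a y)| ≤ κ * |x - y|) (hH : SqcHamiltonianClass α₀ α₁ γ η H) :
    Admissible (coercivityBound α₀ γ) a H where
  a_nonneg x := (ha x).1
  a_le_one x := (ha x).2
  a_lip := by
    refine ⟨2 * κ, fun x y => ?_⟩
    have e : a x - a y = (√(a x) - √(a y)) * (√(a x) + √(a y)) := by
      nlinarith [Real.sq_sqrt (ha x).1, Real.sq_sqrt (ha y).1]
    have h1 : √(a x) ≤ 1 := Real.sqrt_le_one.2 (ha x).2
    have h2 : √(a y) ≤ 1 := Real.sqrt_le_one.2 (ha y).2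
    rw [e, abs_mul, abs_of_nonneg (by positivity : 0 ≤ √(a x) + √(a y))]
    calc |√(a x) - √(a y)| * (√(a x) + √(a y)) ≤ (κ * |x - y|) * 2 :=
          mul_le_mul (hA x y) (by linarith) (by positivity) (by positivity)
      _ = _ := by ring
  a_quad := by
    refine ⟨κ ^ 2, by positivity, fun z x hz => ?_⟩
    have h1 := hA x z
    rw [hz, Real.sqrt_zero, sub_zero, abs_of_nonneg (Real.sqrt_nonneg _)] at h1
    calc a x = √(a x) ^ 2 := (Real.sq_sqrt (ha x).1).symm
      _ ≤ (κ * |x - z|) ^ 2 := by gcongr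
      _ = _ := by rw [mul_pow, sq_abs]
  H_lip R := by
    refine ⟨α₁ * (|R| ^ γ + 1) + α₁ * (|R| + |R| + 1) ^ (γ - 1), by positivity,
      fun x y p q hp hq => ?_⟩
    have hp' : |p| ≤ |R| := hp.trans (le_abs_self R)
    have hq' : |q| ≤ |R| := hq.trans (le_abs_self R)
    have h1 : |H x p - H y p| ≤ α₁ * (|R| ^ γ + 1) * |x - y| :=
      (hH.lipschitz_space x y p).trans (by gcongr)
    have h2 : |H y p - H y q| ≤ α₁ * (|R| + |R| + 1) ^ (γ - 1) * |p - q| :=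
      (hH.lipschitz_momentum y p q).trans (by gcongr; linarith)
    have h3 : 0 ≤ α₁ * (|R| ^ γ + 1) * |p - q| := by positivity
    have h4 : 0 ≤ α₁ * (|R| + |R| + 1) ^ (γ - 1) * |x - y| := by positivity
    have h5 := abs_sub_le (H x p) (H y p) (H y q)
    nlinarith
  H_bdd R := by
    refine ⟨α₁ * (|R| ^ γ + 1) + 1 / α₀, by positivity, fun x p hp => ?_⟩
    have hp' : |p| ≤ |R| := hp.trans (le_abs_self R)
    have h1 := hH.growth_lower x p
    have h2 := hH.growth_upper x p
    have h3 : α₁ * (|p| ^ γ + 1) ≤ α₁ * (|R| ^ γ + 1) := by gcongr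
    have h4 : 0 ≤ α₀ * |p| ^ γ := by positivity
    have h5 : 0 < 1 / α₀ := by positivity
    have h6 : 0 ≤ α₁ * (|R| ^ γ + 1) := by positivity
    rw [abs_le]
    constructor <;> linarith
  one_le_M t := by
    have h1 : 0 < (2 / α₀) ^ (1 / (γ - 2)) := by positivity
    have h2 : 0 < 1 / α₀ := by positivity
    have h3 : 0 ≤ max t 0 := le_max_right _ _
    unfold coercivityBound
    linarith
  mono_M s t hst := by
    unfold coercivityBound
    gcongr
  coercive t x p hp := (coercivityBound_spec hα₀ hγ hp).trans_le (hH.growth_lower x p)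
  sqc x p q r hpq hqr := by
    have hrp : 0 < r - p := by linarith
    have := hH.strict_quasiconvex x p r ((q - p) / (r - p)) (by linarith)
      (div_pos (by linarith) hrp) ((div_lt_one hrp).2 (by linarith))
    convert this using 2
    field_simp
    ring

end ClassToAdmissible

/-! ### Countable families of test slopes -/

section TestSlopes

/-- A countable family of continuously differentiable functions which is dense in `C¹([c, d])`. -/
lemma exists_dense_C1_family (c d : ℝ) : ∃ G G' : ℕ × ℚ → ℝ → ℝ,
    (∀ i y, HasDerivAt (G i) (G' i y) y) ∧ (∀ i, Continuous (G' i)) ∧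
    (c ≤ d → ∀ p p' : ℝ → ℝ, (∀ y ∈ Icc c d, HasDerivWithinAt p (p' y) (Icc c d) y) →
      ContinuousOn p' (Icc c d) → ∀ ε > 0, ∃ i, ∀ y ∈ Icc c d,
        |G i y - p y| < ε ∧ |G' i y - p' y| < ε) := by
  by_cases hcd : c ≤ d
  swap
  · exact ⟨fun _ _ => 0, fun _ _ => 0, fun _ y => hasDerivAt_const y 0,
      fun _ => continuous_const, fun h => absurd h hcd⟩
  -- The derivative is taken from a dense sequence in C([c, d]) and the initial value from ℚ;
  -- integration controls the function itself.
  set f : ℕ → C(Icc c d, ℝ) := TopologicalSpace.denseSeq C(Icc c d, ℝ) with hf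
  have hfd : DenseRange f := TopologicalSpace.denseRange_denseSeq _
  have hFc : ∀ n, Continuous (IccExtend hcd (f n)) := fun n => (f n).continuous.Icc_extend'
  have hd : ∀ (i : ℕ × ℚ) y, HasDerivAt
      (fun y => (i.2 : ℝ) + ∫ t in c..y, IccExtend hcd (f i.1) t) (IccExtend hcd (f i.1) y) y :=
    fun i y => ((hFc i.1).integral_hasStrictDerivAt c y).hasDerivAt.const_add _
  refine ⟨fun i y => i.2 + ∫ t in c..y, IccExtend hcd (f i.1) t, fun i => IccExtend hcd (f i.1),
    hd, fun i => hFc i.1, fun _ p p' hp hp' ε hε => ?_⟩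
  set θ := min ε (ε / (2 * (d - c + 1))) with hθ
  have hdc : 0 < d - c + 1 := by linarith
  have hθ0 : 0 < θ := by positivity
  set g : C(Icc c d, ℝ) := ⟨_, continuousOn_iff_continuous_domRestrict.1 hp'⟩ with hg
  obtain ⟨n, hn⟩ := hfd.exists_dist_lt g hθ0
  obtain ⟨s, hs1, hs2⟩ := exists_rat_btwn (show p c < p c + ε / 2 by linarith)
  have hcl : ∀ y ∈ Icc c d, |IccExtend hcd (f n) y - p' y| < θ := fun y hy => by
    rw [IccExtend_of_mem _ _ hy, abs_sub_comm]
    exact (ContinuousMap.dist_apply_le_dist (f := g) (g := f n) ⟨y, hy⟩).trans_lt hn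
  refine ⟨(n, s), fun y hy => ⟨?_, (hcl y hy).trans_le (min_le_left _ _)⟩⟩
  obtain ⟨z, hz, -, hz'⟩ := exists_sub_eq_deriv_mul
    (p := fun y => ((s : ℝ) + ∫ t in c..y, IccExtend hcd (f n) t) - p y)
    (p' := fun y => IccExtend hcd (f n) y - p' y)
    (fun y hy => (hd (n, s) y).hasDerivWithinAt.fun_sub (hp y hy)) ⟨le_rfl, hcd⟩ hy
  simp only [intervalIntegral.integral_same, add_zero] at hz'
  have h1 : |(IccExtend hcd (f n) z - p' z) * (y - c)| ≤ ε / (2 * (d - c + 1)) * (d - c) := by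
    rw [abs_mul, abs_of_nonneg (by linarith [hy.1] : 0 ≤ y - c)]
    exact mul_le_mul ((hcl z hz).le.trans (min_le_right _ _)) (by linarith [hy.2])
      (by linarith [hy.1]) (by positivity)
  have h2 : ε / (2 * (d - c + 1)) * (d - c) < ε / 2 := by
    have e : ε / (2 * (d - c + 1)) * (d - c + 1) = ε / 2 := by field_simp
    have : 0 < ε / (2 * (d - c + 1)) := by positivity
    nlinarith
  have h3 := abs_le.1 h1
  rw [abs_lt]
  constructor <;> simp only <;> linarith [h3.1, h3.2]

lemma SolvesOn.exists_test_slope {M : ℝ → ℝ} {a : ℝ → ℝ} {H : ℝ → ℝ → ℝ} {nu c d R : ℝ}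
    (h : Admissible M a H) {p : ℝ → ℝ} (hp : SolvesOn a H nu c d p)
    (ha : ∀ y ∈ Icc c d, 0 < a y) (hR : ∀ y ∈ Icc c d, |p y| ≤ R) {ι : Type*} {G G' : ι → ℝ → ℝ}
    (hG : ∀ p p' : ℝ → ℝ, (∀ y ∈ Icc c d, HasDerivWithinAt p (p' y) (Icc c d) y) →
      ContinuousOn p' (Icc c d) → ∀ ε > 0, ∃ i, ∀ y ∈ Icc c d,
        |G i y - p y| < ε ∧ |G' i y - p' y| < ε) {ε : ℝ} (hε : 0 < ε) :
    ∃ i, ∀ y ∈ Icc c d, |G i y - p y| < ε ∧ |a y * G' i y + H y (G i y) - nu| < ε := by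
  obtain ⟨L, hL, hL'⟩ := h.H_lip (R + 1)
  have hc : ContinuousOn (fun y => (nu - H y (p y)) / a y) (Icc c d) := by
    refine ContinuousOn.div (continuousOn_const.sub ?_) h.continuous_a.continuousOn
      fun y hy => (ha y hy).ne'
    exact h.continuous_H.comp_continuousOn (f := fun y => (y, p y))
      (continuousOn_id.prodMk hp.continuousOn)
  -- The bound θ ≤ 1 keeps the test slope within R + 1, where L is valid. As a ≤ 1, the error in the
  -- equation is at most (1 + L)θ ≤ ε, strictly less by the first term.
  set θ := min (min ε 1) (ε / (1 + L)) with hθ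
  have hθ0 : 0 < θ := by positivity
  have hθ1 : θ ≤ 1 := (min_le_left _ _).trans (min_le_right _ _)
  have hθε : θ ≤ ε := (min_le_left _ _).trans (min_le_left _ _)
  have hθL : (1 + L) * θ ≤ ε := by
    have := min_le_right (min ε 1) (ε / (1 + L))
    rw [le_div_iff₀ (by positivity)] at this
    linarith
  obtain ⟨i, hi⟩ := hG p _ hp hc θ hθ0
  refine ⟨i, fun y hy => ⟨(hi y hy).1.trans_le hθε, ?_⟩⟩
  obtain ⟨h1, h2⟩ := hi y hy
  have hGR : |G i y| ≤ R + 1 := by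
    calc |G i y| = |p y + (G i y - p y)| := by ring_nf
      _ ≤ |p y| + |G i y - p y| := abs_add_le _ _
      _ ≤ _ := by linarith [hR y hy]
  have h3 := hL' y y (G i y) (p y) hGR ((hR y hy).trans (by linarith))
  rw [sub_self, abs_zero, zero_add] at h3
  have e : a y * G' i y + H y (G i y) - nu =
      a y * (G' i y - (nu - H y (p y)) / a y) + (H y (G i y) - H y (p y)) := by
    have := (ha y hy).ne'
    field_simp
    ring
  rw [e]
  refine (abs_add_le _ _).trans_lt ?_
  rw [abs_mul, abs_of_pos (ha y hy)]
  have h4 : a y * |G' i y - (nu - H y (p y)) / a y| < θ := by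
    have := h.a_le_one y
    nlinarith [abs_nonneg (G' i y - (nu - H y (p y)) / a y), ha y hy]
  nlinarith

end TestSlopes

/-! ### Measurability of the critical value and of the profile -/

section Measurability

variable {Ω : Type*} [MeasurableSpace Ω] {M : ℝ → ℝ} {a : ℝ → Ω → ℝ} {H : ℝ → ℝ → Ω → ℝ}

/-- By continuity the condition needs checking only on a countable dense subset of [c, d]. -/
lemma measurable_forall_mem_Icc_le {Φ : ℝ → Ω → ℝ} (c d : ℝ) (hc : ∀ ω, Continuous fun y => Φ y ω)
    (hm : ∀ y, Measurable (Φ y)) (t : ℝ) : Measurable fun ω => ∀ y ∈ Icc c d, Φ y ω ≤ t := by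
  obtain ⟨s, hsc, hsd⟩ := TopologicalSpace.exists_countable_dense (Icc c d)
  have e : (fun ω => ∀ y ∈ Icc c d, Φ y ω ≤ t) = fun ω => ∀ y : s, Φ y ω ≤ t := by
    ext ω
    refine ⟨fun h y => h _ y.1.2, fun h y hy => ?_⟩
    have hcl : IsClosed {y : Icc c d | Φ y ω ≤ t} :=
      isClosed_le ((hc ω).comp continuous_subtype_val) continuous_const
    have : closure s ⊆ {y : Icc c d | Φ y ω ≤ t} :=
      hcl.closure_subset_iff.2 fun y hy => h ⟨y, hy⟩
    exact this (hsd ⟨y, hy⟩)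
  rw [e]
  have := hsc.to_subtype
  exact Measurable.forall fun y => measurableSet_setOfPred.1 (measurableSet_le (hm _) measurable_const)

lemma measurable_forall_mem_Icc_pos (ha : ∀ ω, Continuous fun y => a y ω)
    (hm : ∀ y, Measurable (a y)) {c d : ℝ} (hcd : c ≤ d) :
    Measurable fun ω => ∀ y ∈ Icc c d, 0 < a y ω := by
  have e : (fun ω => ∀ y ∈ Icc c d, 0 < a y ω) =
      fun ω => ∃ k : ℕ, ∀ y ∈ Icc c d, - a y ω ≤ -(1 / ((k : ℝ) + 1)) := by
    ext ω
    refine ⟨fun h => ?_, fun ⟨k, hk⟩ y hy => ?_⟩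
    · obtain ⟨m, hm, hmin⟩ := isCompact_Icc.exists_isMinOn ⟨c, le_rfl, hcd⟩ (ha ω).continuousOn
      obtain ⟨k, hk⟩ := exists_nat_one_div_lt (h m hm)
      exact ⟨k, fun y hy => neg_le_neg (hk.le.trans (hmin hy))⟩
    · have h1 : 0 < 1 / ((k : ℝ) + 1) := by positivity
      linarith [hk y hy]
  rw [e]
  exact Measurable.exists fun k => measurable_forall_mem_Icc_le c d (fun ω => (ha ω).neg)
    (fun y => (hm y).neg) _

lemma measurable_exists_mem_Icc_eq_zero (ha : ∀ ω, Continuous fun y => a y ω)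
    (hm : ∀ y, Measurable (a y)) (hpos : ∀ y ω, 0 ≤ a y ω) {c d : ℝ} (hcd : c ≤ d) :
    Measurable fun ω => ∃ y ∈ Icc c d, a y ω = 0 := by
  have e : (fun ω => ∃ y ∈ Icc c d, a y ω = 0) = fun ω => ¬ ∀ y ∈ Icc c d, 0 < a y ω := by
    ext ω
    push Not
    exact exists_congr fun y => and_congr_right fun _ =>
      ⟨fun h => h.le, fun h => le_antisymm h (hpos y ω)⟩
  rw [e]
  exact (measurable_forall_mem_Icc_pos ha hm hcd).not

lemma measurable_lt_const {f : Ω → ℝ} (hf : Measurable f) (t : ℝ) : Measurable fun ω => f ω < t :=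
  measurableSet_setOfPred.1 (measurableSet_lt hf measurable_const)

lemma measurable_const_lt {f : Ω → ℝ} (hf : Measurable f) (t : ℝ) : Measurable fun ω => t < f ω :=
  measurableSet_setOfPred.1 (measurableSet_lt measurable_const hf)

/-- The Hamiltonian takes values below `mu` near all zeros of the diffusion. -/
def LowNearZeros (a : ℝ → ℝ) (H : ℝ → ℝ → ℝ) (mu : ℝ) : Prop :=
  ∀ N : ℕ, ∃ k : ℕ, ∀ x : ℚ, |(x : ℝ)| ≤ N → a x < 1 / ((k : ℝ) + 1) → ∃ q : ℚ, H x q < mu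

lemma measurable_lowNearZeros (ha_meas : ∀ x, Measurable (a x))
    (hH_meas : ∀ x p, Measurable (H x p)) (mu : ℝ) :
    Measurable fun ω => LowNearZeros (fun x => a x ω) (fun x p => H x p ω) mu := by
  unfold LowNearZeros
  exact Measurable.forall fun N => Measurable.exists fun k => Measurable.forall fun x =>
    measurable_const.imp ((measurable_lt_const (ha_meas x) _).imp
      (Measurable.exists fun q => measurable_lt_const (hH_meas x q) mu))

/-- Rational points near a zero have small a, and the slope found there is bounded by coercivity, so
it can be moved to the zero at an arbitrarily small cost, absorbed by nu - mu. -/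
lemma LowNearZeros.exists_lt {a : ℝ → ℝ} {H : ℝ → ℝ → ℝ} {mu nu z : ℝ}
    (hlow : LowNearZeros a H mu) (h : Admissible M a H) (hmu : mu < nu) (hz : a z = 0) :
    ∃ q, H z q < nu := by
  obtain ⟨N, hN⟩ := exists_nat_gt (|z| + 1)
  obtain ⟨k, hk⟩ := hlow N
  obtain ⟨L, hL, hL'⟩ := h.H_lip (M mu)
  have hk0 : 0 < 1 / ((k : ℝ) + 1) := by positivity
  obtain ⟨δ, hδ, hδ'⟩ := Metric.eventually_nhds_iff.1
    (h.continuous_a.continuousAt.eventually (gt_mem_nhds (show a z < 1 / ((k : ℝ) + 1) by rwa [hz])))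
  set θ := min δ (min 1 ((nu - mu) / L)) with hθ
  have hθ0 : 0 < θ := lt_min hδ (lt_min one_pos (div_pos (by linarith) hL))
  obtain ⟨x, hx1, hx2⟩ := exists_rat_btwn (show z < z + θ by linarith)
  have hxz : |(x : ℝ) - z| < θ := by rw [abs_lt]; constructor <;> linarith
  have hx3 : |(x : ℝ)| ≤ N := by
    have h1 : θ ≤ 1 := (min_le_right _ _).trans (min_le_left _ _)
    calc |(x : ℝ)| = |z + (x - z)| := by ring_nf
      _ ≤ |z| + |(x : ℝ) - z| := abs_add_le _ _
      _ ≤ _ := by linarith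
  obtain ⟨q, hq⟩ := hk x hx3 (hδ' (hxz.trans_le (min_le_left _ _)))
  have hqM := (h.abs_lt_of_H_le hq.le).le
  have h2 := (abs_le.1 (hL' z x q q hqM hqM)).2
  rw [sub_self, abs_zero, add_zero, abs_sub_comm] at h2
  have h3 : L * |(x : ℝ) - z| ≤ nu - mu := by
    have h4 : |(x : ℝ) - z| ≤ (nu - mu) / L :=
      hxz.le.trans ((min_le_right _ _).trans (min_le_right _ _))
    rw [le_div_iff₀ hL] at h4
    linarith
  exact ⟨q, by linarith⟩

/-- The points of [-N, N] where H is at least mu at all rational slopes form a compact set without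
zeros of a. The minimum of a over it, if any, is positive and provides k. -/
lemma Admissible.lowNearZeros {a : ℝ → ℝ} {H : ℝ → ℝ → ℝ} {mu : ℝ}
    (h : Admissible M a H) (hlow : ∀ z, a z = 0 → ∃ q, H z q < mu) : LowNearZeros a H mu := by
  intro N
  set S : Set ℝ := Icc (-N : ℝ) N ∩ ⋂ q : ℚ, {x | mu ≤ H x q} with hS
  have hSc : IsCompact S := isCompact_Icc.inter_right
    (isClosed_iInter fun q => isClosed_le continuous_const
      (h.continuous_H_comp continuous_id continuous_const))
  have key : ∃ k : ℕ, ∀ x ∈ S, 1 / ((k : ℝ) + 1) < a x := by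
    rcases S.eq_empty_or_nonempty with hE | hne
    · exact ⟨0, fun x hx => by simp [hE] at hx⟩
    obtain ⟨m, hm, hmin⟩ := hSc.exists_isMinOn hne h.continuous_a.continuousOn
    have hpos : 0 < a m := h.a_pos fun h0 => by
      obtain ⟨q, hq⟩ := hlow m h0
      have hev := (h.continuous_H_comp (f := fun _ => m) continuous_const
        continuous_id).continuousAt.eventually (gt_mem_nhds hq)
      obtain ⟨δ, hδ, hδ'⟩ := Metric.eventually_nhds_iff.1 hev
      obtain ⟨x, hx1, hx2⟩ := exists_rat_btwn (show q < q + δ by linarith)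
      have h1 : H m x < mu := hδ' (by rw [Real.dist_eq, abs_lt]; constructor <;> linarith)
      have h2 : mu ≤ H m x := mem_iInter.1 hm.2 x
      linarith
    obtain ⟨k, hk⟩ := exists_nat_one_div_lt hpos
    exact ⟨k, fun x hx => hk.trans_le (hmin hx)⟩
  obtain ⟨k, hk⟩ := key
  refine ⟨k, fun x hx hxa => ?_⟩
  by_contra! hcon
  have := hk x ⟨abs_le.1 hx, mem_iInter.2 hcon⟩
  linarith

/-- Up to exceptional `ω`, the sublevel sets of the critical value are measurable. -/
theorem exists_measurable_criticalValue_lt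
    (hadm : ∀ ω, Admissible M (fun x => a x ω) (fun x p => H x p ω))
    (ha_meas : ∀ x, Measurable (a x)) (hH_meas : ∀ x p, Measurable (H x p)) (lam : ℝ) :
    ∃ E : Ω → Prop, Measurable E ∧
    ∀ ω, HasBoundedComponents (fun x => a x ω) →
      (criticalValue (fun x => a x ω) (fun x p => H x p ω) < lam ↔ E ω) := by
  choose G G' hG hG'c hGd using exists_dense_C1_family
  have hac : ∀ ω, Continuous fun y => a y ω := fun ω => (hadm ω).continuous_a
  set R := M lam + 2 with hR
  -- The event says that barriers exist at some rational level below lam, with rational intervals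
  -- and test slopes only. An approximate solution of size M lam + 1 with error below 1 stays within
  -- R = M lam + 2.
  refine ⟨fun ω => ∃ mu : ℚ, (mu : ℝ) < lam ∧ LowNearZeros (fun x => a x ω) (fun x p => H x p ω) mu ∧
    ∀ c d : ℚ, (c : ℝ) ≤ d → (∀ y ∈ Icc (c : ℝ) d, 0 < a y ω) → ∃ i, (∀ y ∈ Icc (c : ℝ) d,
      |G c d i y| ≤ R) ∧ ∀ y ∈ Icc (c : ℝ) d, a y ω * G' c d i y + H y (G c d i y) ω ≤ mu,
    ?_, fun ω hω => ?_⟩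
  · refine Measurable.exists fun mu => measurable_const.and
      ((measurable_lowNearZeros ha_meas hH_meas mu).and ?_)
    refine Measurable.forall fun c => Measurable.forall fun d => ?_
    by_cases hcd : (c : ℝ) ≤ d
    swap
    · simp only [hcd, false_imp_iff]; exact measurable_const
    simp only [hcd, true_imp_iff]
    refine (measurable_forall_mem_Icc_pos hac ha_meas hcd).imp (Measurable.exists fun i =>
      measurable_const.and (measurable_forall_mem_Icc_le c d (fun ω => ?_) (fun y => ?_) mu))
    · have hGc : Continuous (G c d i) :=
        continuous_iff_continuousAt.2 fun y => (hG c d i y).continuousAt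
      exact ((hac ω).mul (hG'c c d i)).add ((hadm ω).continuous_H_comp continuous_id hGc)
    · exact ((ha_meas y).mul_const _).add (hH_meas y _)
  have h := hadm ω
  obtain ⟨⟨x₁, hx₁⟩, hz⟩ := (hasBoundedComponents_iff h.a_nonneg).1 hω
  constructor
  · intro hlt
    obtain ⟨mu₀, hmu₀, w, hw⟩ := h.exists_supersolution_of_criticalValue_lt hlt
    obtain ⟨mu, hmu1, hmu2⟩ := exists_rat_btwn hmu₀
    obtain ⟨mu₁, hmu₁, hmu₁'⟩ := exists_between hmu1
    refine ⟨mu, hmu2, h.lowNearZeros fun z hz0 => hw.exists_H_lt_of_a_eq_zero h hz0 hmu1,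
      fun c d hcd hpos => ?_⟩
    have hM := h.mono_M (by linarith : mu₁ ≤ lam)
    obtain ⟨p, hp, hpR⟩ := hw.exists_solvesOn h hmu₁ (show M mu₁ < M lam + 1 by linarith) hcd hpos
    obtain ⟨i, hi⟩ := hp.exists_test_slope h hpos hpR (hGd c d hcd)
      (ε := min 1 (mu - mu₁)) (lt_min one_pos (by linarith))
    refine ⟨i, fun y hy => ?_, fun y hy => ?_⟩
    · have h1 := (hi y hy).1.trans_le (min_le_left _ _)
      calc |G c d i y| = |p y + (G c d i y - p y)| := by ring_nf
        _ ≤ |p y| + |G c d i y - p y| := abs_add_le _ _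
        _ ≤ _ := by linarith [hpR y hy]
    · have h1 := (abs_lt.1 ((hi y hy).2.trans_le (min_le_right _ _))).2
      linarith
  · rintro ⟨mu, hmu, hlow, hbar⟩
    -- Two levels are inserted between mu and lam: nu absorbs the passage from rational points to
    -- zeros, and nu' > nu carries the profile, whose primitive is a supersolution below lam.
    obtain ⟨nu, hnu1, hnu2⟩ := exists_between hmu
    obtain ⟨nu', hnu1', hnu2'⟩ := exists_between hnu2
    have hB : HasBarriers (fun x => a x ω) (fun x p => H x p ω) nu R := by
      refine ⟨fun z hz0 => ?_, fun c d hcd hpos => ?_⟩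
      · obtain ⟨q, hq⟩ := hlow.exists_lt h hnu1 hz0
        exact ⟨q, hq.le⟩
      · obtain ⟨δ₁, hδ₁, hδ₁'⟩ := Metric.eventually_nhds_iff.1
          ((hac ω).continuousAt.eventually (lt_mem_nhds (hpos c ⟨le_rfl, hcd⟩)))
        obtain ⟨δ₂, hδ₂, hδ₂'⟩ := Metric.eventually_nhds_iff.1
          ((hac ω).continuousAt.eventually (lt_mem_nhds (hpos d ⟨hcd, le_rfl⟩)))
        -- A rational interval slightly larger than [c, d], on which a is still positive.
        obtain ⟨c', hc1, hc2⟩ := exists_rat_btwn (show c - δ₁ < c by linarith)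
        obtain ⟨d', hd1, hd2⟩ := exists_rat_btwn (show d < d + δ₂ by linarith)
        have hsub : Icc c d ⊆ Icc (c' : ℝ) d' := Icc_subset_Icc hc2.le hd1.le
        obtain ⟨i, hi1, hi2⟩ := hbar c' d' (by linarith) fun y hy => by
          rcases lt_or_ge y c with hyc | hyc
          · exact hδ₁' (by rw [Real.dist_eq, abs_lt]; constructor <;> linarith [hy.1])
          rcases le_or_gt y d with hyd | hyd
          · exact hpos y ⟨hyc, hyd⟩
          · exact hδ₂' (by rw [Real.dist_eq, abs_lt]; constructor <;> linarith [hy.2])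
        exact ⟨G c' d' i, G' c' d' i, fun y _ => (hG c' d' i y).hasDerivWithinAt,
          fun y hy => hi1 y (hsub hy), fun y hy => (hi2 y (hsub hy)).trans hnu1.le⟩
    have hM := h.mono_M hnu2'.le
    obtain ⟨p, hp, hpR⟩ := h.exists_isUpperProfile hz hnu1' (show M nu' ≤ R by linarith) hB
    obtain ⟨u, -, hu, -, -⟩ := hp.exists_solution h hpR
    obtain ⟨⟨z, -, hz0⟩, -⟩ := hz x₁ (h.a_pos hx₁)
    exact (csInf_le (h.bddBelow_supersolution hz0) ⟨u, hu.2⟩).trans_lt hnu2'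

/-- Up to exceptional `ω`, the sublevel sets of the upper profile are measurable. -/
theorem exists_measurable_profile_lt
    (hadm : ∀ ω, Admissible M (fun x => a x ω) (fun x p => H x p ω))
    (ha_meas : ∀ x, Measurable (a x)) (hH_meas : ∀ x p, Measurable (H x p)) (lam x t : ℝ) :
    ∃ E : Ω → Prop, Measurable E ∧
    ∀ ω p, HasZerosOnBothSides (fun x => a x ω) →
      IsUpperProfile (fun x => a x ω) (fun x p => H x p ω) lam p → (∀ x, |p x| ≤ M lam + 1) →
      (p x < t ↔ E ω) := by
  choose G G' hG hG'c hGd using exists_dense_C1_family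
  have hac : ∀ ω, Continuous fun y => a y ω := fun ω => (hadm ω).continuous_a
  -- At a zero of a, the sign of H at t together with a rational slope below t locates the larger
  -- root. Elsewhere the event asks for a strict test supersolution that starts above every
  -- admissible profile value and ends below t.
  refine ⟨fun ω => (a x ω = 0 ∧ lam < H x t ω ∧ ∃ q : ℚ, (q : ℝ) < t ∧ H x q ω < lam) ∨
    (0 < a x ω ∧ ∃ c : ℚ, (c : ℝ) ≤ x ∧ (∀ y ∈ Icc (c : ℝ) x, 0 < a y ω) ∧ ∃ i, ∃ m : ℕ,
      M lam + 1 ≤ G c x i c ∧ (∀ y ∈ Icc (c : ℝ) x,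
        -(a y ω * G' c x i y + H y (G c x i y) ω) ≤ -(lam + 1 / ((m : ℝ) + 1))) ∧
      G c x i x < t), ?_, fun ω p hz hp hpR => ?_⟩
  · refine Measurable.or ?_ ?_
    · refine (measurableSet_setOfPred.1 (measurableSet_eq_fun (ha_meas x) measurable_const)).and
        ((measurable_const_lt (hH_meas x t) lam).and (Measurable.exists fun q =>
          measurable_const.and (measurable_lt_const (hH_meas x q) lam)))
    · refine (measurable_const_lt (ha_meas x) 0).and (Measurable.exists fun c => ?_)
      by_cases hcx : (c : ℝ) ≤ x
      swap
      · simp only [hcx, false_and]; exact measurable_const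
      simp only [hcx, true_and]
      refine (measurable_forall_mem_Icc_pos hac ha_meas hcx).and (Measurable.exists fun i =>
        Measurable.exists fun m => measurable_const.and
          ((measurable_forall_mem_Icc_le c x (fun ω => ?_) (fun y => ?_) _).and measurable_const))
      · have hGc : Continuous (G c x i) :=
          continuous_iff_continuousAt.2 fun y => (hG c x i y).continuousAt
        exact (((hac ω).mul (hG'c c x i)).add
          ((hadm ω).continuous_H_comp continuous_id hGc)).neg
      · exact (((ha_meas y).mul_const _).add (hH_meas y _)).neg
  have h := hadm ω
  by_cases hx : a x ω = 0
  · have hroot := hp.root x hx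
    simp only [hx, true_and, lt_irrefl, false_and, or_false]
    constructor
    · intro hlt
      refine ⟨hroot.lt_H h hlt, ?_⟩
      obtain ⟨q₀, hq₀, hq⟩ := hroot.H_lt h
      obtain ⟨q, hq1, hq2⟩ := exists_rat_btwn hq₀
      exact ⟨q, hq2.trans hlt, hq q hq1.le hq2⟩
    · rintro ⟨h1, q, hq1, hq2⟩
      exact hroot.lt_of_lt_H h hq1 hq2 h1
  have hx0 : 0 < a x ω := h.a_pos hx
  simp only [hx, false_and, false_or, hx0, true_and]
  constructor
  swap
  · rintro ⟨c, hcx, hpos, i, m, hGc, hGH, hGt⟩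
    refine lt_of_le_of_lt ?_ hGt
    refine le_of_deriv_lt_of_eq (c := c) (d := x)
      (fun y hy => (hp.ode y (hpos y hy)).hasDerivWithinAt)
      (fun y _ => (hG c x i y).hasDerivWithinAt) ((abs_le.1 (hpR c)).2.trans hGc)
      (fun y hy he => ?_) x ⟨hcx, le_rfl⟩
    rw [div_lt_iff₀ (hpos y hy), he]
    have h1 : 0 < 1 / ((m : ℝ) + 1) := by positivity
    have := hGH y hy
    linarith
  intro hlt
  obtain ⟨l, r, hI, hxI⟩ := hz.exists_isComponent h hx0
  by_contra hcon
  have hsol := hp.solvesOnIoo hI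
  -- If no test slope ends below t, then solutions at levels slightly above lam, started from R ever
  -- closer to l, all stay at or above t' > p x at x. Their limit is a solution at level lam above p
  -- which issues from the same larger root, so it equals p, a contradiction.
  set R := M (lam + 1) + 2 with hR
  have hMM := h.mono_M (by linarith : lam ≤ lam + 1)
  obtain ⟨c₀, e₀, hcd₁, hc₀, -⟩ := exists_seq_tendsto_endpoints hxI.1
  obtain ⟨e₁, d, hcd₂, -, hd⟩ := exists_seq_tendsto_endpoints hxI.2
  have hcr : ∀ n, ∃ c : ℚ, l < (c : ℝ) ∧ (c : ℝ) < c₀ n := fun n => exists_rat_btwn (hcd₁ n).1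
  choose c hc1 hc2 using hcr
  have hcx : ∀ n, (c n : ℝ) < x := fun n =>
    (hc2 n).trans_le ((hcd₁ n).2.1.trans (hcd₁ n).2.2.le)
  have hxd : ∀ n, x < d n := fun n => (hcd₂ n).1.trans_le (hcd₂ n).2.1
  have hdr : ∀ n, d n < r := fun n => (hcd₂ n).2.2
  have hc : Tendsto (fun n => (c n : ℝ)) atTop (𝓝 l) :=
    tendsto_of_tendsto_of_tendsto_of_le_of_le tendsto_const_nhds hc₀ (fun n => (hc1 n).le)
      fun n => (hc2 n).le
  have hmu : Tendsto (fun n : ℕ => lam + 1 / ((n : ℝ) + 1)) atTop (𝓝 lam) := by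
    simpa using tendsto_one_div_add_atTop_nhds_zero_nat.const_add lam
  have hposI : ∀ n, ∀ y ∈ Icc (c n : ℝ) (d n), 0 < a y ω := fun n y hy =>
    hI.pos y ⟨(hc1 n).trans_le hy.1, hy.2.trans_lt (hdr n)⟩
  have step : ∀ n : ℕ, ∃ q : ℝ → ℝ, q (c n) = R ∧
      SolvesOn (fun x => a x ω) (fun x p => H x p ω) (lam + 1 / ((n : ℝ) + 1)) (c n) (d n) q ∧
      ∀ y ∈ Icc (c n : ℝ) (d n), |q y| ≤ R ∧ p y ≤ q y := fun n => by
    have h1 : 0 < 1 / ((n : ℝ) + 1) := by positivity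
    have h2 : 1 / ((n : ℝ) + 1) ≤ 1 := by
      rw [div_le_one (by positivity)]; linarith [n.cast_nonneg (α := ℝ)]
    have h3 := h.mono_M (by linarith : lam + 1 / ((n : ℝ) + 1) ≤ lam + 1)
    refine h.exists_solvesOn_of_barrier ((hcx n).trans (hxd n)).le (hposI n) (by linarith)
      (mu := lam) (by linarith) (hsol.solvesOn (hc1 n) (hdr n))
      (fun y _ => (hpR y).trans (by linarith)) (fun y hy => ?_)
    rw [mul_div_cancel₀ _ (hposI n y hy).ne']
    linarith
  choose q hqc hq hqR using step
  set t' := (p x + t) / 2 with ht'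
  have hqt : ∀ n, t' ≤ q n x := fun n => by
    by_contra! hlt'
    have h1 : 0 < 1 / ((n : ℝ) + 1) := by positivity
    obtain ⟨i, hi⟩ := ((hq n).mono le_rfl (hxd n).le).exists_test_slope h
      (fun y hy => hposI n y ⟨hy.1, hy.2.trans (hxd n).le⟩)
      (fun y hy => (hqR n y ⟨hy.1, hy.2.trans (hxd n).le⟩).1) (hGd (c n) x (hcx n).le)
      (ε := min (min 1 (t - t')) (1 / ((n : ℝ) + 1) / 2))
      (lt_min (lt_min one_pos (by linarith)) (by linarith))
    -- With m = 2n + 1 the excess 1/(m + 1) is half of 1/(n + 1); the other half is spent on the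
    -- approximation.
    refine hcon ⟨c n, (hcx n).le, fun y hy => hposI n y ⟨hy.1, hy.2.trans (hxd n).le⟩, i,
      2 * n + 1, ?_, fun y hy => ?_, ?_⟩
    · have h2 := (abs_lt.1 ((hi (c n) ⟨le_rfl, (hcx n).le⟩).1.trans_le
        ((min_le_left _ _).trans (min_le_left _ _)))).1
      rw [hqc n] at h2
      linarith
    · have h2 := (abs_lt.1 ((hi y hy).2.trans_le (min_le_right _ _))).1
      have h3 : 1 / (((2 * n + 1 : ℕ) : ℝ) + 1) = 1 / ((n : ℝ) + 1) / 2 := by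
        push_cast
        field_simp
        ring
      rw [h3]
      linarith
    · have h2 := (abs_lt.1 ((hi x ⟨(hcx n).le, le_rfl⟩).1.trans_le
        ((min_le_left _ _).trans (min_le_right _ _)))).2
      linarith
  obtain ⟨Q, hQ, hQk⟩ := h.exists_limit_solution hI.pos hc hd hmu hq fun n y hy => (hqR n y hy).1
  have hQs : SolvesOnIoo (fun x => a x ω) (fun x p => H x p ω) lam l r Q := fun y hy => (hQ y hy).1
  have hQp : ∀ y ∈ Ioo l r, p y ≤ Q y := fun y hy => hQk y hy _ (by
    filter_upwards [hc.eventually (Iic_mem_nhds hy.1), hd.eventually (Ici_mem_nhds hy.2)]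
      with n h1 h2 using (hqR n y ⟨h1, h2⟩).2)
  have hQx : t' ≤ Q x := hQk x hxI _ (Eventually.of_forall hqt)
  obtain ⟨P, hP, hQP⟩ := h.exists_tendsto_left hI.lt hI.left hI.pos hQs fun y hy => (hQ y hy).2
  have hpl : Tendsto p (𝓝[>] l) (𝓝 (p l)) := (hp.cont.tendsto l).mono_left nhdsWithin_le_nhds
  have hroot := hp.root l hI.left
  -- The limit of Q is a root, hence at most the larger one, and at least p l because Q ≥ p.
  have hPl : P = p l := le_antisymm (hroot.le_of_H_le h hP.le)
    (le_of_tendsto_of_tendsto hpl hQP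
      (by filter_upwards [Ioo_mem_nhdsGT hI.lt] with y hy using hQp y hy))
  rw [hPl] at hQP
  have := hsol.eq_of_tendsto h hI.lt hI.pos hroot hQs hpl hQP (R := R)
    (fun y _ => (hpR y).trans (by linarith)) (fun y hy => (hQ y hy).2) x hxI
  linarith

end Measurability

/-! ### Invariance under shifts and reflections -/

section Symmetries

variable {a : ℝ → ℝ} {H : ℝ → ℝ → ℝ} {lam : ℝ}

lemma criticalValue_translate (z : ℝ) :
    criticalValue (fun x => a (x + z)) (fun x p => H (x + z) p) = criticalValue a H := by
  unfold criticalValue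
  congr 1
  ext lam
  refine ⟨fun ⟨u, hu⟩ => ⟨fun x => u (x + -z), ?_⟩, fun ⟨u, hu⟩ => ⟨_, hu.translate z⟩⟩
  simpa using hu.translate (-z)

lemma criticalValue_reflect :
    criticalValue (fun x => a (-x)) (fun x p => H (-x) (-p)) = criticalValue a H := by
  unfold criticalValue
  congr 1
  ext lam
  refine ⟨fun ⟨u, hu⟩ => ⟨fun x => u (-x), ?_⟩, fun ⟨u, hu⟩ => ⟨_, hu.reflect⟩⟩
  simpa using hu.reflect

lemma HasZerosOnBothSides.translate (hz : HasZerosOnBothSides a) (z : ℝ) :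
    HasZerosOnBothSides fun x => a (x + z) := by
  intro x hx
  obtain ⟨⟨l, hl, hl0⟩, r, hr, hr0⟩ := hz _ hx
  exact ⟨⟨l - z, by linarith, by simpa using hl0⟩, r - z, by linarith, by simpa using hr0⟩

lemma HasZerosOnBothSides.reflect (hz : HasZerosOnBothSides a) :
    HasZerosOnBothSides fun x => a (-x) := by
  intro x hx
  obtain ⟨⟨l, hl, hl0⟩, r, hr, hr0⟩ := hz _ hx
  exact ⟨⟨-r, by linarith, by simpa using hr0⟩, -l, by linarith, by simpa using hl0⟩

lemma HasBoundedComponents.translate (ha : ∀ x, 0 ≤ a x) (h : HasBoundedComponents a) (z : ℝ) :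
    HasBoundedComponents fun x => a (x + z) := by
  obtain ⟨⟨x, hx⟩, hz⟩ := (hasBoundedComponents_iff ha).1 h
  exact (hasBoundedComponents_iff fun x => ha _).2
    ⟨⟨x - z, by simpa using hx⟩, hz.translate z⟩

lemma HasBoundedComponents.reflect (ha : ∀ x, 0 ≤ a x) (h : HasBoundedComponents a) :
    HasBoundedComponents fun x => a (-x) := by
  obtain ⟨⟨x, hx⟩, hz⟩ := (hasBoundedComponents_iff ha).1 h
  exact (hasBoundedComponents_iff fun x => ha _).2 ⟨⟨-x, by simpa using hx⟩, hz.reflect⟩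

lemma IsUpperProfile.translate {p : ℝ → ℝ} (hp : IsUpperProfile a H lam p) (z : ℝ) :
    IsUpperProfile (fun x => a (x + z)) (fun x p => H (x + z) p) lam (fun x => p (x + z)) where
  cont := hp.cont.comp (continuous_add_const z)
  bdd := hp.bdd.imp fun _ h _ => h _
  ode x hx := (hp.ode (x + z) hx).comp_add_const x z
  root x hx := hp.root (x + z) hx

end Symmetries

/-! ### Random environments: correctors, measurability, stationarity -/

section Flow

variable {Ω : Type*} {τ : ℝ → Ω → Ω} {M : ℝ → ℝ}
  {a : ℝ → Ω → ℝ} {H : ℝ → ℝ → Ω → ℝ} {lam0 lam : ℝ} {Ωhat : Set Ω} {v : Ω → ℝ → ℝ}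

/-- If a stationary diffusion vanishes somewhere, almost surely, then it has arbitrarily large
zeros, almost surely. -/
lemma ae_exists_large_zero [MeasurableSpace Ω] {P : Measure Ω} [IsProbabilityMeasure P]
    (hτ : ∀ x, MeasurePreserving (τ x) P P)
    (hac : ∀ ω, Continuous fun y => a y ω) (ha_meas : ∀ x, Measurable (a x))
    (ha0 : ∀ x ω, 0 ≤ a x ω) (ha_stat : ∀ x y ω, a (x + y) ω = a x (τ y ω))
    (hzero : ∀ᵐ ω ∂P, ∃ x, a x ω = 0) : ∀ᵐ ω ∂P, ∀ x, ∃ y > x, a y ω = 0 := by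
  set Z : ℝ → Set Ω := fun s => {ω | ∃ y ≥ s, a y ω = 0} with hZ
  have hZm : ∀ s, MeasurableSet (Z s) := fun s => by
    have e : Z s = {ω | ∃ k : ℕ, ∃ y ∈ Icc s (s + k), a y ω = 0} := by
      ext ω
      refine ⟨fun ⟨y, hy, hy0⟩ => ?_, fun ⟨k, y, hy, hy0⟩ => ⟨y, hy.1, hy0⟩⟩
      obtain ⟨k, hk⟩ := exists_nat_ge (y - s)
      exact ⟨k, y, ⟨hy, by linarith⟩, hy0⟩
    rw [e]
    exact measurableSet_setOfPred.2 (Measurable.exists fun k =>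
      measurable_exists_mem_Icc_eq_zero hac ha_meas ha0 (by simp))
  have hZτ : ∀ s, τ s ⁻¹' Z 0 = Z s := fun s => by
    ext ω
    simp only [hZ, mem_preimage, mem_ofPred_eq, ← ha_stat]
    exact ⟨fun ⟨y, hy, hy0⟩ => ⟨y + s, by linarith, hy0⟩,
      fun ⟨y, hy, hy0⟩ => ⟨y - s, by linarith, by simpa using hy0⟩⟩
  -- All the events Z s have the same probability by stationarity. They increase to an event of
  -- probability one as s → -∞, so each of them has probability one.
  have hZP : ∀ s, P (Z s) = P (Z 0) := fun s => by
    rw [← hZτ s, (hτ s).measure_preimage (hZm 0).nullMeasurableSet]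
  have hmono : Monotone fun n : ℕ => Z (-(n : ℝ)) := fun m n hmn ω ⟨y, hy, hy0⟩ =>
    ⟨y, by have : (m : ℝ) ≤ n := by exact_mod_cast hmn
           linarith, hy0⟩
  have hU : P (⋃ n : ℕ, Z (-(n : ℝ))) = 1 := by
    rw [← mem_ae_iff_prob_eq_one (MeasurableSet.iUnion fun n => hZm _)]
    filter_upwards [hzero] with ω ⟨x, hx⟩
    obtain ⟨n, hn⟩ := exists_nat_ge (-x)
    exact mem_iUnion.2 ⟨n, x, by linarith, hx⟩
  have h0 : P (Z 0) = 1 := by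
    rw [hmono.measure_iUnion] at hU
    simpa [hZP] using hU
  have hae : ∀ᵐ ω ∂P, ∀ n : ℕ, ω ∈ Z n := ae_all_iff.2 fun n =>
    (mem_ae_iff_prob_eq_one (hZm n)).2 ((hZP n).trans h0)
  filter_upwards [hae] with ω hω x
  obtain ⟨n, hn⟩ := exists_nat_gt x
  obtain ⟨y, hy, hy0⟩ := hω n
  exact ⟨y, by linarith, hy0⟩

lemma ae_hasBoundedComponents [MeasurableSpace Ω] {P : Measure Ω} [IsProbabilityMeasure P]
    (hτ : ∀ x, MeasurePreserving (τ x) P P)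
    (hac : ∀ ω, Continuous fun y => a y ω) (ha_meas : ∀ x, Measurable (a x))
    (ha0 : ∀ x ω, 0 ≤ a x ω) (ha_stat : ∀ x y ω, a (x + y) ω = a x (τ y ω))
    (hne : ∀ᵐ ω ∂P, ∃ x, a x ω ≠ 0) (hzero : ∀ᵐ ω ∂P, ∃ x, a x ω = 0) :
    ∀ᵐ ω ∂P, HasBoundedComponents fun x => a x ω := by
  have hr := ae_exists_large_zero hτ hac ha_meas ha0 ha_stat hzero
  have hl := ae_exists_large_zero (a := fun x ω => a (-x) ω) (τ := fun x => τ (-x))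
    (fun x => hτ _) (fun ω => (hac ω).comp continuous_neg) (fun x => ha_meas _) (fun x => ha0 _)
    (fun x y ω => by rw [neg_add, ha_stat])
    (hzero.mono fun ω ⟨x, hx⟩ => ⟨-x, by simpa using hx⟩)
  filter_upwards [hr, hl, hne] with ω hr hl hne
  refine (hasBoundedComponents_iff fun x => ha0 x ω).2 ⟨hne, fun x _ => ⟨?_, hr x⟩⟩
  obtain ⟨y, hy, hy0⟩ := hl (-x)
  exact ⟨-y, by linarith, hy0⟩

lemma criticalValue_flow (ha_stat : ∀ x y ω, a (x + y) ω = a x (τ y ω))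
    (hH_stat : ∀ x y p ω, H (x + y) p ω = H x p (τ y ω)) (z : ℝ) (ω : Ω) :
    criticalValue (fun x => a x (τ z ω)) (fun x p => H x p (τ z ω)) =
      criticalValue (fun x => a x ω) (fun x p => H x p ω) := by
  simp only [← ha_stat, ← hH_stat]
  exact criticalValue_translate (a := fun x => a x ω) (H := fun x p => H x p ω) z

/-- Each sublevel set agrees with a measurable event off a null set, and completeness of P removes
the exception. -/
lemma measurable_criticalValue [MeasurableSpace Ω] {P : Measure Ω} [P.IsComplete]
    (hadm : ∀ ω, Admissible M (fun x => a x ω) (fun x p => H x p ω))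
    (ha_meas : ∀ x, Measurable (a x)) (hH_meas : ∀ x p, Measurable (H x p))
    (hbc : ∀ᵐ ω ∂P, HasBoundedComponents fun x => a x ω) :
    Measurable fun ω => criticalValue (fun x => a x ω) (fun x p => H x p ω) := by
  refine measurable_of_Iio fun t => ?_
  obtain ⟨E, hE, hiff⟩ := exists_measurable_criticalValue_lt hadm ha_meas hH_meas t
  refine NullMeasurableSet.measurable_of_complete
    ((measurableSet_setOfPred.2 hE).nullMeasurableSet.congr ?_) (μ := P)
  filter_upwards [hbc] with ω hω
  exact propext (hiff ω hω).symm

lemma flow_mem_regularSet (hτ0 : ∀ ω, τ 0 ω = ω) (hτ : ∀ x y ω, τ (x + y) ω = τ x (τ y ω))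
    (ha0 : ∀ x ω, 0 ≤ a x ω) (ha_stat : ∀ x y ω, a (x + y) ω = a x (τ y ω))
    (hH_stat : ∀ x y p ω, H (x + y) p ω = H x p (τ y ω)) (z : ℝ) (ω : Ω) :
    τ z ω ∈ regularSet a H lam0 ↔ ω ∈ regularSet a H lam0 := by
  have key : ∀ z ω, ω ∈ regularSet a H lam0 → τ z ω ∈ regularSet a H lam0 := fun z ω h => by
    refine ⟨?_, (criticalValue_flow ha_stat hH_stat z ω).trans h.2⟩
    simp only [← ha_stat]
    exact h.1.translate (fun x => ha0 x ω) z
  refine ⟨fun h => ?_, key z ω⟩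
  have := key (-z) _ h
  rwa [← hτ, neg_add_cancel, hτ0] at this

lemma exists_isCriticalFamily (hadm : ∀ ω, Admissible M (fun x => a x ω) (fun x p => H x p ω))
    (hΩ : Ωhat ⊆ regularSet a H lam0) : ∃ v, IsCriticalFamily a H lam0 Ωhat v := by
  classical
  have key : ∀ ω, ∃ w : ℝ → ℝ, (ω ∈ Ωhat → IsLip w ∧
      IsViscositySolution (fun x => a x ω) (fun x p => H x p ω) lam0 w ∧ w 0 = 0) ∧
      (ω ∉ Ωhat → ∀ x, w x = 0) := fun ω => by
    by_cases hω : ω ∈ Ωhat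
    · obtain ⟨w, hw⟩ := (hadm ω).exists_critical_solution
        ((hasBoundedComponents_iff (hadm ω).a_nonneg).1 (hΩ hω).1).2
      rw [(hΩ hω).2] at hw
      exact ⟨w, fun _ => hw, fun h => absurd hω h⟩
    · exact ⟨fun _ => 0, fun h => absurd h hω, fun _ _ => rfl⟩
  choose v hv using key
  exact ⟨v, fun ω => (hv ω).1, fun ω => (hv ω).2⟩

/-- A function on `ℝ × Ω` which is continuous in the first variable and measurable in the second
is jointly measurable. -/
lemma measurable_prod_of_continuous [MeasurableSpace Ω] {f : ℝ → Ω → ℝ}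
    (hc : ∀ ω, Continuous fun x => f x ω)
    (hm : ∀ x, Measurable (f x)) : Measurable fun q : ℝ × Ω => f q.1 q.2 :=
  measurable_uncurry_of_continuous_of_measurable hc hm

theorem existsUnique_correctorsPlus
    (hadm : ∀ ω, Admissible M (fun x => a x ω) (fun x p => H x p ω))
    (hΩ : Ωhat ⊆ regularSet a H lam0) (hv : IsCriticalFamily a H lam0 Ωhat v) (hlam : lam0 < lam)
    (ω : Ω) : ∃! u, u ∈ correctorsPlus a H Ωhat v lam ω ∧ u 0 = 0 := by
  by_cases hω : ω ∈ Ωhat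
  · have h := hadm ω
    obtain ⟨hbc, hcv⟩ := hΩ hω
    have hz := ((hasBoundedComponents_iff h.a_nonneg).1 hbc).2
    obtain ⟨hvL, hvs, -⟩ := hv.1 ω hω
    obtain ⟨p, hp, hpR⟩ := h.exists_isUpperProfile_of_criticalValue_lt hz (hcv.trans_lt hlam)
    obtain ⟨u, huL, hu, hu0, hud⟩ := hp.exists_solution h hpR
    refine ⟨u, ⟨Or.inl ⟨hω, ⟨_, huL⟩, hu, ?_⟩, hu0⟩, ?_⟩
    · filter_upwards [hp.ae_deriv_le h hz hlam hvs hvL] with x hx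
      rwa [(hud x).deriv]
    · rintro w ⟨⟨-, hwL, hw, hwle⟩ | ⟨hn, -⟩, hw0⟩
      · have hwd := hp.hasDerivAt_of_ae_le h hz hlam hvs hvL hw hwL hwle
        refine eq_of_fderiv_eq (𝕜 := ℝ) (fun x => (hwd x).differentiableAt)
          (fun x => (hud x).differentiableAt) (fun x => ?_) 0 (hw0.trans hu0.symm)
        rw [(hwd x).hasFDerivAt.fderiv, (hud x).hasFDerivAt.fderiv]
      · exact absurd hω hn
  · refine ⟨fun _ => 0, ⟨Or.inr ⟨hω, 0, rfl⟩, rfl⟩, ?_⟩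
    rintro w ⟨⟨hn, -⟩ | ⟨-, c, rfl⟩, hw0⟩
    · exact absurd hn hω
    · exact funext fun _ => hw0

/-- A corrector family is differentiable in space, its derivative being the upper profile for
the regular `ω` and zero for the others. -/
lemma hasDerivAt_correctorsPlus
    (hadm : ∀ ω, Admissible M (fun x => a x ω) (fun x p => H x p ω))
    (hΩ : Ωhat ⊆ regularSet a H lam0) (hv : IsCriticalFamily a H lam0 Ωhat v) (hlam : lam0 < lam)
    {U : ℝ → Ω → ℝ} (hU : ∀ ω, (fun x => U x ω) ∈ correctorsPlus a H Ωhat v lam ω ∧ U 0 ω = 0) :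
    ∃ p : Ω → ℝ → ℝ, (∀ ω ∈ Ωhat, IsUpperProfile (fun x => a x ω) (fun x p => H x p ω) lam (p ω) ∧
      ∀ x, |p ω x| ≤ M lam + 1) ∧ (∀ ω ∉ Ωhat, p ω = fun _ => 0) ∧
      ∀ ω x, HasDerivAt (fun y => U y ω) (p ω x) x := by
  have key : ∀ ω, ∃ p : ℝ → ℝ, (ω ∈ Ωhat →
      IsUpperProfile (fun x => a x ω) (fun x p => H x p ω) lam p ∧ ∀ x, |p x| ≤ M lam + 1) ∧
      (ω ∉ Ωhat → p = fun _ => 0) ∧ ∀ x, HasDerivAt (fun y => U y ω) (p x) x := fun ω => by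
    rcases (hU ω).1 with ⟨hω, huL, hu, hle⟩ | ⟨hω, c, hc⟩
    · have h := hadm ω
      obtain ⟨hbc, hcv⟩ := hΩ hω
      have hz := ((hasBoundedComponents_iff h.a_nonneg).1 hbc).2
      obtain ⟨hvL, hvs, -⟩ := hv.1 ω hω
      obtain ⟨p, hp, hpR⟩ := h.exists_isUpperProfile_of_criticalValue_lt hz (hcv.trans_lt hlam)
      exact ⟨p, fun _ => ⟨hp, hpR⟩, fun hn => absurd hω hn,
        hp.hasDerivAt_of_ae_le h hz hlam hvs hvL hu huL hle⟩
    · refine ⟨fun _ => 0, fun hn => absurd hn hω, fun _ => rfl, fun x => ?_⟩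
      rw [hc]
      exact hasDerivAt_const x c
  choose p hp using key
  exact ⟨p, fun ω => (hp ω).1, fun ω => (hp ω).2.1, fun ω => (hp ω).2.2⟩

theorem correctorsPlus_regularity [MeasurableSpace Ω] {P : Measure Ω} [P.IsComplete]
    (hτ : ∀ x, MeasurePreserving (τ x) P P)
    (hadm : ∀ ω, Admissible M (fun x => a x ω) (fun x p => H x p ω))
    (ha_meas : ∀ x, Measurable (a x)) (hH_meas : ∀ x p, Measurable (H x p))
    (ha_stat : ∀ x y ω, a (x + y) ω = a x (τ y ω))
    (hH_stat : ∀ x y p ω, H (x + y) p ω = H x p (τ y ω))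
    (hΩ : Ωhat ⊆ regularSet a H lam0) (hae : ∀ᵐ ω ∂P, ω ∈ Ωhat)
    (hv : IsCriticalFamily a H lam0 Ωhat v) (hlam : lam0 < lam)
    {U : ℝ → Ω → ℝ} (hU : ∀ ω, (fun x => U x ω) ∈ correctorsPlus a H Ωhat v lam ω ∧ U 0 ω = 0) :
    (∀ ω, ContDiff ℝ 1 (fun x => U x ω)) ∧ Measurable (fun q : ℝ × Ω => U q.1 q.2) ∧
      HasStationaryDeriv P τ Ωhat U := by
  obtain ⟨p, hp, hp0, hd⟩ := hasDerivAt_correctorsPlus hadm hΩ hv hlam hU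
  have hz : ∀ ω ∈ Ωhat, HasZerosOnBothSides fun x => a x ω := fun ω hω =>
    ((hasBoundedComponents_iff (hadm ω).a_nonneg).1 (hΩ hω).1).2
  have hder : ∀ ω, deriv (fun y => U y ω) = p ω := fun ω => funext fun x => (hd ω x).deriv
  have hpc : ∀ ω, Continuous (p ω) := fun ω => by
    by_cases hω : ω ∈ Ωhat
    · exact (hp ω hω).1.cont
    · rw [hp0 ω hω]; exact continuous_const
  have hUc : ∀ ω, Continuous fun x => U x ω := fun ω =>
    continuous_iff_continuousAt.2 fun x => (hd ω x).continuousAt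
  -- The profile is described by measurable events only for ω in Ωhat; completeness takes care of
  -- the remaining null set, whatever Ωhat is.
  have hpm : ∀ x, Measurable fun ω => p ω x := fun x => measurable_of_Iio fun t => by
    obtain ⟨E, hE, hiff⟩ := exists_measurable_profile_lt hadm ha_meas hH_meas lam x t
    refine NullMeasurableSet.measurable_of_complete
      ((measurableSet_setOfPred.2 hE).nullMeasurableSet.congr ?_) (μ := P)
    filter_upwards [hae] with ω hω
    exact propext (hiff ω _ (hz ω hω) (hp ω hω).1 (hp ω hω).2).symm
  have hpj : Measurable fun q : ℝ × Ω => p q.2 q.1 :=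
    measurable_prod_of_continuous (f := fun x ω => p ω x) hpc hpm
  have hUi : ∀ x ω, U x ω = ∫ t in (0 : ℝ)..x, p ω t := fun x ω => by
    rw [intervalIntegral.integral_eq_sub_of_hasDerivAt (fun t _ => hd ω t)
      ((hpc ω).intervalIntegrable _ _), (hU ω).2, sub_zero]
  have hUm : ∀ x, Measurable (U x) := fun x => by
    have e : U x = fun ω => ∫ t in (0 : ℝ)..x, p ω t := funext (hUi x)
    rw [e]
    have hs : StronglyMeasurable fun q : Ω × ℝ => p q.1 q.2 :=
      (hpj.comp measurable_swap).stronglyMeasurable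
    simp only [intervalIntegral]
    exact (hs.integral_prod_right.sub hs.integral_prod_right).measurable
  -- The shifted profile is an upper profile for the shifted environment, so uniqueness identifies
  -- the two. Both ω and τ z ω must be on the same side of Ωhat, which holds almost surely, and
  -- always if Ωhat is invariant.
  have hstat : ∀ z ω, (ω ∈ Ωhat ↔ τ z ω ∈ Ωhat) → ∀ x, p ω (x + z) = p (τ z ω) x := by
    intro z ω hiff x
    by_cases hω : ω ∈ Ωhat
    · have h1 := (hp ω hω).1.translate z
      have h2 := (hp _ (hiff.1 hω)).1
      simp only [ha_stat, hH_stat] at h1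
      exact congrFun (IsUpperProfile.unique (hadm _) (hz _ (hiff.1 hω)) h1 h2) x
    · rw [hp0 ω hω, hp0 _ (hiff.not.1 hω)]
  refine ⟨fun ω => ?_, measurable_prod_of_continuous hUc hUm, fun z => ?_, fun hinv z ω x => ?_⟩
  · rw [contDiff_one_iff_deriv, hder ω]
    exact ⟨fun x => (hd ω x).differentiableAt, hpc ω⟩
  · filter_upwards [hae, (hτ z).quasiMeasurePreserving.ae hae] with ω h1 h2 x
    rw [hder, hder, hstat z ω (iff_of_true h1 h2)]
  · rw [hder, hder, hstat z ω (hinv z ω).symm]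

lemma mem_regularSet_reflect (ha0 : ∀ x ω, 0 ≤ a x ω) {ω : Ω} (h : ω ∈ regularSet a H lam0) :
    ω ∈ regularSet (fun x ω => a (-x) ω) (fun x p ω => H (-x) (-p) ω) lam0 :=
  ⟨h.1.reflect fun x => ha0 x ω,
    (criticalValue_reflect (a := fun x => a x ω) (H := fun x p => H x p ω)).trans h.2⟩

lemma IsLip.reflect {u : ℝ → ℝ} (hu : IsLip u) : IsLip fun x => u (-x) := by
  obtain ⟨K, hK⟩ := hu
  refine ⟨K, LipschitzWith.of_dist_le_mul fun x y => ?_⟩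
  simpa [dist_neg_neg] using hK.dist_le_mul (-x) (-y)

lemma IsCriticalFamily.reflect (hv : IsCriticalFamily a H lam0 Ωhat v) :
    IsCriticalFamily (fun x ω => a (-x) ω) (fun x p ω => H (-x) (-p) ω) lam0 Ωhat
      fun ω x => v ω (-x) :=
  ⟨fun ω hω => ⟨(hv.1 ω hω).1.reflect, (hv.1 ω hω).2.1.reflect, by simpa using (hv.1 ω hω).2.2⟩,
    fun ω hω x => hv.2 ω hω _⟩

lemma ae_neg {p : ℝ → Prop} (h : ∀ᵐ x, p x) : ∀ᵐ x, p (-x) :=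
  (Measure.measurePreserving_neg (volume : Measure ℝ)).quasiMeasurePreserving.ae h

/-- Reflection reverses the sign of slopes and so exchanges the two inequalities with the critical
slope. The reflected environment is stationary for the reversed flow, and everything proved for the
upper correctors transfers. -/
lemma mem_correctorsMinus_iff {u : ℝ → ℝ} {ω : Ω} : u ∈ correctorsMinus a H Ωhat v lam ω ↔
    (fun x => u (-x)) ∈ correctorsPlus (fun x ω => a (-x) ω) (fun x p ω => H (-x) (-p) ω) Ωhat
      (fun ω x => v ω (-x)) lam ω := by
  refine or_congr (and_congr_right fun _ => and_congr ⟨fun h => h.reflect, fun h => ?_⟩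
    (and_congr ⟨fun h => h.reflect, fun h => ?_⟩ ?_))
    (and_congr_right fun _ => exists_congr fun c => ?_)
  · simpa using h.reflect
  · simpa using h.reflect
  · simp only [deriv_comp_neg, neg_le_neg_iff]
    exact ⟨fun h => ae_neg h, fun h => by simpa using ae_neg h⟩
  · exact ⟨fun h => by rw [h], fun h => funext fun x => by simpa using congrFun h (-x)⟩

theorem existsUnique_correctorsMinus
    (hadm : ∀ ω, Admissible M (fun x => a x ω) (fun x p => H x p ω))
    (hΩ : Ωhat ⊆ regularSet a H lam0) (hv : IsCriticalFamily a H lam0 Ωhat v) (hlam : lam0 < lam)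
    (ω : Ω) : ∃! u, u ∈ correctorsMinus a H Ωhat v lam ω ∧ u 0 = 0 := by
  obtain ⟨u, ⟨hu, hu0⟩, huniq⟩ := existsUnique_correctorsPlus (fun ω => (hadm ω).reflect)
    (fun ω hω => mem_regularSet_reflect (fun x ω => (hadm ω).a_nonneg x) (hΩ hω)) hv.reflect hlam ω
  refine ⟨fun x => u (-x), ⟨mem_correctorsMinus_iff.2 (by simpa using hu), by simpa using hu0⟩, ?_⟩
  rintro w ⟨hw, hw0⟩
  rw [← huniq (fun x => w (-x)) ⟨mem_correctorsMinus_iff.1 hw, by simpa using hw0⟩]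
  simp

theorem correctorsMinus_regularity [MeasurableSpace Ω] {P : Measure Ω} [P.IsComplete]
    (hτ : ∀ x, MeasurePreserving (τ x) P P)
    (hadm : ∀ ω, Admissible M (fun x => a x ω) (fun x p => H x p ω))
    (ha_meas : ∀ x, Measurable (a x)) (hH_meas : ∀ x p, Measurable (H x p))
    (ha_stat : ∀ x y ω, a (x + y) ω = a x (τ y ω))
    (hH_stat : ∀ x y p ω, H (x + y) p ω = H x p (τ y ω))
    (hΩ : Ωhat ⊆ regularSet a H lam0) (hae : ∀ᵐ ω ∂P, ω ∈ Ωhat)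
    (hv : IsCriticalFamily a H lam0 Ωhat v) (hlam : lam0 < lam)
    {U : ℝ → Ω → ℝ} (hU : ∀ ω, (fun x => U x ω) ∈ correctorsMinus a H Ωhat v lam ω ∧ U 0 ω = 0) :
    (∀ ω, ContDiff ℝ 1 (fun x => U x ω)) ∧ Measurable (fun q : ℝ × Ω => U q.1 q.2) ∧
      HasStationaryDeriv P τ Ωhat U := by
  obtain ⟨h1, h2, h3, h4⟩ := correctorsPlus_regularity (P := P) (τ := fun x => τ (-x))
    (a := fun x ω => a (-x) ω) (H := fun x p ω => H (-x) (-p) ω) (v := fun ω x => v ω (-x))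
    (U := fun x ω => U (-x) ω) (fun x => hτ _)
    (fun ω => (hadm ω).reflect) (fun x => ha_meas _) (fun x p => hH_meas _ _)
    (fun x y ω => by rw [neg_add, ha_stat]) (fun x y p ω => by rw [neg_add, hH_stat])
    (fun ω hω => mem_regularSet_reflect (fun x ω => (hadm ω).a_nonneg x) (hΩ hω)) hae
    hv.reflect hlam fun ω => ⟨mem_correctorsMinus_iff.1 (hU ω).1, by simpa using (hU ω).2⟩
  have key : ∀ z ω x, deriv (fun y => U (-y) ω) (-x + -z) =
      deriv (fun y => U (-y) (τ (- -z) ω)) (-x) →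
      deriv (fun y => U y ω) (x + z) = deriv (fun y => U y (τ z ω)) x := fun z ω x h => by
    rw [deriv_comp_neg (fun y => U y ω), deriv_comp_neg (fun y => U y (τ (- -z) ω)),
      neg_inj] at h
    simpa [neg_add, add_comm] using h
  refine ⟨fun ω => ?_, ?_, fun z => ?_, fun hinv z ω x => ?_⟩
  · simpa [Function.comp_def] using (h1 ω).comp contDiff_neg
  · simpa [Function.comp_def] using h2.comp (measurable_fst.neg.prodMk measurable_snd)
  · filter_upwards [h3 (-z)] with ω hω x using key z ω x (hω (-x))
  · exact key z ω x (h4 (fun z ω => hinv (-z) ω) (-z) ω (-x))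

end Flow

/-! ### The main theorem -/

theorem theorem5p1 {Ω : Type*} [MeasurableSpace Ω] (P : Measure Ω) [IsProbabilityMeasure P]
    [P.IsComplete] (τ : ℝ → Ω → Ω) (hτ : IsErgodicFlow P τ)
    (a : ℝ → Ω → ℝ) (H : ℝ → ℝ → Ω → ℝ) (κ α₀ α₁ γ η : ℝ)
    (hκ : 0 < κ) (hα₀ : 0 < α₀) (hα₁ : 0 < α₁) (hγ : 2 < γ) (hη : 0 < η)
    (ha_meas : Measurable (fun q : ℝ × Ω => a q.1 q.2))
    (hH_meas : Measurable (fun q : ℝ × ℝ × Ω => H q.1 q.2.1 q.2.2))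
    (ha_range : ∀ x ω, 0 ≤ a x ω ∧ a x ω ≤ 1)
    (ha_stat : ∀ x y ω, a (x + y) ω = a x (τ y ω))
    (hH_stat : ∀ x y p ω, H (x + y) p ω = H x p (τ y ω))
    (hA1 : ∀ᵐ ω ∂P, (∃ x, a x ω ≠ 0) ∧ IsLeast (Set.range fun x => a x ω) 0)
    (hA2 : ∀ ω x y, |√(a x ω) - √(a y ω)| ≤ κ * |x - y|)
    (hH : ∀ ω, SqcHamiltonianClass α₀ α₁ γ η (fun x p => H x p ω)) :
    ∃ lam0 : ℝ,
      (∀ᵐ ω ∂P, criticalValue (fun x => a x ω) (fun x p => H x p ω) = lam0) ∧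
      (∀ᵐ ω ∂P, ω ∈ regularSet a H lam0) ∧
      (∀ z ω, τ z ω ∈ regularSet a H lam0 ↔ ω ∈ regularSet a H lam0) ∧
      ∀ Ωhat : Set Ω, Ωhat ⊆ regularSet a H lam0 → (∀ᵐ ω ∂P, ω ∈ Ωhat) →
        (∃ v, IsCriticalFamily a H lam0 Ωhat v) ∧
        ∀ v, IsCriticalFamily a H lam0 Ωhat v → ∀ lam, lam0 < lam →
          (∀ ω, ∃! u, u ∈ correctorsPlus a H Ωhat v lam ω ∧ u 0 = 0) ∧
          (∀ ω, ∃! u, u ∈ correctorsMinus a H Ωhat v lam ω ∧ u 0 = 0) ∧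
          (∀ U : ℝ → Ω → ℝ,
            (∀ ω, (fun x => U x ω) ∈ correctorsPlus a H Ωhat v lam ω ∧ U 0 ω = 0) →
              (∀ ω, ContDiff ℝ 1 (fun x => U x ω)) ∧
              Measurable (fun q : ℝ × Ω => U q.1 q.2) ∧
              HasStationaryDeriv P τ Ωhat U) ∧
          (∀ U : ℝ → Ω → ℝ,
            (∀ ω, (fun x => U x ω) ∈ correctorsMinus a H Ωhat v lam ω ∧ U 0 ω = 0) →
              (∀ ω, ContDiff ℝ 1 (fun x => U x ω)) ∧
              Measurable (fun q : ℝ × Ω => U q.1 q.2) ∧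
              HasStationaryDeriv P τ Ωhat U) := by
  have hadm : ∀ ω, Admissible (coercivityBound α₀ γ) (fun x => a x ω) (fun x p => H x p ω) :=
    fun ω => (hH ω).admissible hκ hα₀ hα₁ hγ (fun x => ha_range x ω) (hA2 ω)
  have ha0 : ∀ x ω, 0 ≤ a x ω := fun x ω => (ha_range x ω).1
  have hτm := hτ.measurePreserving
  have ha_meas' : ∀ x, Measurable (a x) := fun x => ha_meas.comp measurable_prodMk_left
  have hH_meas' : ∀ x p, Measurable (H x p) := fun x p =>
    hH_meas.comp (measurable_const.prodMk (measurable_const.prodMk measurable_id))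
  have hbc : ∀ᵐ ω ∂P, HasBoundedComponents fun x => a x ω :=
    ae_hasBoundedComponents hτm (fun ω => (hadm ω).continuous_a) ha_meas' ha0 ha_stat
      (hA1.mono fun ω h => h.1) (hA1.mono fun ω h => h.2.1)
  -- The critical value is shift invariant for every ω, so ergodicity makes it almost surely
  -- constant.
  obtain ⟨lam0, hlam0⟩ := hτ.ergodic _ (measurable_criticalValue hadm ha_meas' hH_meas' hbc)
    fun z => Eventually.of_forall (criticalValue_flow ha_stat hH_stat z)
  refine ⟨lam0, hlam0, hbc.and hlam0,
    flow_mem_regularSet hτ.zero hτ.add ha0 ha_stat hH_stat, fun Ωhat hΩ hae =>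
    ⟨exists_isCriticalFamily hadm hΩ, fun v hv lam hlam =>
    ⟨existsUnique_correctorsPlus hadm hΩ hv hlam, existsUnique_correctorsMinus hadm hΩ hv hlam,
      fun U hU => correctorsPlus_regularity hτm hadm ha_meas' hH_meas' ha_stat hH_stat hΩ hae hv
        hlam hU,
      fun U hU => correctorsMinus_regularity hτm hadm ha_meas' hH_meas' ha_stat hH_stat hΩ hae hv
        hlam hU⟩⟩⟩
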